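/- \textbf{Theorem.} Fix constants $\kappa,S_0\in\mathbb N$ and polynomials $p,q$. Consider $n$ qubits, a $\kappa$-local Hamiltonian $H=\sum_{i=1}^{N}H_i$ (each $H_i$ Hermitian and acting non-trivially on at most $\kappa$ qubits, not necessarily stoquastic) with $N\le p(n)$ terms, and a normalized state $|\Phi\rangle=\sum_{x\in\{0,1\}^n}\Phi(x)|x\rangle$. Assume that: (a) $|\Phi\rangle$ is supported on exactly $S$ orthonormal eigenvectors of $H$, $1\le S\le S_0$ (so $S=O(1)$), with eigenvalues $E_1,\dots,E_S\in[0,\pi]$, each occurring with probability $|\langle\psi_j|\Phi\rangle|^2\ge 1/p(n)$; (b) the gap satisfies $\Delta=\frac1{2\pi}\min_{i\ne j}|E_i-E_j|\ge 1/p(n)$ (no condition if $S=1$); (c) one can draw independent samples from the distribution $|\Phi(x)|^2$, and for given $x,y$ one can compute $\Phi(y)/\Phi(x)$ (when $\Phi(x)\neq 0$), each use of these two routines costing effort at most $p(n)$ (beyond reading and writing the bit strings). Let $g_D(k)=\langle\Phi|(I-H/2\pi)^k|\Phi\rangle$, and let $d(\{E_i\},\{\tilde E_j\})=\frac1{2\pi}\min_{\sigma\in\mathrm{Perm}_S}\max_j|\tilde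 E_{\sigma(j)}-E_j|$. Then there are a polynomial $Q$ and a single classical algorithm (a random-access machine with unit-cost exact complex arithmetic, comparisons of real parts and constants $i,\pi$, and unit-cost addition and truncated subtraction of integers), depending only on $\kappa,S_0,p,q$, which for every $n$, every such $S,H,\Phi$ and every $t\in\mathbb N$ does the following with total effort at most $Q(n+t)$: (i) For each $k=0,\dots,2S$ it draws fresh samples $x$ from $|\Phi(x)|^2$, computes for each of them, by summation over all paths $x=x_0,x_1,\dots,x_k$, the number $\mathcal R_k(x)=\sum_{x_1,\dots,x_k}\frac{\Phi(x_k)}{\Phi(x)}\prod_{i=0}^{k-1}\langle x_i|I-H/2\pi|x_{i+1}\rangle$, and outputs as $y(k)$ the median of means of the values $\mathrm{Re}\,\mathcal R_k(x)$. The total number of samples is at most $Q(n)\,(t+1)$. (ii) It outputs numbers $\tilde E_1,\dots,\tilde E_S$, the energies found by ESPRIT from $y(0),\dots,y(2S)$ to numerical accuracy $1/q(n)$, in the sense made precise next. With probability at least $1-2^{-t}$ all of the following hold: $|y(k)-g_D(k)|\le 1/q(n)$ for all $k\le 2S$; the ESPRIT algorithm applied to $y$ (singular value decomposition $U\Sigma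 W$ of the $(S+1)\times(S+1)$ Hankel matrix $(y(i+j))_{i,j}$ with decreasing singular values, first $S$ columns of $U$, of these the first $S$ rows $U_0$ and the last $S$ rows $U_1$, eigenvalues $\tilde z_j$ of $U_0^{+}U_1$), for any choice of the singular value decomposition, yields energies $2\pi(1-\tilde z_j)$ at distance $d\le 1/q(n)$ from $\{E_j\}$; and the computed $\{\tilde E_j\}$ agree with these ESPRIT energies, and with $\{E_j\}$, up to distance $d\le 1/q(n)$. (Where $q(n)=0$ the bounds $1/q(n)$ are void.) -/

import Mathlib

open MeasureTheory ProbabilityTheory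
open scoped BigOperators Matrix

noncomputable section

/-! ## Qubits, local Hamiltonians and the decaying signal -/

/-- Computational basis states of `n` qubits, that is `n`-bit strings. -/
abbrev Basis (n : ℕ) : Type := Fin n → Bool

/-- The space of (not necessarily normalized) `n`-qubit states; the amplitude `⟨x|Φ⟩` is `Φ x`. -/
abbrev QState (n : ℕ) : Type := EuclideanSpace ℂ (Basis n)

/-- A Hermitian operator acting non-trivially on at most `κ` of the `n` qubits: a Hermitian matrix
`block` on `arity ≤ κ` qubits, together with the distinct qubits `site 0, site 1, …` it acts on. -/
structure LocalTerm (n κ : ℕ) where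
  arity : ℕ
  arity_le : arity ≤ κ
  site : Fin arity → Fin n
  site_injective : Function.Injective site
  block : Matrix (Basis arity) (Basis arity) ℂ
  isHermitian : block.IsHermitian

/-- The `2ⁿ × 2ⁿ` matrix `block ⊗ I` of a local term. -/
def LocalTerm.toMatrix {n κ : ℕ} (T : LocalTerm n κ) : Matrix (Basis n) (Basis n) ℂ :=
  open Classical in
  Matrix.of fun x y =>
    if ∀ i, i ∉ Set.range T.site → x i = y i then
      T.block (fun a => x (T.site a)) (fun a => y (T.site a))
    else 0

/-- A `κ`-local Hamiltonian on `n` qubits, given by the list of its local terms. -/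
abbrev LocalHamiltonian (n κ : ℕ) : Type := List (LocalTerm n κ)

/-- The matrix of the sum of all local terms. -/
def LocalHamiltonian.toMatrix {n κ : ℕ} (H : LocalHamiltonian n κ) :
    Matrix (Basis n) (Basis n) ℂ :=
  (H.map LocalTerm.toMatrix).sum

/-- The matrix `I - H / 2π`. -/
def stepMatrix {n κ : ℕ} (H : LocalHamiltonian n κ) : Matrix (Basis n) (Basis n) ℂ :=
  1 - ((2 * Real.pi : ℝ) : ℂ)⁻¹ • LocalHamiltonian.toMatrix H

/-- The signal `g_D(k) = ⟨Φ| (I - H / 2π)ᵏ |Φ⟩`. -/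
def decaySignal {n κ : ℕ} (H : LocalHamiltonian n κ) (Φ : QState n) (k : ℕ) : ℂ :=
  star Φ.ofLp ⬝ᵥ ((stepMatrix H ^ k) *ᵥ Φ.ofLp)

/-- `Φ` is a normalized state that is supported on exactly `S` eigenvectors of `H`, with eigenvalues
`E j ∈ [0, π]`; each of them occurs in `Φ` with probability at least `1 / P`, and the eigenvalue gap
`Δ = (1 / 2π) min_{i ≠ j} |E i - E j|` is at least `1 / P`. -/
structure SpectralPromise {n κ S : ℕ} (H : LocalHamiltonian n κ) (Φ : QState n) (E : Fin S → ℝ)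
    (P : ℕ) : Prop where
  normalized : ‖Φ‖ = 1
  range : ∀ j, 0 ≤ E j ∧ E j ≤ Real.pi
  gap : ∀ i j, i ≠ j → 1 ≤ (P : ℝ) * (|E i - E j| / (2 * Real.pi))
  supported : ∃ ψ : Fin S → QState n, Orthonormal ℂ ψ ∧
    (∀ j, LocalHamiltonian.toMatrix H *ᵥ (ψ j).ofLp = (E j : ℂ) • (ψ j).ofLp) ∧
    Φ = ∑ j, (inner ℂ (ψ j) Φ) • ψ j ∧
    ∀ j, 1 ≤ (P : ℝ) * ‖inner ℂ (ψ j) Φ‖ ^ 2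

/-! ## The estimator: brute-force path sums and median of means -/

/-- The sum over all paths `x = x₀, x₁, …, x_k` of
`ρ(x₀, x_k) ∏ ⟨x_i| I - H / 2π |x_{i+1}⟩`, where `ρ(x, y)` stands for the ratio `Φ(y) / Φ(x)`. -/
def pathSum {n κ : ℕ} (H : LocalHamiltonian n κ) (ρ : Basis n → Basis n → ℂ) (k : ℕ)
    (x : Basis n) : ℂ :=
  ∑ w : Fin k → Basis n,
    let path : Fin (k + 1) → Basis n := Fin.cons x w
    ρ x (path (Fin.last k)) * ∏ i : Fin k, stepMatrix H (path i.castSucc) (path i.succ)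

/-- At least half of the numbers are `≤ f i`, and at least half of them are `≥ f i`. -/
def IsMiddle {r : ℕ} (f : Fin r → ℝ) (i : Fin r) : Prop :=
  r ≤ 2 * Nat.card {j // f j ≤ f i} ∧ r ≤ 2 * Nat.card {j // f i ≤ f j}

/-- `v` is the median of the numbers `f j`: the middle one of them, with the smallest index if there
are several. -/
def IsMedian {r : ℕ} (f : Fin r → ℝ) (v : ℝ) : Prop :=
  ∃ i, IsMiddle f i ∧ (∀ j, j < i → ¬ IsMiddle f j) ∧ v = f i

/-- `v` is the median of the `r` means of `F` over `r` consecutive groups of `m` samples each, the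
first of which is `X s`. -/
def IsMedianOfMeans {α : Type} (F : α → ℝ) (X : ℕ → α) (s r m : ℕ) (v : ℝ) : Prop :=
  IsMedian (fun j : Fin r => (∑ i ∈ Finset.range m, F (X (s + (j * m + i)))) / m) v

/-! ## ESPRIT -/

/-- The `(L + 1) × (L + 1)` Hankel matrix of the signal `y(0), …, y(K)`, where `K = 2 L`. -/
def hankel (L : ℕ) (y : ℕ → ℂ) : Matrix (Fin (L + 1)) (Fin (L + 1)) ℂ :=
  Matrix.of fun i j => y (i + j)

/-- `B` is the Moore–Penrose inverse of `A`. -/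
structure IsMoorePenrose {m n : ℕ} (A : Matrix (Fin m) (Fin n) ℂ) (B : Matrix (Fin n) (Fin m) ℂ) :
    Prop where
  mul_mul_self : A * B * A = A
  mul_mul_inv : B * A * B = B
  left_hermitian : (A * B).IsHermitian
  right_hermitian : (B * A).IsHermitian

/-- `A = U diag(σ) W` is a singular value decomposition, with decreasingly ordered `σ`. -/
structure IsSVD {m : ℕ} (A U W : Matrix (Fin m) (Fin m) ℂ) (σ : Fin m → ℝ) : Prop where
  left_unitary : U ∈ Matrix.unitaryGroup (Fin m) ℂ
  right_unitary : W ∈ Matrix.unitaryGroup (Fin m) ℂ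
  nonneg : ∀ i, 0 ≤ σ i
  antitone : Antitone σ
  eq : A = U * Matrix.diagonal (fun i => (σ i : ℂ)) * W

/-- The list `z` is a possible output of the ESPRIT algorithm, run on the signal `y(0), …, y(2 L)`
with `S` components: from a singular value decomposition `U diag(σ) W` of the Hankel matrix, take the
first `S` columns of `U`, then its first `L` rows `U₀` and its last `L` rows `U₁`; `z` lists the
eigenvalues of `U₀⁺ U₁` with multiplicity. -/
def IsEspritOutput (L S : ℕ) (hS : S ≤ L) (y : ℕ → ℂ) (z : Fin S → ℂ) : Prop :=
  ∃ (U W : Matrix (Fin (L + 1)) (Fin (L + 1)) ℂ) (σ : Fin (L + 1) → ℝ),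
    IsSVD (hankel L y) U W σ ∧
    ∃ U₀inv : Matrix (Fin S) (Fin L) ℂ,
      IsMoorePenrose (U.submatrix Fin.castSucc (Fin.castLE (Nat.le_succ_of_le hS))) U₀inv ∧
      (U₀inv * U.submatrix Fin.succ (Fin.castLE (Nat.le_succ_of_le hS))).charpoly.roots =
        Finset.univ.val.map z

/-- The energy estimates `2π (1 - z)` for poles `z` of the signal `g_D`. -/
def energyOf {S : ℕ} (z : Fin S → ℂ) : Fin S → ℂ := fun j => 2 * (Real.pi : ℂ) * (1 - z j)

/-- The optimal matching distance `(1 / 2π) min_σ max_j |E' (σ j) - E j|`. -/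
def matchDist {S : ℕ} (E E' : Fin S → ℂ) : ℝ :=
  1 / (2 * Real.pi) * ⨅ σ : Equiv.Perm (Fin S), ⨆ j, ‖E' (σ j) - E j‖

/-! ## The machine model: a random-access machine with exact complex arithmetic

The machine has integer cells and number cells. Integer cells serve for control and addressing and
allow addition and truncated subtraction; number cells allow field operations, conjugation and real
parts, and comparison of real parts. The only constants are natural numbers, `i` and `π`, and a number
is never turned into an integer. Control flow is by branching and by loops whose number of iterations
is fixed when they are entered; hence every program halts. -/

/-- Integer expressions; `cell a` is the content of the integer cell whose address is `a`. -/
inductive NExp : Type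
  | const (c : ℕ)
  | cell (a : NExp)
  | add (a b : NExp)
  | sub (a b : NExp)

/-- Number expressions; `cell a` is the content of the number cell whose address is `a`. -/
inductive CExp : Type
  | ofNat (a : NExp)
  | imagUnit
  | pi
  | cell (a : NExp)
  | add (a b : CExp)
  | sub (a b : CExp)
  | mul (a b : CExp)
  | div (a b : CExp)
  | conj (a : CExp)
  | re (a : CExp)

/-- Tests: comparison of integers, and of real parts of numbers. -/
inductive Test : Type
  | natLE (a b : NExp)
  | reLE (a b : CExp)

/-- Programs. An `n`-bit string is stored in `n` consecutive integer cells, `0` for `false` and any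
other content for `true`. -/
inductive Prog : Type
  | skip
  /-- Write the integer `e` to the integer cell `a`. -/
  | setNat (a e : NExp)
  /-- Write the number `e` to the number cell `a`. -/
  | setNum (a : NExp) (e : CExp)
  | seq (P Q : Prog)
  | ite (b : Test) (P Q : Prog)
  /-- Run `P` as many times as the value of `e` on entry. -/
  | loop (e : NExp) (P : Prog)
  /-- Draw a fresh sample and store it in the integer cells from `a` on. -/
  | sample (a : NExp)
  /-- Store `Φ(y) / Φ(x)` in the number cell `d`, where `x`, `y` are stored from `a`, `b` on. -/
  | ratio (d a b : NExp)
  /-- Store the arity of the `i`-th local term in the integer cell `d`. -/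
  | arity (d i : NExp)
  /-- Store the `j`-th qubit of the `i`-th local term in the integer cell `d`. -/
  | site (d i j : NExp)
  /-- Store the entry of the block of the `i`-th local term in the row and the column stored from
  `a` and `b` on in the number cell `d`. -/
  | entry (d i a b : NExp)

/-- What a program has access to: the Hamiltonian, a routine for ratios of amplitudes, samples, and
the effort charged for each use of the sampling routine or the ratio routine. -/
structure Access (n κ : ℕ) where
  ham : LocalHamiltonian n κ
  ratio : Basis n → Basis n → ℂ
  samples : ℕ → Basis n
  charge : ℕ

/-- Memory, number of samples drawn so far, and effort spent so far. -/
structure MState where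
  nat : ℕ → ℕ
  num : ℕ → ℂ
  draws : ℕ
  effort : ℕ

def NExp.eval (s : MState) : NExp → ℕ
  | .const c => c
  | .cell a => s.nat (a.eval s)
  | .add a b => a.eval s + b.eval s
  | .sub a b => a.eval s - b.eval s

/-- The number of operations in the evaluation of an integer expression. -/
def NExp.size : NExp → ℕ
  | .const _ => 1
  | .cell a => a.size + 1
  | .add a b => a.size + b.size + 1
  | .sub a b => a.size + b.size + 1

def CExp.eval (s : MState) : CExp → ℂ
  | .ofNat a => (a.eval s : ℂ)
  | .imagUnit => Complex.I
  | .pi => (Real.pi : ℂ)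
  | .cell a => s.num (a.eval s)
  | .add a b => a.eval s + b.eval s
  | .sub a b => a.eval s - b.eval s
  | .mul a b => a.eval s * b.eval s
  | .div a b => a.eval s / b.eval s
  | .conj a => (starRingEnd ℂ) (a.eval s)
  | .re a => ((a.eval s).re : ℂ)

/-- The number of operations in the evaluation of a number expression. -/
def CExp.size : CExp → ℕ
  | .ofNat a => a.size + 1
  | .imagUnit => 1
  | .pi => 1
  | .cell a => a.size + 1
  | .add a b => a.size + b.size + 1
  | .sub a b => a.size + b.size + 1
  | .mul a b => a.size + b.size + 1
  | .div a b => a.size + b.size + 1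
  | .conj a => a.size + 1
  | .re a => a.size + 1

def Test.holds (s : MState) : Test → Prop
  | .natLE a b => a.eval s ≤ b.eval s
  | .reLE a b => (a.eval s).re ≤ (b.eval s).re

def Test.size : Test → ℕ
  | .natLE a b => a.size + b.size + 1
  | .reLE a b => a.size + b.size + 1

/-- The bit string of length `m` that is stored in the integer cells from `a` on. -/
def MState.bits (s : MState) (m a : ℕ) : Basis m := fun i => decide (s.nat (a + i) ≠ 0)

def MState.writeNat (s : MState) (a v : ℕ) : MState := { s with nat := Function.update s.nat a v }

def MState.writeNum (s : MState) (a : ℕ) (v : ℂ) : MState :=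
  { s with num := Function.update s.num a v }

/-- Write a bit string to the integer cells from `a` on. -/
def MState.writeBits (s : MState) {n : ℕ} (a : ℕ) (x : Basis n) : MState :=
  { s with nat := fun c =>
      if h : a ≤ c ∧ c - a < n then (if x ⟨c - a, h.2⟩ then 1 else 0) else s.nat c }

/-- Spend effort `e`. -/
def MState.spend (s : MState) (e : ℕ) : MState := { s with effort := s.effort + e }

/-- The arity of the `i`-th local term (`0` if there is none). -/
def LocalHamiltonian.arityAt {n κ : ℕ} (H : LocalHamiltonian n κ) (i : ℕ) : ℕ :=
  match H[i]? with
  | some T => T.arity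
  | none => 0

/-- The `j`-th qubit of the `i`-th local term (`0` if there is none). -/
def LocalHamiltonian.siteAt {n κ : ℕ} (H : LocalHamiltonian n κ) (i j : ℕ) : ℕ :=
  match H[i]? with
  | some T => if h : j < T.arity then (T.site ⟨j, h⟩ : ℕ) else 0
  | none => 0

/-- The entry of the `i`-th block (`0` if there is none) in the row and column stored from `a` and
`b` on. -/
def LocalHamiltonian.entryAt {n κ : ℕ} (H : LocalHamiltonian n κ) (s : MState) (i a b : ℕ) : ℂ :=
  match H[i]? with
  | some T => T.block (s.bits T.arity a) (s.bits T.arity b)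
  | none => 0

/-- The state after running a program. Each instruction costs one unit, plus one for each operation
in its expressions and each bit it reads or writes, plus the charge for an access to the state. -/
def Prog.run {n κ : ℕ} (A : Access n κ) : Prog → MState → MState
  | .skip, s => s.spend 1
  | .setNat a e, s => (s.writeNat (a.eval s) (e.eval s)).spend (a.size + e.size + 1)
  | .setNum a e, s => (s.writeNum (a.eval s) (e.eval s)).spend (a.size + e.size + 1)
  | .seq P Q, s => (Q.run A (P.run A s)).spend 1
  | .ite b P Q, s =>
      open Classical in (if b.holds s then P.run A s else Q.run A s).spend (b.size + 1)
  | .loop e P, s => ((P.run A)^[e.eval s] s).spend (e.size + 1)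
  | .sample a, s =>
      { (s.writeBits (a.eval s) (A.samples s.draws)).spend (a.size + n + A.charge + 1) with
        draws := s.draws + 1 }
  | .ratio d a b, s =>
      (s.writeNum (d.eval s) (A.ratio (s.bits n (a.eval s)) (s.bits n (b.eval s)))).spend
        (d.size + a.size + b.size + 2 * n + A.charge + 1)
  | .arity d i, s => (s.writeNat (d.eval s) (A.ham.arityAt (i.eval s))).spend (d.size + i.size + 1)
  | .site d i j, s =>
      (s.writeNat (d.eval s) (A.ham.siteAt (i.eval s) (j.eval s))).spend
        (d.size + i.size + j.size + 1)
  | .entry d i a b, s =>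
      (s.writeNum (d.eval s) (A.ham.entryAt s (i.eval s) (a.eval s) (b.eval s))).spend
        (d.size + i.size + a.size + b.size + 2 * A.ham.arityAt (i.eval s) + 1)

/-- The initial state: the integer cells `0, 1, 2, 3` hold the number of qubits, the number of
eigenvalues sought, the number of local terms and the confidence parameter. -/
def MState.start (n S N t : ℕ) : MState where
  nat := fun c => if c = 0 then n else if c = 1 then S else if c = 2 then N else if c = 3 then t else 0
  num := fun _ => 0
  draws := 0
  effort := 0

/-- The final state of a program on given inputs. -/
def Prog.final {n κ : ℕ} (P : Prog) (A : Access n κ) (S t : ℕ) : MState :=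
  P.run A (MState.start n S A.ham.length t)

/-- The output signal `y(k)`, in the number cells `0, …, 2 S`. -/
def MState.signal (s : MState) (k : ℕ) : ℂ := s.num k

/-- The output energies, in the number cells `2 S + 1, …, 3 S`. -/
def MState.energies (s : MState) (S : ℕ) : Fin S → ℂ := fun j => s.num (2 * S + 1 + j)

/-- The output is correct up to an error of `1 / accuracy`: every signal value is this close to `g_D`;
ESPRIT applied to the signal yields energies at this matching distance from the eigenvalues, and
the energies computed by the program are at most this far from those of ESPRIT and from the
eigenvalues. -/
structure GoodOutput {n κ S : ℕ} (H : LocalHamiltonian n κ) (Φ : QState n) (E : Fin S → ℝ)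
    (accuracy : ℕ) (out : MState) : Prop where
  signal : ∀ k ≤ 2 * S, (accuracy : ℝ) * ‖out.signal k - decaySignal H Φ k‖ ≤ 1
  exists_esprit : ∃ z, IsEspritOutput S S le_rfl out.signal z
  esprit : ∀ z, IsEspritOutput S S le_rfl out.signal z →
    (accuracy : ℝ) * matchDist (fun j => (E j : ℂ)) (energyOf z) ≤ 1
  numerical : ∀ z, IsEspritOutput S S le_rfl out.signal z →
    (accuracy : ℝ) * matchDist (energyOf z) (out.energies S) ≤ 1
  resolved : (accuracy : ℝ) * matchDist (fun j => (E j : ℂ)) (out.energies S) ≤ 1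

end

/-! ## Frames and effort of programs -/

/-! Expanding Φ in the eigenvectors gives g_D(k) = ∑ p_l z_l^k with poles z_l = 1 - E_l / 2π in [0,
1] and weights p_l ≥ 1 / p(n) (`SpectralPromise.exists_signal`). Resolving the energies means
finding the poles of a short exponential sum from noisy values.

Sampling. For x drawn from |Φ|², the path sum equals ((I - H/2π)^k Φ)(x) / Φ(x) (`pathSum_eq_div`).
Its real part has mean g_D(k), and its second moment is at most ‖(I - H/2π)^k Φ‖² ≤ 1, whatever the
phases of the matrix entries: no stoquasticity is needed. Chebyshev's inequality within a group and
independence between groups give medians of means with error at most 1/K for all k ≤ 2S, except with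
probability 2⁻ᵗ (`SpectralPromise.measure_signal_le`). One path sum visits at most (1 + N 2^κ)^k
paths, which is polynomial because k is bounded.

Stability. The poles are separated by 1/P, so the inverse of their Vandermonde matrix is
polynomially bounded. For ESPRIT, the last left singular vector of the Hankel matrix defines a
polynomial that is small at every pole (`norm_noisePoly_le`) while its top coefficient is not small
(`one_le_norm_last_last`). Hence det U₀ is not small, whereas shift invariance makes det(z_l U₀ -
U₁) small (`norm_det_pencil_le`). The characteristic polynomial of U₀⁺U₁ is therefore small at every
pole, and a monic polynomial of degree S that is small at S separated points has one root near each
of them (`exists_perm_norm_sub_le`). The argument applies to every singular value decomposition.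

Computation. The program computes no singular value decomposition. It searches the S-tuples of a
grid for one whose linear recurrence nearly annihilates the signal. Rounding the true poles gives
such a tuple (`exists_grid_residual_le`), and every such tuple is close to the true poles by the
Vandermonde bound (`norm_prod_sub_le_of_residual`). The stored energies are thus close to the
eigenvalues, and through these to the output of ESPRIT. A polynomial K suffices
(`resolution_bounds`). The rest is program verification by frames and loop invariants. -/

@[simp] lemma MState.spend_nat (s : MState) (e : ℕ) : (s.spend e).nat = s.nat := rfl
@[simp] lemma MState.spend_num (s : MState) (e : ℕ) : (s.spend e).num = s.num := rfl
@[simp] lemma MState.spend_draws (s : MState) (e : ℕ) : (s.spend e).draws = s.draws := rfl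
@[simp] lemma MState.spend_effort (s : MState) (e : ℕ) :
    (s.spend e).effort = s.effort + e := rfl
@[simp] lemma MState.writeNat_nat (s : MState) (a v : ℕ) :
    (s.writeNat a v).nat = Function.update s.nat a v := rfl
@[simp] lemma MState.writeNat_num (s : MState) (a v : ℕ) : (s.writeNat a v).num = s.num := rfl
@[simp] lemma MState.writeNum_nat (s : MState) (a : ℕ) (v : ℂ) :
    (s.writeNum a v).nat = s.nat := rfl
@[simp] lemma MState.writeNum_num (s : MState) (a : ℕ) (v : ℂ) :
    (s.writeNum a v).num = Function.update s.num a v := rfl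
@[simp] lemma MState.writeNat_effort (s : MState) (a v : ℕ) :
    (s.writeNat a v).effort = s.effort := rfl
@[simp] lemma MState.writeNum_effort (s : MState) (a : ℕ) (v : ℂ) :
    (s.writeNum a v).effort = s.effort := rfl
@[simp] lemma MState.writeBits_effort (s : MState) {n : ℕ} (a : ℕ) (x : Basis n) :
    (s.writeBits a x).effort = s.effort := rfl

/-- Every possible value of the address lies in `W`, as can be read off from its shape. -/
def NExp.Lands (W : ℕ → Prop) : NExp → Prop
  | .const c => W c
  | .add (.const c) _ => ∀ k, c ≤ k → W k
  | _ => False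

lemma NExp.Lands.eval {W : ℕ → Prop} {a : NExp} (h : a.Lands W) (s : MState) : W (a.eval s) := by
  match a, h with
  | .const c, h => exact h
  | .add (.const c) e, h => exact h _ (Nat.le_add_right c _)

lemma NExp.Lands.ne_eval {W : ℕ → Prop} {a : NExp} (h : a.Lands W) (s : MState) {c : ℕ}
    (hc : ¬ W c) : c ≠ a.eval s := by
  rintro rfl
  exact hc (h.eval s)

/-- A constant address such that it and all larger ones lie in `W`. -/
def NExp.LandsAbove (W : ℕ → Prop) : NExp → Prop
  | .const c => ∀ k, c ≤ k → W k
  | _ => False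

lemma NExp.LandsAbove.eval {W : ℕ → Prop} {a : NExp} (h : a.LandsAbove W) (s : MState) :
    ∀ k, a.eval s ≤ k → W k := by
  match a, h with
  | .const c, h => exact h

/-- All integer cells the program writes lie in `W`. -/
def Prog.NatFrame (W : ℕ → Prop) : Prog → Prop
  | .skip => True
  | .setNat a _ => a.Lands W
  | .setNum _ _ => True
  | .seq P Q => P.NatFrame W ∧ Q.NatFrame W
  | .ite _ P Q => P.NatFrame W ∧ Q.NatFrame W
  | .loop _ P => P.NatFrame W
  | .sample a => a.LandsAbove W
  | .ratio _ _ _ => True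
  | .arity d _ => d.Lands W
  | .site d _ _ => d.Lands W
  | .entry _ _ _ _ => True

/-- All number cells the program writes lie in `W`. -/
def Prog.NumFrame (W : ℕ → Prop) : Prog → Prop
  | .skip => True
  | .setNat _ _ => True
  | .setNum a _ => a.Lands W
  | .seq P Q => P.NumFrame W ∧ Q.NumFrame W
  | .ite _ P Q => P.NumFrame W ∧ Q.NumFrame W
  | .loop _ P => P.NumFrame W
  | .sample _ => True
  | .ratio d _ _ => d.Lands W
  | .arity _ _ => True
  | .site _ _ _ => True
  | .entry d _ _ _ => d.Lands W

/-- The program draws no samples. -/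
def Prog.NoSample : Prog → Prop
  | .seq P Q => P.NoSample ∧ Q.NoSample
  | .ite _ P Q => P.NoSample ∧ Q.NoSample
  | .loop _ P => P.NoSample
  | .sample _ => False
  | _ => True

/-- Every loop is controlled by an integer cell with a constant address below `L`. -/
def Prog.LoopsOn (L : ℕ) : Prog → Prop
  | .seq P Q => P.LoopsOn L ∧ Q.LoopsOn L
  | .ite _ P Q => P.LoopsOn L ∧ Q.LoopsOn L
  | .loop (.cell (.const c)) P => c < L ∧ P.LoopsOn L
  | .loop _ _ => False
  | _ => True

lemma NExp.Lands.mono {W W' : ℕ → Prop} (h : ∀ c, W c → W' c) {a : NExp} (ha : a.Lands W) :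
    a.Lands W' := by
  match a, ha with
  | .const c, ha => exact h _ ha
  | .add (.const c) e, ha => exact fun k hk => h _ (ha k hk)

lemma NExp.LandsAbove.mono {W W' : ℕ → Prop} (h : ∀ c, W c → W' c) {a : NExp}
    (ha : a.LandsAbove W) : a.LandsAbove W' := by
  match a, ha with
  | .const c, ha => exact fun k hk => h _ (ha k hk)

lemma Prog.NatFrame.mono {W W' : ℕ → Prop} (h : ∀ c, W c → W' c) {P : Prog} (hP : P.NatFrame W) :
    P.NatFrame W' := by
  induction P with
  | skip | setNum | ratio | entry => trivial
  | setNat a e => exact NExp.Lands.mono h hP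
  | arity d i => exact NExp.Lands.mono h hP
  | site d i j => exact NExp.Lands.mono h hP
  | sample a => exact NExp.LandsAbove.mono h hP
  | seq P Q hp hq => exact ⟨hp hP.1, hq hP.2⟩
  | ite b P Q hp hq => exact ⟨hp hP.1, hq hP.2⟩
  | loop e P hp => exact hp hP

lemma Prog.NumFrame.mono {W W' : ℕ → Prop} (h : ∀ c, W c → W' c) {P : Prog} (hP : P.NumFrame W) :
    P.NumFrame W' := by
  induction P with
  | skip | setNat | sample | arity | site => trivial
  | setNum a e => exact NExp.Lands.mono h hP
  | ratio d a b => exact NExp.Lands.mono h hP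
  | entry d i a b => exact NExp.Lands.mono h hP
  | seq P Q hp hq => exact ⟨hp hP.1, hq hP.2⟩
  | ite b P Q hp hq => exact ⟨hp hP.1, hq hP.2⟩
  | loop e P hp => exact hp hP

/-! ### Frame rules and the effort bound -/

section Runs

variable {n κ : ℕ} (A : Access n κ)

/-- Invariants of loops. -/
lemma iterate_invariant {α : Type*} {f : α → α} (I : ℕ → α → Prop) {K : ℕ} {s : α} (h0 : I 0 s)
    (hstep : ∀ i s, i < K → I i s → I (i + 1) (f s)) : I K (f^[K] s) := by
  induction K with
  | zero => exact h0
  | succ K ih =>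
    rw [Function.iterate_succ_apply']
    exact hstep K _ K.lt_succ_self (ih fun i s hi => hstep i s (hi.trans K.lt_succ_self))

/-- The frame rule: a syntactic check of the write addresses replaces the tracking of memory through
a run. All statements below about surviving registers rest on it and on its analogue for number
cells. -/
lemma Prog.run_nat_of_natFrame {W : ℕ → Prop} {P : Prog} (hP : P.NatFrame W) (s : MState) {c : ℕ}
    (hc : ¬ W c) : (P.run A s).nat c = s.nat c := by
  induction P generalizing s with
  | skip | setNum | ratio | entry => rfl
  | setNat a e =>
    exact Function.update_of_ne (NExp.Lands.ne_eval hP s hc) _ _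
  | arity d i =>
    exact Function.update_of_ne (NExp.Lands.ne_eval hP s hc) _ _
  | site d i j =>
    exact Function.update_of_ne (NExp.Lands.ne_eval hP s hc) _ _
  | sample a =>
    have : ¬ a.eval s ≤ c := fun h => hc (NExp.LandsAbove.eval hP s c h)
    simp [Prog.run, MState.writeBits, this]
  | seq P Q hp hq => exact (hq hP.2 _).trans (hp hP.1 s)
  | ite b P Q hp hq =>
    simp only [Prog.run, MState.spend_nat]
    split_ifs
    · exact hp hP.1 s
    · exact hq hP.2 s
  | loop e P hp =>
    simp only [Prog.run, MState.spend_nat]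
    exact iterate_invariant (fun _ u => u.nat c = s.nat c) rfl
      (fun i u _ hu => (hp hP u).trans hu)

lemma Prog.run_num_of_numFrame {W : ℕ → Prop} {P : Prog} (hP : P.NumFrame W) (s : MState) {c : ℕ}
    (hc : ¬ W c) : (P.run A s).num c = s.num c := by
  induction P generalizing s with
  | skip | setNat | sample | arity | site => rfl
  | setNum a e =>
    exact Function.update_of_ne (NExp.Lands.ne_eval hP s hc) _ _
  | ratio d a b =>
    exact Function.update_of_ne (NExp.Lands.ne_eval hP s hc) _ _
  | entry d i a b =>
    exact Function.update_of_ne (NExp.Lands.ne_eval hP s hc) _ _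
  | seq P Q hp hq => exact (hq hP.2 _).trans (hp hP.1 s)
  | ite b P Q hp hq =>
    simp only [Prog.run, MState.spend_num]
    split_ifs
    · exact hp hP.1 s
    · exact hq hP.2 s
  | loop e P hp =>
    simp only [Prog.run, MState.spend_num]
    exact iterate_invariant (fun _ u => u.num c = s.num c) rfl
      (fun i u _ hu => (hp hP u).trans hu)

lemma Prog.run_draws_of_noSample {P : Prog} (hP : P.NoSample) (s : MState) :
    (P.run A s).draws = s.draws := by
  induction P generalizing s with
  | skip | setNat | arity | site | setNum | ratio | entry => rfl
  | sample a => exact hP.elim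
  | seq P Q hp hq => exact (hq hP.2 _).trans (hp hP.1 s)
  | ite b P Q hp hq =>
    simp only [Prog.run, MState.spend_draws]
    split_ifs
    · exact hp hP.1 s
    · exact hq hP.2 s
  | loop e P hp =>
    simp only [Prog.run, MState.spend_draws]
    exact iterate_invariant (fun _ u => u.draws = s.draws) rfl
      (fun i u _ hu => (hp hP u).trans hu)

open Polynomial in
/-- A bound for the effort in terms of a bound for the number of qubits, the loop counts and the
charge. -/
noncomputable def Prog.cost (κ : ℕ) : Prog → Polynomial ℕ
  | .skip => 1
  | .setNat a e => C (a.size + e.size + 1)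
  | .setNum a e => C (a.size + e.size + 1)
  | .seq P Q => P.cost κ + Q.cost κ + 1
  | .ite b P Q => P.cost κ + Q.cost κ + C (b.size + 1)
  | .loop e P => X * P.cost κ + C (e.size + 1)
  | .sample a => X + X + C (a.size + 1)
  | .ratio d a b => X + X + X + C (d.size + a.size + b.size + 1)
  | .arity d i => C (d.size + i.size + 1)
  | .site d i j => C (d.size + i.size + j.size + 1)
  | .entry d i a b => C (d.size + i.size + a.size + b.size + 2 * κ + 1)

lemma LocalHamiltonian.arityAt_le (H : LocalHamiltonian n κ) (i : ℕ) : H.arityAt i ≤ κ := by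
  unfold LocalHamiltonian.arityAt
  split
  · exact LocalTerm.arity_le _
  · exact Nat.zero_le _

/-- Loop counts are read from cells below `L`, which the program never writes. They stay at most `B`
even inside other loops, so the bound multiplies up along the nesting. -/
lemma Prog.effort_le {L B : ℕ} {P : Prog} (hW : P.NatFrame (L ≤ ·)) (hL : P.LoopsOn L)
    (hn : n ≤ B) (hA : A.charge ≤ B) (s : MState) (hs : ∀ c < L, s.nat c ≤ B) :
    (P.run A s).effort ≤ s.effort + (P.cost κ).eval B := by
  induction P generalizing s with
  | skip | setNat | arity | site | setNum => simp [Prog.run, Prog.cost]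
  | ratio d a b => simp [Prog.run, Prog.cost]; omega
  | entry d i a b =>
    have := A.ham.arityAt_le (i.eval s)
    simp [Prog.run, Prog.cost]; omega
  | sample a => simp [Prog.run, Prog.cost]; omega
  | seq P Q hp hq =>
    have h1 := hp hW.1 hL.1 s hs
    have h2 := hq hW.2 hL.2 (P.run A s) fun c hc => by
      rw [Prog.run_nat_of_natFrame A hW.1 s (not_le.2 hc)]; exact hs c hc
    simp [Prog.run, Prog.cost]; omega
  | ite b P Q hp hq =>
    have h1 := hp hW.1 hL.1 s hs
    have h2 := hq hW.2 hL.2 s hs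
    simp only [Prog.run, Prog.cost, Polynomial.eval_add, Polynomial.eval_C, MState.spend_effort]
    split_ifs <;> omega
  | loop e P hp =>
    match e, hL with
    | .cell (.const c), hL =>
      have key := iterate_invariant (f := P.run A) (K := s.nat c) (s := s)
        (fun i u => (∀ c < L, u.nat c ≤ B) ∧ u.effort ≤ s.effort + i * (P.cost κ).eval B)
        ⟨hs, by simp⟩ (by
          rintro i u - ⟨h1, h2⟩
          refine ⟨fun c hc => ?_, ?_⟩
          · rw [Prog.run_nat_of_natFrame A (P := P) hW u (not_le.2 hc)]; exact h1 c hc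
          · have := hp hW hL.2 u h1
            rw [Nat.succ_mul]; omega)
      have hb : s.nat c * (P.cost κ).eval B ≤ B * (P.cost κ).eval B :=
        Nat.mul_le_mul_right _ (hs c hL.1)
      have h2 := key.2
      simp only [Prog.run, Prog.cost, Polynomial.eval_add, Polynomial.eval_C, Polynomial.eval_mul,
        Polynomial.eval_X, MState.spend_effort, NExp.eval]
      omega

end Runs

/-! ## Path sums by a program -/

/-- The content of a register for integers. -/
abbrev NExp.reg (c : ℕ) : NExp := .cell (.const c)

/-- The content of a register for numbers. -/
abbrev CExp.reg (c : ℕ) : CExp := .cell (.const c)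

attribute [simp] NExp.eval CExp.eval

/-- The address of the bit of the current string whose index is stored in register `c`. The string
starts at the cell `R + n`. -/
abbrev bitAddress (R c : ℕ) : NExp := .add (.const R) (.add (.reg 0) (.reg c))

/-- Write the bit `v` into the column buffer and the current string. -/
def setBitProg (κ R l j v : ℕ) : Prog :=
  .seq (.setNat (.const (l + 2 + κ + j)) (.const v))
    (.setNat (bitAddress R (l + 2 + 2 * κ + j)) (.const v))

/-- Run `leaf` for every assignment of bits to the qubits `j, j + 1, …` of the local term whose index
is in the register `l` and whose arity is in the register `l + 1`. -/
def enumProg (κ R l : ℕ) (leaf : Prog) : ℕ → ℕ → Prog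
  | 0, _ => leaf
  | m + 1, j =>
    -- The recursion has the constant depth `κ`, so it unfolds into a finite program; a term of
    -- smaller arity stops early.
    .ite (.natLE (.reg (l + 1)) (.const j)) leaf
      (.seq (.site (.const (l + 2 + 2 * κ + j)) (.reg l) (.const j))
      (.seq (.setNat (.const (l + 2 + j)) (.cell (bitAddress R (l + 2 + 2 * κ + j))))
      (.seq (setBitProg κ R l j 0)
      (.seq (enumProg κ R l leaf m (j + 1))
      (.seq (setBitProg κ R l j 1)
      (.seq (enumProg κ R l leaf m (j + 1))
        (.setNat (bitAddress R (l + 2 + 2 * κ + j)) (.reg (l + 2 + j)))))))))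

/-- The integer cells written by `enumProg`. -/
def EnumFrame (κ L₀ R l j : ℕ) (c : ℕ) : Prop :=
  (L₀ ≤ c ∧ c < l) ∨ R ≤ c ∨ (l + 2 + j ≤ c ∧ c < l + 2 + κ) ∨
    (l + 2 + κ + j ≤ c ∧ c < l + 2 + 2 * κ) ∨ (l + 2 + 2 * κ + j ≤ c ∧ c < l + 2 + 3 * κ)

/-- The frame shrinks as `j` grows: the recursive calls leave the buffer entries with index at most
`j` alone, so the saved bit and the stored site are still there when the bit is restored. -/
lemma enumProg_natFrame {κ L₀ R l : ℕ} {leaf : Prog}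
    (hleaf : leaf.NatFrame fun c => (L₀ ≤ c ∧ c < l) ∨ R ≤ c) :
    ∀ m j, m + j = κ → (enumProg κ R l leaf m j).NatFrame (EnumFrame κ L₀ R l j)
  | 0, j, _ => Prog.NatFrame.mono (fun c hc => hc.elim Or.inl fun h => Or.inr (Or.inl h)) hleaf
  | m + 1, j, h => by
    have ih := (enumProg_natFrame (κ := κ) hleaf m (j + 1) (by omega)).mono
      (W' := EnumFrame κ L₀ R l j) (fun c hc => by unfold EnumFrame at hc ⊢; omega)
    refine ⟨Prog.NatFrame.mono (fun c hc => hc.elim Or.inl fun h => Or.inr (Or.inl h)) hleaf,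
      ?_, ?_, ⟨?_, ?_⟩, ih, ⟨?_, ?_⟩, ih, ?_⟩ <;>
      simp only [Prog.NatFrame, NExp.Lands, EnumFrame] <;> omega

lemma enumProg_numFrame {κ R l : ℕ} {leaf : Prog} {V : ℕ → Prop} (hleaf : leaf.NumFrame V) :
    ∀ m j, (enumProg κ R l leaf m j).NumFrame V
  | 0, _ => hleaf
  | m + 1, j => by
    have ih := enumProg_numFrame (κ := κ) (R := R) (l := l) hleaf m (j + 1)
    simp [enumProg, setBitProg, Prog.NumFrame, hleaf, ih]

lemma enumProg_noSample {κ R l : ℕ} {leaf : Prog} (hleaf : leaf.NoSample) :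
    ∀ m j, (enumProg κ R l leaf m j).NoSample
  | 0, _ => hleaf
  | m + 1, j => by
    have ih := enumProg_noSample (κ := κ) (R := R) (l := l) hleaf m (j + 1)
    simp [enumProg, setBitProg, Prog.NoSample, hleaf, ih]

lemma enumProg_loopsOn {κ R l L : ℕ} {leaf : Prog} (hleaf : leaf.LoopsOn L) :
    ∀ m j, (enumProg κ R l leaf m j).LoopsOn L
  | 0, _ => hleaf
  | m + 1, j => by
    have ih := enumProg_loopsOn (κ := κ) (R := R) (l := l) hleaf m (j + 1)
    simp [enumProg, setBitProg, Prog.LoopsOn, hleaf, ih]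

/-- Add to the register `T` the sum over all paths with `k` steps from the current string on, times
the weight in the register `T + 4 + k`. -/
noncomputable def goProg (κ L₀ R T : ℕ) : ℕ → Prog
  | 0 => .seq (.ratio (.const (T + 3)) (.const R) (.add (.const R) (.reg 0)))
      (.setNum (.const T) (.add (.reg T) (.mul (.reg (T + 4)) (.reg (T + 3)))))
  | k + 1 =>
    -- The first call, with the weight unchanged, is the contribution of the identity; the loop then
    -- adds that of `-H / 2π` term by term.
    .seq (.setNum (.const (T + 4 + k)) (.reg (T + 4 + (k + 1))))
    (.seq (goProg κ L₀ R T k)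
    (.seq (.setNat (.const (L₀ + k * (3 * κ + 2))) (.const 0))
    (.loop (.reg 2)
      (.seq (.arity (.const (L₀ + k * (3 * κ + 2) + 1)) (.reg (L₀ + k * (3 * κ + 2))))
      (.seq
        (enumProg κ R (L₀ + k * (3 * κ + 2))
          (.seq (.entry (.const (T + 2)) (.reg (L₀ + k * (3 * κ + 2)))
            (.const (L₀ + k * (3 * κ + 2) + 2)) (.const (L₀ + k * (3 * κ + 2) + 2 + κ)))
          (.seq (.setNum (.const (T + 4 + k)) (.mul (.reg (T + 4 + (k + 1)))
            (.sub (.ofNat (.const 0)) (.div (.reg (T + 2)) (.mul (.ofNat (.const 2)) .pi)))))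
            (goProg κ L₀ R T k)))
          κ 0)
        (.setNat (.const (L₀ + k * (3 * κ + 2)))
          (.add (.reg (L₀ + k * (3 * κ + 2))) (.const 1))))))))

/-- Each step of the path owns a block of `3 * κ + 2` cells: term index, arity, and three buffers of
length `κ` (saved bits, column bits, sites). A recursive call writes only to lower blocks and to the
strings from `R` on, so the variables of the outer steps survive. -/
lemma goProg_natFrame (κ L₀ R T : ℕ) : ∀ k,
    (goProg κ L₀ R T k).NatFrame fun c => (L₀ ≤ c ∧ c < L₀ + k * (3 * κ + 2)) ∨ R ≤ c
  | 0 => ⟨trivial, trivial⟩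
  | k + 1 => by
    have hk : (k + 1) * (3 * κ + 2) = k * (3 * κ + 2) + (3 * κ + 2) := Nat.succ_mul _ _
    have ih := goProg_natFrame κ L₀ R T k
    have h := enumProg_natFrame (κ := κ) (L₀ := L₀) (R := R) (l := L₀ + k * (3 * κ + 2))
      (leaf := (.seq (.entry (.const (T + 2)) (.reg (L₀ + k * (3 * κ + 2)))
            (.const (L₀ + k * (3 * κ + 2) + 2)) (.const (L₀ + k * (3 * κ + 2) + 2 + κ)))
          (.seq (.setNum (.const (T + 4 + k)) (.mul (.reg (T + 4 + (k + 1)))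
            (.sub (.ofNat (.const 0)) (.div (.reg (T + 2)) (.mul (.ofNat (.const 2)) .pi)))))
            (goProg κ L₀ R T k)))) ⟨trivial, trivial, ih⟩ κ 0 rfl
    refine ⟨trivial, ih.mono fun c hc => by omega, ?_, ?_, h.mono fun c hc => ?_, ?_⟩
    · simp only [Prog.NatFrame, NExp.Lands]; omega
    · change _ ∨ _; omega
    · unfold EnumFrame at hc; omega
    · simp only [Prog.NatFrame, NExp.Lands]; omega

/-- The frame leaves out `T + 1`, the running total over samples, and `T + 4 + k`, the weight that
is still needed after a recursive call. -/
lemma goProg_numFrame (κ L₀ R T : ℕ) : ∀ k,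
    (goProg κ L₀ R T k).NumFrame fun c => c = T ∨ (T + 2 ≤ c ∧ c < T + 4 + k)
  | 0 => by
    constructor
    · simp [Prog.NumFrame, NExp.Lands]
    · simp [Prog.NumFrame, NExp.Lands]
  | k + 1 => by
    have ih := (goProg_numFrame κ L₀ R T k).mono
      (W' := fun c => c = T ∨ (T + 2 ≤ c ∧ c < T + 4 + (k + 1))) fun c hc => by omega
    refine ⟨?_, ih, trivial, trivial, enumProg_numFrame (leaf := .seq _ (.seq _ _)) ⟨?_, ?_, ih⟩ κ 0, trivial⟩ <;>
      simp only [Prog.NumFrame, NExp.Lands] <;> omega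

lemma goProg_noSample (κ L₀ R T : ℕ) : ∀ k, (goProg κ L₀ R T k).NoSample
  | 0 => ⟨trivial, trivial⟩
  | k + 1 => by
    have ih := goProg_noSample κ L₀ R T k
    exact ⟨trivial, ih, trivial, trivial, enumProg_noSample
      (leaf := .seq (.entry _ _ _ _) (.seq (.setNum _ _) _)) ⟨trivial, trivial, ih⟩ κ 0, trivial⟩

lemma goProg_loopsOn (κ L₀ R T : ℕ) {L : ℕ} (hL : 2 < L) : ∀ k, (goProg κ L₀ R T k).LoopsOn L
  | 0 => ⟨trivial, trivial⟩
  | k + 1 => by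
    have ih := goProg_loopsOn κ L₀ R T hL k
    exact ⟨trivial, ih, trivial, hL, trivial, enumProg_loopsOn
      (leaf := .seq (.entry _ _ _ _) (.seq (.setNum _ _) _)) ⟨trivial, trivial, ih⟩ κ 0, trivial⟩

/-! ### Correctness of the enumeration and of the path sums -/

section Enumeration

variable {n κ : ℕ} {A : Access n κ}

/-- The memory in the middle of an enumeration: bits have been assigned to the qubits with index
below `j` of the term `T`, and `y₀` is the string that the enumeration started from. -/
structure EnumState (A : Access n κ) (R l i : ℕ) (T : LocalTerm n κ) (x₀ y₀ : Basis n) (j j' : ℕ)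
    (s : MState) : Prop where
  qubits : s.nat 0 = n
  terms : s.nat 2 = A.ham.length
  index : s.nat l = i
  arity : s.nat (l + 1) = T.arity
  start : s.bits n R = x₀
  row : ∀ c : Fin T.arity, (c : ℕ) < j' → (decide (s.nat (l + 2 + c) ≠ 0) = y₀ (T.site c))
  col : ∀ c : Fin T.arity, (c : ℕ) < j →
    (decide (s.nat (l + 2 + κ + c) ≠ 0) = s.bits n (R + n) (T.site c))
  off : ∀ q, (∀ c : Fin T.arity, (c : ℕ) < j' → T.site c ≠ q) → s.bits n (R + n) q = y₀ q

lemma MState.bits_congr {s s' : MState} {m a : ℕ} (h : ∀ i < m, s'.nat (a + i) = s.nat (a + i)) :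
    s'.bits m a = s.bits m a := by
  ext i
  simp only [MState.bits, h i i.2]

lemma MState.bits_writeNat {s : MState} {m a : ℕ} (q : Fin m) (v : ℕ) :
    (s.writeNat (a + q) v).bits m a = Function.update (s.bits m a) q (decide (v ≠ 0)) := by
  ext i
  by_cases h : i = q
  · subst h; simp [MState.bits]
  · have : (i : ℕ) ≠ q := fun e => h (Fin.ext e)
    simp [MState.bits, h, this]

/-- The second index is `j + 1` already before the write, since the original bit of qubit `j` has
been saved by then. Distinctness of the sites keeps the earlier column bits in agreement with the
current string. -/
lemma setBitProg_state {L₀ R l i : ℕ} {T : LocalTerm n κ} {x₀ y₀ : Basis n} {j : ℕ} {s : MState}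
    (hL₀ : 2 < L₀) (hl : L₀ ≤ l) (hR : l + (3 * κ + 2) ≤ R) (hj : j < T.arity)
    (h : EnumState A R l i T x₀ y₀ j (j + 1) s)
    (hsite : s.nat (l + 2 + 2 * κ + j) = T.site ⟨j, hj⟩) (v : ℕ) :
    EnumState A R l i T x₀ y₀ (j + 1) (j + 1) ((setBitProg κ R l j v).run A s) ∧
    ((setBitProg κ R l j v).run A s).bits n (R + n) =
      Function.update (s.bits n (R + n)) (T.site ⟨j, hj⟩) (decide (v ≠ 0)) := by
  have hκ := T.arity_le
  set s' := (setBitProg κ R l j v).run A s with hs'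
  have hnat : s'.nat = Function.update (Function.update s.nat (l + 2 + κ + j) v)
      (R + n + T.site ⟨j, hj⟩) v := by
    have h0 : (0 : ℕ) ≠ l + 2 + κ + j := by omega
    have h1 : l + 2 + 2 * κ + j ≠ l + 2 + κ + j := by omega
    simp only [hs', setBitProg, Prog.run, MState.spend_nat, MState.writeNat_nat, NExp.eval]
    rw [Function.update_of_ne h0, Function.update_of_ne h1, h.qubits, hsite, ← Nat.add_assoc R]
  have hlt : ∀ c, c < R → c ≠ l + 2 + κ + j → s'.nat c = s.nat c := fun c hc hc' => by
    rw [hnat, Function.update_of_ne (by omega), Function.update_of_ne hc']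
  have hbits : s'.bits n (R + n) =
      Function.update (s.bits n (R + n)) (T.site ⟨j, hj⟩) (decide (v ≠ 0)) := by
    rw [← MState.bits_writeNat]
    refine MState.bits_congr fun c _ => ?_
    rw [hnat, MState.writeNat_nat]
    by_cases hc : R + n + c = R + n + T.site ⟨j, hj⟩
    · simp [hc]
    · rw [Function.update_of_ne hc, Function.update_of_ne hc, Function.update_of_ne (by omega)]
  refine ⟨⟨?_, ?_, ?_, ?_, ?_, ?_, ?_, ?_⟩, hbits⟩
  · rw [hlt 0 (by omega) (by omega), h.qubits]
  · rw [hlt 2 (by omega) (by omega), h.terms]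
  · rw [hlt l (by omega) (by omega), h.index]
  · rw [hlt _ (by omega) (by omega), h.arity]
  · rw [← h.start]
    refine MState.bits_congr fun c hc => ?_
    rw [hnat, Function.update_of_ne (by omega), Function.update_of_ne (by omega)]
  · intro c hc
    have := c.2
    rw [hlt _ (by omega) (by omega), h.row c hc]
  · intro c hc
    have := c.2
    rw [hbits]
    by_cases hcj : (c : ℕ) = j
    · have : c = ⟨j, hj⟩ := Fin.ext hcj
      rw [hnat, Function.update_of_ne (by omega), this]
      simp
    · have hne : T.site c ≠ T.site ⟨j, hj⟩ := fun e => hcj (congrArg Fin.val (T.site_injective e))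
      rw [hlt _ (by omega) (by omega), Function.update_of_ne hne, h.col c (by omega)]
  · intro q hq
    rw [hbits, Function.update_of_ne (fun e => hq ⟨j, hj⟩ (Nat.lt_succ_self j) e.symm), h.off q hq]

/-- Splitting a sum over strings at the bit of one qubit. -/
lemma sum_ite_split {n a : ℕ} {site : Fin a → Fin n} (hsite : Function.Injective site) (j : ℕ)
    (hj : j < a) (y : Basis n) (f : Basis n → ℂ) :
    open Classical in
    (∑ y', if (∀ q, (∀ c : Fin a, j ≤ c → site c ≠ q) → y' q = y q) then f y' else 0) =
    (∑ y', if (∀ q, (∀ c : Fin a, j + 1 ≤ c → site c ≠ q) →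
        y' q = Function.update y (site ⟨j, hj⟩) false q) then f y' else 0) +
    ∑ y', if (∀ q, (∀ c : Fin a, j + 1 ≤ c → site c ≠ q) →
        y' q = Function.update y (site ⟨j, hj⟩) true q) then f y' else 0 := by
  classical
  rw [← Finset.sum_add_distrib]
  refine Finset.sum_congr rfl fun y' _ => ?_
  have key : ∀ b, (∀ q, (∀ c : Fin a, j + 1 ≤ c → site c ≠ q) →
      y' q = Function.update y (site ⟨j, hj⟩) b q) ↔
      (∀ q, (∀ c : Fin a, j ≤ c → site c ≠ q) → y' q = y q) ∧ y' (site ⟨j, hj⟩) = b := by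
    intro b
    constructor
    · intro h
      constructor
      · intro q hq
        rw [h q fun c hc => hq c (by omega), Function.update_of_ne (hq ⟨j, hj⟩ le_rfl).symm]
      · rw [h _ fun c hc e => ?_, Function.update_self]
        have := congrArg Fin.val (hsite e)
        simp only at this
        omega
    · rintro ⟨h, rfl⟩ q hq
      by_cases hqj : q = site ⟨j, hj⟩
      · subst hqj; simp
      · rw [Function.update_of_ne hqj]
        refine h q fun c hc e => ?_
        rcases Nat.eq_or_lt_of_le hc with hc | hc
        · exact hqj (e ▸ congrArg site (Fin.ext hc.symm))
        · exact hq c hc e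
  simp only [key]
  cases y' (site ⟨j, hj⟩) <;> simp

/-- The sum runs over the strings that agree with the current one outside the qubits still to be
assigned. `sum_ite_split` divides it by the bit of qubit `j`, one half for each recursive call. The
cells from `R` on are restored at the end, which lets callers iterate. -/
lemma enumProg_run {L₀ R l i w t : ℕ} {T : LocalTerm n κ} {x₀ y₀ : Basis n}
    (hi : A.ham[i]? = some T) (hL₀ : 2 < L₀) (hl : L₀ ≤ l) (hR : l + (3 * κ + 2) ≤ R)
    {leaf : Prog} (hleaf : leaf.NatFrame fun c => (L₀ ≤ c ∧ c < l) ∨ R ≤ c)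
    {V : ℕ → Prop} (hV : leaf.NumFrame V) (hw : ¬ V w) (G : Basis n → ℂ)
    (hrun : ∀ s, s.nat 0 = n → s.nat 2 = A.ham.length → s.nat l = i → s.nat (l + 1) = T.arity → s.bits n R = x₀ →
      (leaf.run A s).num t = s.num t + s.num w *
        (T.block (s.bits T.arity (l + 2)) (s.bits T.arity (l + 2 + κ)) * G (s.bits n (R + n))) ∧
      ∀ c, R ≤ c → (leaf.run A s).nat c = s.nat c) :
    open Classical in
    ∀ m j s, m + j = κ → j ≤ T.arity → EnumState A R l i T x₀ y₀ j j s →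
      ((enumProg κ R l leaf m j).run A s).num t = s.num t + s.num w *
        (∑ y', if (∀ q, (∀ c : Fin T.arity, j ≤ c → T.site c ≠ q) → y' q = s.bits n (R + n) q) then
          T.block (fun c => y₀ (T.site c)) (fun c => y' (T.site c)) * G y' else 0) ∧
      ∀ c, R ≤ c → ((enumProg κ R l leaf m j).run A s).nat c = s.nat c := by
  classical
  have hκ := T.arity_le
  -- When all qubits are assigned, the current string is the only one left in the sum.
  have full : ∀ s, EnumState A R l i T x₀ y₀ T.arity T.arity s →
      (leaf.run A s).num t = s.num t + s.num w *
        (∑ y', if (∀ q, (∀ c : Fin T.arity, T.arity ≤ c → T.site c ≠ q) →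
          y' q = s.bits n (R + n) q) then
          T.block (fun c => y₀ (T.site c)) (fun c => y' (T.site c)) * G y' else 0) ∧
      ∀ c, R ≤ c → (leaf.run A s).nat c = s.nat c := by
    intro s h
    refine ⟨?_, (hrun s h.qubits h.terms h.index h.arity h.start).2⟩
    rw [(hrun s h.qubits h.terms h.index h.arity h.start).1]
    have h1 : s.bits T.arity (l + 2) = fun c => y₀ (T.site c) := by
      ext c; rw [← h.row c c.2]; rfl
    have h2 : s.bits T.arity (l + 2 + κ) = fun c => s.bits n (R + n) (T.site c) := by
      ext c; rw [← h.col c c.2]; rfl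
    have h3 : ∀ y' : Basis n, (∀ q, (∀ c : Fin T.arity, T.arity ≤ c → T.site c ≠ q) →
          y' q = s.bits n (R + n) q) ↔ y' = s.bits n (R + n) := fun y' =>
      ⟨fun h => funext fun q => h q fun c hc => absurd c.2 (by omega), fun h => by simp [h]⟩
    simp only [h3, h1, h2, Finset.sum_ite_eq', Finset.mem_univ, if_true]
  intro m
  induction m with
  | zero =>
    intro j s hm hj h
    obtain rfl : j = T.arity := by omega
    exact full s h
  | succ m ih =>
    intro j s hm hj h
    by_cases hja : T.arity ≤ j
    · obtain rfl : j = T.arity := by omega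
      have := full s h
      simp only [enumProg, Prog.run, Test.holds, NExp.eval, h.arity, le_refl, if_true,
        MState.spend_nat, MState.spend_num]
      exact this
    push Not at hja
    have hframe := enumProg_natFrame (κ := κ) hleaf m (j + 1) (by omega)
    have hnum := enumProg_numFrame (κ := κ) (R := R) (l := l) hV m (j + 1)
    set q := T.site ⟨j, hja⟩ with hq
    obtain ⟨s₁, hs₁⟩ : ∃ s₁, s₁ =
      (Prog.setNat (.const (l + 2 + j)) (.cell (bitAddress R (l + 2 + 2 * κ + j)))).run A
      ((Prog.site (.const (l + 2 + 2 * κ + j)) (.reg l) (.const j)).run A s) := ⟨_, rfl⟩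
    have hsite : A.ham.siteAt i j = q := by
      simp [LocalHamiltonian.siteAt, hi, hja, hq]
    have hnat₁ : s₁.nat = Function.update (Function.update s.nat (l + 2 + 2 * κ + j) q) (l + 2 + j)
        (s.nat (R + n + q)) := by
      have h0 : R + (n + q) ≠ l + 2 + 2 * κ + j := by omega
      have h1 : (0 : ℕ) ≠ l + 2 + 2 * κ + j := by omega
      simp only [hs₁, Prog.run, MState.spend_nat, MState.writeNat_nat, NExp.eval, h.index, hsite]
      rw [Function.update_of_ne h1, Function.update_self, h.qubits, Function.update_of_ne h0,
        Nat.add_assoc R]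
    have hnum₁ : s₁.num = s.num := by rw [hs₁]; rfl
    have hlt₁ : ∀ c, c ≠ l + 2 + 2 * κ + j → c ≠ l + 2 + j → s₁.nat c = s.nat c :=
      fun c h1 h2 => by rw [hnat₁, Function.update_of_ne h2, Function.update_of_ne h1]
    have hbits₁ : s₁.bits n (R + n) = s.bits n (R + n) :=
      MState.bits_congr fun c _ => hlt₁ _ (by omega) (by omega)
    have hst₁ : EnumState A R l i T x₀ y₀ j (j + 1) s₁ := by
      refine ⟨?_, ?_, ?_, ?_, ?_, ?_, ?_, ?_⟩
      · rw [hlt₁ _ (by omega) (by omega), h.qubits]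
      · rw [hlt₁ _ (by omega) (by omega), h.terms]
      · rw [hlt₁ _ (by omega) (by omega), h.index]
      · rw [hlt₁ _ (by omega) (by omega), h.arity]
      · rw [← h.start]
        exact MState.bits_congr fun c _ => hlt₁ _ (by omega) (by omega)
      · intro c hc
        have := c.2
        by_cases hcj : (c : ℕ) = j
        · rw [hcj, hnat₁, Function.update_self]
          have hcq : T.site c = q := congrArg T.site (Fin.ext hcj)
          rw [hcq]
          refine h.off q fun c' hc' e => ?_
          have := congrArg Fin.val (T.site_injective e)
          simp only at this
          omega
        · rw [hlt₁ _ (by omega) (by omega), h.row c (by omega)]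
      · intro c hc
        have := c.2
        rw [hlt₁ _ (by omega) (by omega), hbits₁, h.col c hc]
      · intro q' hq'
        rw [hbits₁]
        exact h.off q' fun c hc => hq' c (by omega)
    have hq₁ : s₁.nat (l + 2 + 2 * κ + j) = q := by
      rw [hnat₁, Function.update_of_ne (by omega), Function.update_self]
    -- One half of the enumeration, for either bit value. From `R` on, only the bit of qubit `j` in
    -- the current string may differ afterwards.
    have half : ∀ (v : ℕ) (u : MState), EnumState A R l i T x₀ y₀ j (j + 1) u →
        u.nat (l + 2 + 2 * κ + j) = q → ∃ u',
        u' = (enumProg κ R l leaf m (j + 1)).run A ((setBitProg κ R l j v).run A u) ∧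
        EnumState A R l i T x₀ y₀ j (j + 1) u' ∧ u'.nat (l + 2 + 2 * κ + j) = q ∧
        u'.nat (l + 2 + j) = u.nat (l + 2 + j) ∧
        u'.num w = u.num w ∧
        (∀ c, R ≤ c → c ≠ R + n + q → u'.nat c = u.nat c) ∧
        u'.num t = u.num t + u.num w *
        (∑ y', if (∀ q', (∀ c : Fin T.arity, j + 1 ≤ c → T.site c ≠ q') →
          y' q' = Function.update (u.bits n (R + n)) q (decide (v ≠ 0)) q') then
          T.block (fun c => y₀ (T.site c)) (fun c => y' (T.site c)) * G y' else 0) := by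
      intro v u hu huq
      refine ⟨_, rfl, ?_⟩
      obtain ⟨h1, h2⟩ := setBitProg_state hL₀ hl hR hja hu huq v
      obtain ⟨u₁, hu₁⟩ : ∃ u₁, u₁ = (setBitProg κ R l j v).run A u := ⟨_, rfl⟩
      rw [← hu₁] at h1 h2
      have hnat : ∀ c, c ≠ l + 2 + κ + j → c ≠ R + n + q → u₁.nat c = u.nat c := by
        intro c hc hc'
        have e0 : (0 : ℕ) ≠ l + 2 + κ + j := by omega
        have e1 : l + 2 + 2 * κ + j ≠ l + 2 + κ + j := by omega
        rw [Nat.add_assoc] at hc'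
        simp only [hu₁, setBitProg, Prog.run, MState.spend_nat, MState.writeNat_nat, NExp.eval]
        rw [Function.update_of_ne e0, Function.update_of_ne e1, hu.qubits, huq,
          Function.update_of_ne hc', Function.update_of_ne hc]
      have hnum' : u₁.num = u.num := by rw [hu₁]; rfl
      obtain ⟨h3, h4⟩ := ih (j + 1) u₁ (by omega) (by omega) h1
      obtain ⟨u₂, hu₂⟩ : ∃ u₂, u₂ = (enumProg κ R l leaf m (j + 1)).run A u₁ := ⟨_, rfl⟩
      rw [← hu₂] at h3 h4
      have hlow : ∀ c, ¬ EnumFrame κ L₀ R l (j + 1) c → u₂.nat c = u₁.nat c := fun c hc => by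
        rw [hu₂]; exact Prog.run_nat_of_natFrame A hframe _ hc
      have hlow' : ∀ c, c < R → (c < L₀ ∨ l ≤ c) → c < l + 2 + κ + j + 1 →
          ¬ (l + 2 + j + 1 ≤ c ∧ c < l + 2 + κ) → u₂.nat c = u₁.nat c := fun c _ _ _ _ =>
        hlow c (by unfold EnumFrame; omega)
      have hbits₂ : u₂.bits n (R + n) = u₁.bits n (R + n) :=
        MState.bits_congr fun c _ => h4 _ (by omega)
      rw [← hu₁, ← hu₂]
      refine ⟨⟨?_, ?_, ?_, ?_, ?_, ?_, ?_, ?_⟩, ?_, ?_, ?_, ?_, ?_⟩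
      · rw [hlow' _ (by omega) (by omega) (by omega) (by omega), h1.qubits]
      · rw [hlow' _ (by omega) (by omega) (by omega) (by omega), h1.terms]
      · rw [hlow' _ (by omega) (by omega) (by omega) (by omega), h1.index]
      · rw [hlow' _ (by omega) (by omega) (by omega) (by omega), h1.arity]
      · rw [← h1.start]
        exact MState.bits_congr fun c _ => h4 _ (by omega)
      · intro c hc
        have := c.2
        change decide (u₂.nat _ ≠ 0) = _
        rw [hlow' _ (by omega) (by omega) (by omega) (by omega), h1.row c hc]
      · intro c hc
        have := c.2
        change decide (u₂.nat _ ≠ 0) = u₂.bits n (R + n) _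
        rw [hlow' _ (by omega) (by omega) (by omega) (by omega), hbits₂, h1.col c (by omega)]
      · intro q' hq'
        rw [hbits₂, h1.off q' hq']
      · rw [hlow _ (by unfold EnumFrame; omega), hnat _ (by omega) (by omega), huq]
      · rw [hlow _ (by unfold EnumFrame; omega), hnat _ (by omega) (by omega)]
      · rw [hu₂, Prog.run_num_of_numFrame A hnum _ hw, hnum']
      · intro c hc hc'
        rw [h4 c hc, hnat c (by omega) hc']
      · rw [h3, h2, hnum']
    obtain ⟨s₂, hs₂, hst₂, hq₂, hrow₂, hw₂, hR₂, hacc₂⟩ := half 0 s₁ hst₁ hq₁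
    obtain ⟨s₃, hs₃, hst₃, hq₃, hrow₃, hw₃, hR₃, hacc₃⟩ := half 1 s₂ hst₂ hq₂
    have hna : ¬ T.arity ≤ j := by omega
    obtain ⟨s₄, hs₄⟩ : ∃ s₄, s₄ = (enumProg κ R l leaf (m + 1) j).run A s := ⟨_, rfl⟩
    rw [← hs₄]
    have hrow₁ : s₁.nat (l + 2 + j) = s.nat (R + n + q) := by rw [hnat₁, Function.update_self]
    have hnat₄ : s₄.nat = Function.update s₃.nat (R + n + q) (s.nat (R + n + q)) := by
      rw [← hrow₁, ← hrow₂, ← hrow₃]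
      have : R + n + q = R + (s₃.nat 0 + s₃.nat (l + 2 + 2 * κ + j)) := by
        rw [hst₃.qubits, hq₃, Nat.add_assoc]
      rw [this, hs₄, hs₃, hs₂, hs₁]
      simp only [enumProg, Prog.run, Test.holds, NExp.eval, h.arity, hna, if_false,
        MState.spend_nat, MState.writeNat_nat]
    have hnum₄ : s₄.num = s₃.num := by
      rw [hs₄, hs₃, hs₂, hs₁]
      simp only [enumProg, Prog.run, Test.holds, NExp.eval, h.arity, hna, if_false,
        MState.spend_num, MState.writeNat_num]
    refine ⟨?_, fun c hc => ?_⟩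
    · rw [hnum₄, hacc₃, hacc₂, hw₂, hnum₁, add_assoc, ← mul_add, sum_ite_split T.site_injective j hja]
      -- The first half leaves a changed bit behind, but it is the very bit that the second half
      -- overwrites.
      have hu : Function.update (s₂.bits n (R + n)) q true =
          Function.update (s.bits n (R + n)) q true := by
        rw [← hbits₁]
        ext q'
        by_cases hq' : q' = q
        · simp [hq']
        · have : (q' : ℕ) ≠ q := fun e => hq' (Fin.ext e)
          simp only [Function.update_of_ne hq', MState.bits]
          rw [hR₂ (R + n + q') (by omega) (by omega)]
      have h0 : decide ((0 : ℕ) ≠ 0) = false := rfl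
      have h1 : decide ((1 : ℕ) ≠ 0) = true := rfl
      rw [h0, h1, hu, hbits₁]
    · rw [hnat₄]
      by_cases hcq : c = R + n + q
      · rw [hcq, Function.update_self]
      · rw [Function.update_of_ne hcq, hR₃ c hc hcq, hR₂ c hc hcq, hlt₁ c (by omega) (by omega)]

/-- For `j = 0` the condition in `enumProg_run` is agreement off the support of the term, so a full
enumeration evaluates one entry of `block ⊗ I` applied to `G`. -/
lemma toMatrix_mulVec (T : LocalTerm n κ) (G : Basis n → ℂ) (y : Basis n) :
    open Classical in
    (T.toMatrix *ᵥ G) y =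
      ∑ y', if (∀ q, (∀ c : Fin T.arity, 0 ≤ (c : ℕ) → T.site c ≠ q) → y' q = y q) then
        T.block (fun c => y (T.site c)) (fun c => y' (T.site c)) * G y' else 0 := by
  classical
  simp only [Matrix.mulVec, dotProduct, LocalTerm.toMatrix, Matrix.of_apply, ite_mul, zero_mul]
  refine Finset.sum_congr rfl fun y' _ => if_congr ?_ rfl rfl
  simp only [Set.mem_range, not_exists, zero_le, true_imp_iff]
  exact forall_congr' fun q => imp_congr Iff.rfl eq_comm

lemma stepMatrix_mulVec (H : LocalHamiltonian n κ) (G : Basis n → ℂ) (y : Basis n) :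
    (stepMatrix H *ᵥ G) y =
      G y - ((2 * Real.pi : ℝ) : ℂ)⁻¹ * (H.map fun T => (T.toMatrix *ᵥ G) y).sum := by
  have : (LocalHamiltonian.toMatrix H *ᵥ G) y = (H.map fun T => (T.toMatrix *ᵥ G) y).sum := by
    unfold LocalHamiltonian.toMatrix
    induction H with
    | nil => simp
    | cons T H ih => simp [Matrix.add_mulVec, ih]
  simp [stepMatrix, Matrix.sub_mulVec, Matrix.smul_mulVec, this]

/-- The path sum is evaluated as an iterated matrix-vector product by recursion on the first step.
The recursive call plays the role of `G` in `enumProg_run`, with the matrix element multiplied into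
its weight. -/
lemma goProg_run {L₀ R T : ℕ} (hL₀ : 2 < L₀) {x₀ : Basis n} :
    ∀ k, L₀ + k * (3 * κ + 2) ≤ R → ∀ s : MState, s.nat 0 = n → s.nat 2 = A.ham.length →
      s.bits n R = x₀ →
      ((goProg κ L₀ R T k).run A s).num T = s.num T + s.num (T + 4 + k) *
        (stepMatrix A.ham ^ k *ᵥ A.ratio x₀) (s.bits n (R + n)) ∧
      ∀ c, R ≤ c → ((goProg κ L₀ R T k).run A s).nat c = s.nat c
  | 0, _, s, h0, h2, hx => by
    simp [goProg, Prog.run, h0, hx]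
  | k + 1, hk, s, h0, h2, hx => by
    have hk' : (k + 1) * (3 * κ + 2) = k * (3 * κ + 2) + (3 * κ + 2) := Nat.succ_mul _ _
    have ih := goProg_run (R := R) (T := T) hL₀ (x₀ := x₀) k (by omega)
    have hnf := goProg_natFrame κ L₀ R T k
    have hvf := goProg_numFrame κ L₀ R T k
    obtain ⟨l, hl⟩ : ∃ l, l = L₀ + k * (3 * κ + 2) := ⟨_, rfl⟩
    rw [← hl] at hnf
    set G := stepMatrix A.ham ^ k *ᵥ A.ratio x₀ with hG
    set y := s.bits n (R + n) with hy
    obtain ⟨leaf, hleaf⟩ : ∃ leaf, leaf = Prog.seq (.entry (.const (T + 2)) (.reg l)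
        (.const (l + 2)) (.const (l + 2 + κ)))
      (.seq (.setNum (.const (T + 4 + k)) (.mul (.reg (T + 4 + (k + 1)))
        (.sub (.ofNat (.const 0)) (.div (.reg (T + 2)) (.mul (.ofNat (.const 2)) .pi)))))
        (goProg κ L₀ R T k)) := ⟨_, rfl⟩
    have hleafnat : leaf.NatFrame fun c => (L₀ ≤ c ∧ c < l) ∨ R ≤ c := by
      rw [hleaf]; exact ⟨trivial, trivial, hnf⟩
    have hleafnum : leaf.NumFrame fun c => c = T ∨ (T + 2 ≤ c ∧ c < T + 4 + (k + 1)) := by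
      rw [hleaf]
      refine ⟨?_, ?_, hvf.mono fun c hc => by omega⟩ <;> simp only [Prog.NumFrame, NExp.Lands] <;>
        omega
    have hleafrun : ∀ i t, A.ham[i]? = some t → ∀ u : MState, u.nat 0 = n →
        u.nat 2 = A.ham.length → u.nat l = i → u.nat (l + 1) = t.arity → u.bits n R = x₀ →
        (leaf.run A u).num T = u.num T + u.num (T + 4 + (k + 1)) *
        (t.block (u.bits t.arity (l + 2)) (u.bits t.arity (l + 2 + κ)) *
          (-((2 * Real.pi : ℝ) : ℂ)⁻¹ * G (u.bits n (R + n)))) ∧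
        ∀ c, R ≤ c → (leaf.run A u).nat c = u.nat c := by
      intro i t hi u hu0 hu2 hul _ hux
      obtain ⟨v, hv⟩ : ∃ v, v = (Prog.setNum (.const (T + 4 + k)) (.mul (.reg (T + 4 + (k + 1)))
        (.sub (.ofNat (.const 0)) (.div (.reg (T + 2)) (.mul (.ofNat (.const 2)) .pi))))).run A
        ((Prog.entry (.const (T + 2)) (.reg l) (.const (l + 2)) (.const (l + 2 + κ))).run A u) :=
        ⟨_, rfl⟩
      have hvn : v.nat = u.nat := by rw [hv]; rfl
      have hvb : ∀ m a, v.bits m a = u.bits m a := fun m a =>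
        MState.bits_congr fun _ _ => by rw [hvn]
      have hvw : v.num (T + 4 + k) = u.num (T + 4 + (k + 1)) * (0 -
          t.block (u.bits t.arity (l + 2)) (u.bits t.arity (l + 2 + κ)) / (2 * Real.pi)) := by
        have : T + 4 + (k + 1) ≠ T + 2 := by omega
        simp only [hv, Prog.run, hul, LocalHamiltonian.entryAt, hi, MState.spend_num, NExp.eval,
          MState.writeNum_num, CExp.eval, Function.update_self, Function.update_of_ne this, Nat.cast_zero, Nat.cast_ofNat]
      have hvT : v.num T = u.num T := by
        simp only [hv, Prog.run, MState.spend_num, MState.writeNum_num, NExp.eval]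
        rw [Function.update_of_ne (by omega), Function.update_of_ne (by omega)]
      obtain ⟨h3, h4⟩ := ih v (by rw [hvn, hu0]) (by rw [hvn, hu2]) (by rw [hvb, hux])
      have hr : (leaf.run A u).num = ((goProg κ L₀ R T k).run A v).num := by
        rw [hleaf, hv]; rfl
      have hr' : (leaf.run A u).nat = ((goProg κ L₀ R T k).run A v).nat := by
        rw [hleaf, hv]; rfl
      rw [hr, hr']
      refine ⟨?_, fun c hc => by rw [h4 c hc, hvn]⟩
      rw [h3, hvT, hvw, hvb]
      push_cast
      ring
    obtain ⟨s₁, hs₁⟩ : ∃ s₁, s₁ = (Prog.setNat (.const l) (.const 0)).run A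
      ((goProg κ L₀ R T k).run A
        ((Prog.setNum (.const (T + 4 + k)) (.reg (T + 4 + (k + 1)))).run A s)) := ⟨_, rfl⟩
    have hlowR : ∀ c, c < L₀ → ¬ ((L₀ ≤ c ∧ c < l) ∨ R ≤ c) := fun c hc => by omega
    obtain ⟨h5, h6⟩ := ih ((Prog.setNum (.const (T + 4 + k)) (.reg (T + 4 + (k + 1)))).run A s)
      (by simpa [Prog.run] using h0) (by simpa [Prog.run] using h2) hx
    have hs₁R : ∀ c, R ≤ c → s₁.nat c = s.nat c := fun c hc => by
      have := h6 c hc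
      simp only [hs₁, Prog.run, MState.spend_nat, MState.writeNat_nat, NExp.eval] at this ⊢
      rw [Function.update_of_ne (by omega), this]
      rfl
    have hs₁low : ∀ c, c < L₀ → s₁.nat c = s.nat c := fun c hc => by
      simp only [hs₁, Prog.run, MState.spend_nat, MState.writeNat_nat, NExp.eval]
      rw [Function.update_of_ne (by omega), Prog.run_nat_of_natFrame A hnf _ (hlowR c hc)]
      rfl
    have hs₁w : s₁.num (T + 4 + (k + 1)) = s.num (T + 4 + (k + 1)) := by
      have : s₁.num (T + 4 + (k + 1)) = ((goProg κ L₀ R T k).run A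
        ((Prog.setNum (.const (T + 4 + k)) (.reg (T + 4 + (k + 1)))).run A s)).num
          (T + 4 + (k + 1)) := by rw [hs₁]; rfl
      rw [this, Prog.run_num_of_numFrame A hvf _ (by omega)]
      simp [Prog.run, Function.update_of_ne]
    have hs₁T : s₁.num T = s.num T + s.num (T + 4 + (k + 1)) * G y := by
      have : s₁.num T = ((goProg κ L₀ R T k).run A
        ((Prog.setNum (.const (T + 4 + k)) (.reg (T + 4 + (k + 1)))).run A s)).num T := by
        rw [hs₁]; rfl
      rw [this, h5]
      have hb : ((Prog.setNum (.const (T + 4 + k)) (.reg (T + 4 + (k + 1)))).run A s).bits n (R + n)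
        = y := rfl
      rw [hb]
      simp [Prog.run, Function.update_of_ne, show T ≠ T + 4 + k by omega]
    have hs₁l : s₁.nat l = 0 := by simp [hs₁, Prog.run]
    obtain ⟨body, hbody⟩ : ∃ body, body = Prog.seq (.arity (.const (l + 1)) (.reg l))
      (.seq (enumProg κ R l leaf κ 0)
        (.setNat (.const l) (.add (.reg l) (.const 1)))) := ⟨_, rfl⟩
    have key := iterate_invariant (f := body.run A) (K := A.ham.length) (s := s₁)
      (fun i u => u.nat 0 = n ∧ u.nat 2 = A.ham.length ∧ u.nat l = i ∧
        (∀ c, R ≤ c → u.nat c = s.nat c) ∧ u.num (T + 4 + (k + 1)) = s.num (T + 4 + (k + 1)) ∧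
        u.num T = s.num T + s.num (T + 4 + (k + 1)) * (G y - ((2 * Real.pi : ℝ) : ℂ)⁻¹ *
          ((A.ham.take i).map fun t => (t.toMatrix *ᵥ G) y).sum))
      ⟨by rw [hs₁low 0 (by omega), h0], by rw [hs₁low 2 (by omega), h2], hs₁l, hs₁R, hs₁w,
        by rw [hs₁T]; simp⟩ (by
      rintro i u hi ⟨hu0, hu2, hul, huR, huw, huT⟩
      obtain ⟨t, ht⟩ : ∃ t, A.ham[i]? = some t := ⟨A.ham[i], List.getElem?_eq_getElem hi⟩
      obtain ⟨v, hv⟩ : ∃ v, v = (Prog.arity (.const (l + 1)) (.reg l)).run A u := ⟨_, rfl⟩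
      have hvnat : v.nat = Function.update u.nat (l + 1) t.arity := by
        simp [hv, Prog.run, hul, LocalHamiltonian.arityAt, ht]
      have hvnum : v.num = u.num := by rw [hv]; rfl
      have hvR : ∀ c, R ≤ c → v.nat c = s.nat c := fun c hc => by
        rw [hvnat, Function.update_of_ne (by omega), huR c hc]
      have hvx : v.bits n R = x₀ := by
        rw [← hx]; exact MState.bits_congr fun c _ => hvR _ (by omega)
      have hvy : v.bits n (R + n) = y := MState.bits_congr fun c _ => hvR _ (by omega)
      have hst : EnumState A R l i t x₀ y 0 0 v := by
        refine ⟨?_, ?_, ?_, ?_, hvx, fun c hc => absurd hc (by omega),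
          fun c hc => absurd hc (by omega), fun q _ => by rw [hvy]⟩
        · rw [hvnat, Function.update_of_ne (by omega), hu0]
        · rw [hvnat, Function.update_of_ne (by omega), hu2]
        · rw [hvnat, Function.update_of_ne (by omega), hul]
        · rw [hvnat, Function.update_self]
      obtain ⟨h7, h8⟩ := enumProg_run (w := T + 4 + (k + 1)) (t := T) ht hL₀ (by omega) (by omega)
        hleafnat hleafnum (by omega) (fun y => -((2 * Real.pi : ℝ) : ℂ)⁻¹ * G y)
        (hleafrun i t ht) κ 0 v rfl (Nat.zero_le _) hst
      have hef := enumProg_natFrame (κ := κ) hleafnat κ 0 rfl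
      have hen := enumProg_numFrame (κ := κ) (R := R) (l := l) hleafnum κ 0
      obtain ⟨v', hv'⟩ : ∃ v', v' = (enumProg κ R l leaf κ 0).run A v := ⟨_, rfl⟩
      rw [← hv'] at h7 h8
      have hlow : ∀ c, c < L₀ ∨ c = l → v'.nat c = u.nat c := fun c hc => by
        rw [hv', Prog.run_nat_of_natFrame A hef _ (by unfold EnumFrame; omega), hvnat,
          Function.update_of_ne (by omega)]
      have hbn : (body.run A u).nat = Function.update v'.nat l (v'.nat l + 1) := by
        rw [hbody, hv', hv]; rfl
      have hbv : (body.run A u).num = v'.num := by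
        rw [hbody, hv', hv]; rfl
      rw [hbn, hbv]
      refine ⟨?_, ?_, ?_, ?_, ?_, ?_⟩
      · rw [Function.update_of_ne (by omega), hlow 0 (by omega), hu0]
      · rw [Function.update_of_ne (by omega), hlow 2 (by omega), hu2]
      · rw [Function.update_self, hlow l (by omega), hul]
      · intro c hc
        rw [Function.update_of_ne (by omega), h8 c hc, hvR c hc]
      · rw [hv', Prog.run_num_of_numFrame A hen _ (by omega), hvnum, huw]
      · rw [h7, hvnum, huT, huw, hvy, List.take_add_one, ht]
        simp only [Option.toList_some, List.map_append, List.map_cons, List.map_nil,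
          List.sum_append, List.sum_cons, List.sum_nil, add_zero]
        rw [toMatrix_mulVec t G y, mul_add, mul_sub, mul_sub]
        have : ∀ (p : Prop) [Decidable p] (b g : ℂ),
            (if p then b * (-((2 * Real.pi : ℝ) : ℂ)⁻¹ * g) else 0) =
            -((2 * Real.pi : ℝ) : ℂ)⁻¹ * if p then b * g else 0 := by
          intro p _ b g; split_ifs <;> ring
        simp only [this, ← Finset.mul_sum]
        ring)
    obtain ⟨e, he⟩ : ∃ e, (goProg κ L₀ R T (k + 1)).run A s =
        ((body.run A)^[A.ham.length] s₁).spend e := by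
      have : s₁.nat 2 = A.ham.length := by rw [hs₁low 2 (by omega), h2]
      -- Three sequencing steps at one unit each, and three units for entering the loop.
      refine ⟨6, ?_⟩
      rw [← this, hs₁, hbody, hleaf, hl]
      rfl
    rw [he]
    simp only [MState.spend_nat, MState.spend_num]
    refine ⟨?_, key.2.2.2.1⟩
    rw [key.2.2.2.2.2, List.take_length, pow_succ', ← Matrix.mulVec_mulVec, stepMatrix_mulVec]

end Enumeration

/-! ## The signal: medians of means of path sums -/

/-- Splitting off the first step gives one factor of the matrix. The ratio `ρ x` depends on the path
only through its end point, so it can be any vector in the induction. -/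
lemma pathSum_eq {n κ : ℕ} (H : LocalHamiltonian n κ) (ρ : Basis n → Basis n → ℂ) (k : ℕ)
    (x : Basis n) : pathSum H ρ k x = (stepMatrix H ^ k *ᵥ ρ x) x := by
  have key : ∀ (k : ℕ) (G : Basis n → ℂ) (x : Basis n),
      ∑ w : Fin k → Basis n, G ((Fin.cons x w : Fin (k + 1) → Basis n) (Fin.last k)) *
        ∏ i : Fin k, stepMatrix H ((Fin.cons x w : Fin (k + 1) → Basis n) i.castSucc)
          ((Fin.cons x w : Fin (k + 1) → Basis n) i.succ) = (stepMatrix H ^ k *ᵥ G) x := by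
    intro k
    induction k with
    | zero => intro G x; simp
    | succ k ih =>
      intro G x
      rw [pow_succ', ← Matrix.mulVec_mulVec]
      rw [Matrix.mulVec, dotProduct, ← (Fin.consEquiv fun _ => Basis n).sum_comp,
        Fintype.sum_prod_type]
      refine Finset.sum_congr rfl fun y _ => ?_
      rw [← ih, Finset.mul_sum]
      refine Finset.sum_congr rfl fun w _ => ?_
      rw [Fin.prod_univ_succ]
      simp only [Fin.consEquiv_apply, Fin.castSucc_zero, Fin.cons_zero, Fin.cons_succ,
        ← Fin.succ_last, ← Fin.succ_castSucc]
      ring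
  exact key k (ρ x) x

/-- Among the indices with at least half of the numbers below or equal, take one with the smallest
value. If more than half of the numbers were strictly smaller, the largest of those would have been
eligible too. -/
lemma exists_isMiddle {r : ℕ} (hr : 0 < r) (f : Fin r → ℝ) : ∃ i, IsMiddle f i := by
  classical
  have hne : Nonempty (Fin r) := ⟨⟨0, hr⟩⟩
  have hcard : ∀ p : Fin r → Prop, Nat.card {j // p j} = (Finset.univ.filter p).card := fun p => by
    rw [Nat.card_eq_fintype_card, Fintype.card_subtype]
  unfold IsMiddle
  simp only [hcard]
  set C := Finset.univ.filter fun i => r ≤ 2 * (Finset.univ.filter fun j => f j ≤ f i).card with hC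
  have hCne : C.Nonempty := by
    obtain ⟨i, hi⟩ := Finite.exists_max f
    refine ⟨i, ?_⟩
    simp [hC, hi]
    omega
  obtain ⟨i, hiC, hi⟩ := C.exists_min_image f hCne
  refine ⟨i, (Finset.mem_filter.1 hiC).2, ?_⟩
  have hsum := Finset.card_filter_add_card_filter_not (s := (Finset.univ : Finset (Fin r)))
    (fun j => f i ≤ f j)
  rw [Finset.card_univ, Fintype.card_fin] at hsum
  set D := Finset.univ.filter fun j => ¬ f i ≤ f j with hD
  rcases D.eq_empty_or_nonempty with h | h
  · rw [h] at hsum; simp at hsum; omega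
  obtain ⟨i', hi'D, hi'⟩ := D.exists_max_image f h
  have hlt : f i' < f i := not_le.1 (Finset.mem_filter.1 hi'D).2
  have hnot : i' ∉ C := fun h' => absurd (hi i' h') (not_le.2 hlt)
  have hDC : D.card ≤ (Finset.univ.filter fun j => f j ≤ f i').card := by
    refine Finset.card_le_card fun j hj => ?_
    simp [hi' j hj]
  simp only [hC, Finset.mem_filter, Finset.mem_univ, true_and, not_le] at hnot
  omega

lemma exists_first_isMiddle {r : ℕ} (hr : 0 < r) (f : Fin r → ℝ) :
    ∃ i, IsMiddle f i ∧ ∀ j, j < i → ¬ IsMiddle f j := by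
  classical
  obtain ⟨i, hi⟩ := exists_isMiddle hr f
  obtain ⟨i', h1, h2⟩ := (Finset.univ.filter (IsMiddle f)).exists_min_image id
    ⟨i, by simp [hi]⟩
  refine ⟨i', (Finset.mem_filter.1 h1).2, fun j hj hm => ?_⟩
  exact absurd (h2 j (by simp [hm])) (not_le.2 hj)

/-- `Nat.count` is what the loop of `countProg` accumulates. -/
lemma isMiddle_iff {r : ℕ} (f : ℕ → ℝ) (i : Fin r) :
    open Classical in
    IsMiddle (fun j : Fin r => f j) i ↔
      r ≤ 2 * Nat.count (fun j => f j ≤ f i) r ∧ r ≤ 2 * Nat.count (fun j => f i ≤ f j) r := by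
  classical
  have hcard : ∀ p : ℕ → Prop, Nat.card {j : Fin r // p j} = Nat.count p r := fun p => by
    rw [Nat.card_eq_fintype_card, Fintype.card_subtype, Nat.count_eq_card_filter_range,
      Finset.card_filter, Finset.card_filter,
      Fin.sum_univ_eq_sum_range (fun j => if p j then 1 else 0) r]
  unfold IsMiddle
  rw [hcard fun j => f j ≤ f i, hcard fun j => f i ≤ f j]

/-- Draw a sample and add the real part of its path sum to the register `T + 1`. -/
noncomputable def sampleProg (κ L₀ R T k : ℕ) : Prog :=
  .seq (.sample (.const R))
  (.seq (.setNat (.const 11) (.const 0))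
  -- Copy the sample to the cells from `R + n` on, where the path moves; the original stays in place
  -- as the reference string of the ratio.
  (.seq (.loop (.reg 0)
    (.seq (.setNat (bitAddress R 11) (.cell (.add (.const R) (.reg 11))))
      (.setNat (.const 11) (.add (.reg 11) (.const 1)))))
  (.seq (.setNum (.const T) (.ofNat (.const 0)))
  (.seq (.setNum (.const (T + 4 + k)) (.ofNat (.const 1)))
  (.seq (goProg κ L₀ R T k)
    (.setNum (.const (T + 1)) (.add (.reg (T + 1)) (.re (.reg T)))))))))

/-- Store the means of groups of samples in the number cells from `M` on. The size and the number of
the groups are in the registers `6` and `7`. -/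
noncomputable def meansProg (κ L₀ R T M k : ℕ) : Prog :=
  .seq (.setNat (.const 10) (.const 0))
    (.loop (.reg 7)
      (.seq (.setNum (.const (T + 1)) (.ofNat (.const 0)))
      (.seq (.loop (.reg 6) (sampleProg κ L₀ R T k))
      (.seq (.setNum (.add (.const M) (.reg 10)) (.div (.reg (T + 1)) (.ofNat (.reg 6))))
        (.setNat (.const 10) (.add (.reg 10) (.const 1)))))))

/-- Compare the number in cell `M + i`, where `i` is in the register `12`, with all the others. -/
def countProg (M : ℕ) : Prog :=
  .seq (.setNat (.const 13) (.const 0))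
  (.seq (.setNat (.const 14) (.const 0))
  (.seq (.setNat (.const 15) (.const 0))
    (.loop (.reg 7)
      (.seq (.ite (.reLE (.cell (.add (.const M) (.reg 13))) (.cell (.add (.const M) (.reg 12))))
        (.setNat (.const 14) (.add (.reg 14) (.const 1))) .skip)
      (.seq (.ite (.reLE (.cell (.add (.const M) (.reg 12))) (.cell (.add (.const M) (.reg 13))))
        (.setNat (.const 15) (.add (.reg 15) (.const 1))) .skip)
        (.setNat (.const 13) (.add (.reg 13) (.const 1))))))))

/-- Store the median of the numbers in the cells from `M` on in the register `k`. -/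
def medianProg (M k : ℕ) : Prog :=
  .seq (.setNat (.const 12) (.reg 7))
    (.loop (.reg 7)
      (.seq (.setNat (.const 12) (.sub (.reg 12) (.const 1)))
      (.seq (countProg M)
        (.ite (.natLE (.reg 7) (.add (.reg 14) (.reg 14)))
          (.ite (.natLE (.reg 7) (.add (.reg 15) (.reg 15)))
            (.setNum (.const k) (.cell (.add (.const M) (.reg 12)))) .skip) .skip))))

/-- Compute the signal values `0, …, k - 1`. -/
noncomputable def signalProg (κ L₀ R T M : ℕ) : ℕ → Prog
  | 0 => .skip
  | k + 1 => .seq (signalProg κ L₀ R T M k) (.seq (meansProg κ L₀ R T M k) (medianProg M k))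

lemma sampleProg_natFrame {κ L₀ R T k : ℕ} (hL₀ : 20 ≤ L₀) (hR : L₀ ≤ R) :
    (sampleProg κ L₀ R T k).NatFrame fun c => c = 11 ∨ 20 ≤ c := by
  have hR' : ∀ k, R ≤ k → k = 11 ∨ 20 ≤ k := fun k hk => by omega
  exact ⟨hR', Or.inl rfl, ⟨hR', Or.inl rfl⟩, trivial, trivial,
    (goProg_natFrame κ L₀ R T k).mono fun c hc => by omega, trivial⟩

lemma sampleProg_numFrame {κ L₀ R T k : ℕ} :
    (sampleProg κ L₀ R T k).NumFrame fun c => T ≤ c ∧ c < T + 5 + k := by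
  refine ⟨trivial, trivial, ⟨trivial, trivial⟩, ?_, ?_, (goProg_numFrame κ L₀ R T k).mono ?_, ?_⟩ <;>
    (try simp only [Prog.NumFrame, NExp.Lands]) <;> (try intro c hc) <;> omega

lemma meansProg_natFrame {κ L₀ R T M k : ℕ} (hL₀ : 20 ≤ L₀) (hR : L₀ ≤ R) :
    (meansProg κ L₀ R T M k).NatFrame (10 ≤ ·) :=
  ⟨le_refl 10, trivial, (sampleProg_natFrame hL₀ hR).mono fun c hc => by omega, trivial, le_refl 10⟩

lemma meansProg_numFrame {κ L₀ R T M k : ℕ} (hM : T ≤ M) :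
    (meansProg κ L₀ R T M k).NumFrame fun c => T ≤ c := by
  refine ⟨trivial, ?_, sampleProg_numFrame.mono fun c hc => by omega, ?_, trivial⟩ <;>
    simp only [Prog.NumFrame, NExp.Lands] <;> omega

lemma medianProg_natFrame {M k : ℕ} : (medianProg M k).NatFrame (10 ≤ ·) := by
  simp [medianProg, countProg, Prog.NatFrame, NExp.Lands]

lemma medianProg_numFrame {M k : ℕ} : (medianProg M k).NumFrame (· = k) := by
  simp [medianProg, countProg, Prog.NumFrame, NExp.Lands]

lemma countProg_natFrame {M : ℕ} : (countProg M).NatFrame fun c => 13 ≤ c ∧ c ≤ 15 := by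
  simp [countProg, Prog.NatFrame, NExp.Lands]

lemma medianProg_noSample {M k : ℕ} : (medianProg M k).NoSample := by
  simp [medianProg, countProg, Prog.NoSample]

lemma signalProg_natFrame {κ L₀ R T M : ℕ} (hL₀ : 20 ≤ L₀) (hR : L₀ ≤ R) :
    ∀ k, (signalProg κ L₀ R T M k).NatFrame (10 ≤ ·)
  | 0 => trivial
  | k + 1 => ⟨signalProg_natFrame hL₀ hR k, meansProg_natFrame hL₀ hR, medianProg_natFrame⟩

lemma signalProg_loopsOn {κ L₀ R T M : ℕ} : ∀ k, (signalProg κ L₀ R T M k).LoopsOn 10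
  | 0 => trivial
  | k + 1 => by
    refine ⟨signalProg_loopsOn k, ?_, ?_⟩
    · simp [meansProg, sampleProg, Prog.LoopsOn, goProg_loopsOn]
    · simp [medianProg, countProg, Prog.LoopsOn]

/-! ### Correctness of the sampling, averaging and median programs -/

section

variable {n κ : ℕ} {A : Access n κ}

lemma sampleProg_run {L₀ R T k : ℕ} (hL₀ : 20 ≤ L₀) (hR : L₀ + k * (3 * κ + 2) ≤ R) {s : MState}
    (h0 : s.nat 0 = n) (h2 : s.nat 2 = A.ham.length) :
    ((sampleProg κ L₀ R T k).run A s).num (T + 1) =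
      s.num (T + 1) + ((pathSum A.ham A.ratio k (A.samples s.draws)).re : ℂ) ∧
    ((sampleProg κ L₀ R T k).run A s).draws = s.draws + 1 := by
  set x := A.samples s.draws with hx
  obtain ⟨s₁, hs₁⟩ : ∃ s₁, s₁ = (Prog.setNat (.const 11) (.const 0)).run A
    ((Prog.sample (.const R)).run A s) := ⟨_, rfl⟩
  have h1x : s₁.bits n R = x := by
    ext i
    have hi := i.2
    have : R + (i : ℕ) ≠ 11 := by omega
    simp only [MState.bits, hs₁, Prog.run, MState.spend_nat, MState.writeNat_nat, NExp.eval]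
    rw [Function.update_of_ne this]
    simp [MState.writeBits, hx]
  have h1low : ∀ c, c < R → c ≠ 11 → s₁.nat c = s.nat c := fun c hc hc' => by
    simp only [hs₁, Prog.run, MState.spend_nat, MState.writeNat_nat, NExp.eval]
    rw [Function.update_of_ne hc']
    simp [MState.writeBits, not_le.2 hc]
  have h1n : s₁.num = s.num := by rw [hs₁]; rfl
  have h1d : s₁.draws = s.draws + 1 := by rw [hs₁]; rfl
  have h111 : s₁.nat 11 = 0 := by simp [hs₁, Prog.run]
  obtain ⟨body, hbody⟩ : ∃ body, body = Prog.seq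
    (.setNat (bitAddress R 11) (.cell (.add (.const R) (.reg 11))))
      (.setNat (.const 11) (.add (.reg 11) (.const 1))) := ⟨_, rfl⟩
  have key := iterate_invariant (f := body.run A) (K := n) (s := s₁)
    (fun i u => u.nat 11 = i ∧ (∀ c, c < R + n → c ≠ 11 → u.nat c = s₁.nat c) ∧
      (∀ c, c < i → u.nat (R + n + c) = s₁.nat (R + c)) ∧ u.num = s.num ∧ u.draws = s.draws + 1)
    ⟨h111, fun _ _ _ => rfl, fun c hc => absurd hc (by omega), h1n, h1d⟩ (by
    rintro i u hi ⟨hu11, hu, hui, hun, hud⟩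
    have hu0 : u.nat 0 = n := by rw [hu 0 (by omega) (by omega), h1low 0 (by omega) (by omega), h0]
    have hnat : (body.run A u).nat =
        Function.update (Function.update u.nat (R + (n + i)) (u.nat (R + i))) 11 (i + 1) := by
      simp only [hbody, Prog.run, MState.spend_nat, MState.writeNat_nat, NExp.eval, hu0, hu11]
      rw [Function.update_of_ne (by omega), hu11]
    rw [hnat]
    refine ⟨by simp, fun c hc hc' => ?_, fun c hc => ?_, ?_, ?_⟩
    · rw [Function.update_of_ne hc', Function.update_of_ne (by omega), hu c hc hc']
    · rw [Function.update_of_ne (by omega)]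
      by_cases hci : c = i
      · subst hci
        rw [← Nat.add_assoc, Function.update_self, hu _ (by omega) (by omega)]
      · rw [Function.update_of_ne (by omega), hui c (by omega)]
    · rw [hbody, ← hun]; rfl
    · rw [hbody, ← hud]; rfl)
  obtain ⟨s₂, hs₂⟩ : ∃ s₂, s₂ = (Prog.loop (.reg 0) body).run A s₁ := ⟨_, rfl⟩
  have h10 : s₁.nat 0 = n := by rw [h1low 0 (by omega) (by omega), h0]
  have hs₂' : s₂ = ((body.run A)^[n] s₁).spend 3 := by
    rw [hs₂]
    simp only [Prog.run, NExp.eval, h10]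
    rfl
  obtain ⟨-, k2, k3, k4, k5⟩ := key
  obtain ⟨s₃, hs₃⟩ : ∃ s₃, s₃ = (Prog.setNum (.const (T + 4 + k)) (.ofNat (.const 1))).run A
    ((Prog.setNum (.const T) (.ofNat (.const 0))).run A s₂) := ⟨_, rfl⟩
  have h3n : s₃.nat = ((body.run A)^[n] s₁).nat := by rw [hs₃, hs₂']; rfl
  have h3num : s₃.num = Function.update (Function.update s.num T 0) (T + 4 + k) 1 := by
    rw [hs₃, ← k4]
    simp [Prog.run, hs₂']
  have h3d : s₃.draws = s.draws + 1 := by rw [hs₃, hs₂', ← k5]; rfl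
  have h3x : s₃.bits n R = x := by
    rw [← h1x]
    exact MState.bits_congr fun c hc => by rw [h3n, k2 _ (by omega) (by omega)]
  have h3y : s₃.bits n (R + n) = x := by
    rw [← h1x]
    ext i
    simp only [MState.bits]
    rw [h3n, k3 _ i.2]
  obtain ⟨g1, -⟩ := goProg_run (T := T) (show 2 < L₀ by omega) k hR s₃
    (by rw [h3n, k2 _ (by omega) (by omega), h10])
    (by rw [h3n, k2 _ (by omega) (by omega), h1low 2 (by omega) (by omega), h2]) h3x
  have g2 := Prog.run_num_of_numFrame A (goProg_numFrame κ L₀ R T k) s₃ (c := T + 1) (by omega)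
  have hnum : ((sampleProg κ L₀ R T k).run A s).num =
      Function.update ((goProg κ L₀ R T k).run A s₃).num (T + 1)
        (((goProg κ L₀ R T k).run A s₃).num (T + 1) +
          ((((goProg κ L₀ R T k).run A s₃).num T).re : ℂ)) := by
    rw [hs₃, hs₂, hbody, hs₁]; rfl
  have hdraws : ((sampleProg κ L₀ R T k).run A s).draws = ((goProg κ L₀ R T k).run A s₃).draws := by
    rw [hs₃, hs₂, hbody, hs₁]; rfl
  refine ⟨?_, ?_⟩
  · rw [hnum, Function.update_self, g2, g1, h3y, pathSum_eq, h3num, Function.update_self,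
      Function.update_of_ne (by omega), Function.update_of_ne (by omega),
      Function.update_of_ne (by omega), Function.update_self, zero_add, one_mul]
  · rw [hdraws, Prog.run_draws_of_noSample A (goProg_noSample κ L₀ R T k), h3d]

/-- The draw counter makes the groups consecutive disjoint blocks of samples; the independence of
the means rests on this. -/
lemma meansProg_run {L₀ R T M k : ℕ} (hL₀ : 20 ≤ L₀) (hR : L₀ + k * (3 * κ + 2) ≤ R)
    (hM : T + 5 + k ≤ M) {s : MState}
    (h0 : s.nat 0 = n) (h2 : s.nat 2 = A.ham.length) :
    (∀ j < s.nat 7, ((meansProg κ L₀ R T M k).run A s).num (M + j) =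
      (((∑ i ∈ Finset.range (s.nat 6), (pathSum A.ham A.ratio k
        (A.samples (s.draws + (j * s.nat 6 + i)))).re) / s.nat 6 : ℝ) : ℂ)) ∧
    ((meansProg κ L₀ R T M k).run A s).draws = s.draws + s.nat 7 * s.nat 6 := by
  set F : ℕ → ℝ := fun i => (pathSum A.ham A.ratio k (A.samples i)).re with hF
  set m := s.nat 6 with hm
  have hL : L₀ ≤ R := by omega
  have hsf := sampleProg_natFrame (κ := κ) (T := T) (k := k) hL₀ hL
  obtain ⟨s₁, hs₁⟩ : ∃ s₁, s₁ = (Prog.setNat (.const 10) (.const 0)).run A s := ⟨_, rfl⟩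
  have h1low : ∀ c, c < 10 → s₁.nat c = s.nat c := fun c hc => by
    simp only [hs₁, Prog.run, MState.spend_nat, MState.writeNat_nat, NExp.eval]
    rw [Function.update_of_ne (by omega)]
  obtain ⟨body, hbody⟩ : ∃ body, body =
      (Prog.seq (.setNum (.const (T + 1)) (.ofNat (.const 0)))
      (.seq (.loop (.reg 6) (sampleProg κ L₀ R T k))
      (.seq (.setNum (.add (.const M) (.reg 10)) (.div (.reg (T + 1)) (.ofNat (.reg 6))))
        (.setNat (.const 10) (.add (.reg 10) (.const 1)))))) := ⟨_, rfl⟩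
  have key := iterate_invariant (f := body.run A) (K := s.nat 7) (s := s₁)
    (fun j u => (∀ c, c < 10 → u.nat c = s.nat c) ∧ u.nat 10 = j ∧ u.draws = s.draws + j * m ∧
      ∀ j' < j, u.num (M + j') =
        (((∑ i ∈ Finset.range m, F (s.draws + (j' * m + i))) / m : ℝ) : ℂ))
    ⟨h1low, by simp [hs₁, Prog.run], by rw [hs₁, Nat.zero_mul]; rfl,
      fun j' hj' => absurd hj' (by omega)⟩ (by
    rintro j u - ⟨hu, hu10, hud, huM⟩
    obtain ⟨u₁, hu₁⟩ : ∃ u₁, u₁ = (Prog.setNum (.const (T + 1)) (.ofNat (.const 0))).run A u :=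
      ⟨_, rfl⟩
    have inner := iterate_invariant (f := (sampleProg κ L₀ R T k).run A) (K := m) (s := u₁)
      (fun i v => (∀ c, c ≤ 10 → v.nat c = u.nat c) ∧ v.draws = u.draws + i ∧
        (∀ c, M ≤ c → v.num c = u.num c) ∧
        v.num (T + 1) = ((∑ i' ∈ Finset.range i, F (u.draws + i') : ℝ) : ℂ))
      ⟨fun c _ => by rw [hu₁]; rfl, by rw [hu₁]; rfl, fun c hc => by
        simp only [hu₁, Prog.run, MState.spend_num, MState.writeNum_num, NExp.eval]
        rw [Function.update_of_ne (by omega)], by simp [hu₁, Prog.run]⟩ (by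
      rintro i v - ⟨hv, hvd, hvM, hvT⟩
      obtain ⟨r1, r2⟩ := sampleProg_run (T := T) hL₀ hR (s := v)
        (by rw [hv 0 (by omega), hu 0 (by omega), h0]) (by rw [hv 2 (by omega), hu 2 (by omega), h2])
      refine ⟨fun c hc => ?_, ?_, fun c hc => ?_, ?_⟩
      · rw [Prog.run_nat_of_natFrame A hsf _ (by omega), hv c hc]
      · rw [r2, hvd, Nat.add_assoc]
      · rw [Prog.run_num_of_numFrame A sampleProg_numFrame _ (by omega), hvM c hc]
      · rw [r1, hvT, Finset.sum_range_succ, hvd]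
        push_cast
        rfl)
    obtain ⟨v, hv⟩ : ∃ v, v = ((sampleProg κ L₀ R T k).run A)^[m] u₁ := ⟨_, rfl⟩
    rw [← hv] at inner
    obtain ⟨i1, i2, i3, i4⟩ := inner
    have hu6 : u₁.nat 6 = m := by rw [hu₁, hm, ← hu 6 (by omega)]; rfl
    have e6 : v.nat 6 = m := by rw [i1 6 (by omega), hu 6 (by omega)]
    have e10 : v.nat 10 = j := by rw [i1 10 le_rfl, hu10]
    have hn : (body.run A u).nat = Function.update v.nat 10 (v.nat 10 + 1) := by
      rw [hv, ← hu6, hbody, hu₁]; rfl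
    have hnum : (body.run A u).num = Function.update v.num (M + v.nat 10)
        (v.num (T + 1) / (v.nat 6 : ℂ)) := by
      rw [hv, ← hu6, hbody, hu₁]; rfl
    have hd : (body.run A u).draws = v.draws := by
      rw [hv, ← hu6, hbody, hu₁]; rfl
    rw [hn, hnum, hd, e10, e6]
    refine ⟨fun c hc => ?_, by simp, ?_, fun j' hj' => ?_⟩
    · rw [Function.update_of_ne (by omega), i1 c (by omega), hu c hc]
    · rw [i2, hud, Nat.succ_mul]; omega
    · by_cases hjj : j' = j
      · subst hjj
        rw [Function.update_self, i4, hud]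
        push_cast
        simp only [Nat.add_assoc]
      · rw [Function.update_of_ne (by omega), i3 _ (by omega), huM j' (by omega)])
  have h17 : s₁.nat 7 = s.nat 7 := h1low 7 (by omega)
  have hn : ((meansProg κ L₀ R T M k).run A s).num = ((body.run A)^[s.nat 7] s₁).num := by
    rw [← h17, hs₁, hbody]; rfl
  have hd : ((meansProg κ L₀ R T M k).run A s).draws = ((body.run A)^[s.nat 7] s₁).draws := by
    rw [← h17, hs₁, hbody]; rfl
  rw [hn, hd]
  exact ⟨key.2.2.2, key.2.2.1⟩

lemma increment_run (b : Test) (c : ℕ) (s : MState) :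
    open Classical in
    ((Prog.ite b (.setNat (.const c) (.add (.reg c) (.const 1))) .skip).run A s).nat =
      Function.update s.nat c (s.nat c + if b.holds s then 1 else 0) ∧
    ((Prog.ite b (.setNat (.const c) (.add (.reg c) (.const 1))) .skip).run A s).num = s.num := by
  classical
  by_cases h : b.holds s <;> simp [Prog.run, h]

lemma countProg_run {M r i : ℕ} {f : ℕ → ℝ} {s : MState} (h7 : s.nat 7 = r) (h12 : s.nat 12 = i)
    (hi : i < r) (hf : ∀ j < r, s.num (M + j) = f j) :
    open Classical in
    ((countProg M).run A s).nat 14 = Nat.count (fun j => f j ≤ f i) r ∧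
    ((countProg M).run A s).nat 15 = Nat.count (fun j => f i ≤ f j) r ∧
    ((countProg M).run A s).num = s.num := by
  classical
  obtain ⟨body, hbody⟩ : ∃ body, body =
      (Prog.seq (.ite (.reLE (.cell (.add (.const M) (.reg 13))) (.cell (.add (.const M) (.reg 12))))
        (.setNat (.const 14) (.add (.reg 14) (.const 1))) .skip)
      (.seq (.ite (.reLE (.cell (.add (.const M) (.reg 12))) (.cell (.add (.const M) (.reg 13))))
        (.setNat (.const 15) (.add (.reg 15) (.const 1))) .skip)
        (.setNat (.const 13) (.add (.reg 13) (.const 1))))) := ⟨_, rfl⟩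
  obtain ⟨s₁, hs₁⟩ : ∃ s₁, s₁ = (Prog.setNat (.const 15) (.const 0)).run A
    ((Prog.setNat (.const 14) (.const 0)).run A
      ((Prog.setNat (.const 13) (.const 0)).run A s)) := ⟨_, rfl⟩
  have key := iterate_invariant (f := body.run A) (K := r) (s := s₁)
    (fun j u => u.nat 12 = i ∧ u.num = s.num ∧ u.nat 13 = j ∧
      u.nat 14 = Nat.count (fun j => f j ≤ f i) j ∧ u.nat 15 = Nat.count (fun j => f i ≤ f j) j)
    (by simp [hs₁, Prog.run, h12]) (by
    rintro j u hj ⟨hu12, hun, hu13, hu14, hu15⟩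
    have e1 : (u.num (M + u.nat 13)).re = f j := by rw [hu13, hun, hf j hj]; simp
    have e2 : (u.num (M + u.nat 12)).re = f i := by rw [hu12, hun, hf i hi]; simp
    rw [Nat.count_succ, Nat.count_succ]
    obtain ⟨b₁, hb₁⟩ : ∃ b₁ : Test, b₁ = .reLE (.cell (.add (.const M) (.reg 13)))
      (.cell (.add (.const M) (.reg 12))) := ⟨_, rfl⟩
    obtain ⟨b₂, hb₂⟩ : ∃ b₂ : Test, b₂ = .reLE (.cell (.add (.const M) (.reg 12)))
      (.cell (.add (.const M) (.reg 13))) := ⟨_, rfl⟩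
    obtain ⟨v₁, hv₁⟩ : ∃ v₁, v₁ = (Prog.ite b₁
      (.setNat (.const 14) (.add (.reg 14) (.const 1))) .skip).run A u := ⟨_, rfl⟩
    obtain ⟨v₂, hv₂⟩ : ∃ v₂, v₂ = (Prog.ite b₂
      (.setNat (.const 15) (.add (.reg 15) (.const 1))) .skip).run A v₁ := ⟨_, rfl⟩
    obtain ⟨p1, p2⟩ := increment_run (A := A) b₁ 14 u
    obtain ⟨p3, p4⟩ := increment_run (A := A) b₂ 15 v₁
    rw [← hv₁] at p1 p2
    rw [← hv₂] at p3 p4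
    have t1 : b₁.holds u ↔ f j ≤ f i := by rw [hb₁, ← e1, ← e2]; rfl
    have t2 : b₂.holds v₁ ↔ f i ≤ f j := by
      rw [hb₂, ← e1, ← e2, ← p2]
      simp [Test.holds, p1]
    simp only [t1] at p1
    simp only [t2] at p3
    have hn : (body.run A u).nat = Function.update v₂.nat 13 (v₂.nat 13 + 1) := by
      rw [hv₂, hv₁, hb₁, hb₂, hbody]; rfl
    have hn' : (body.run A u).num = v₂.num := by
      rw [hv₂, hv₁, hb₁, hb₂, hbody]; rfl
    rw [hn, hn', p3, p4, p1, p2, hun]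
    simp [hu12, hu13, hu14, hu15])
  have h17 : s₁.nat 7 = r := by simp [hs₁, Prog.run, h7]
  have hn : ((countProg M).run A s).nat = ((body.run A)^[r] s₁).nat := by
    rw [← h17, hs₁, hbody]; rfl
  have hn' : ((countProg M).run A s).num = ((body.run A)^[r] s₁).num := by
    rw [← h17, hs₁, hbody]; rfl
  rw [hn, hn']
  exact ⟨key.2.2.2.1, key.2.2.2.2, key.2.1⟩

/-- Candidates are tried from the largest index down, and every middle one overwrites the register.
The last one written is therefore the one with the smallest index, as `IsMedian` demands. -/
lemma medianProg_run {M k r : ℕ} (hr : 0 < r) (hk : k < M) {f : ℕ → ℝ} {s : MState}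
    (h7 : s.nat 7 = r) (hf : ∀ j < r, s.num (M + j) = f j) :
    ∃ v : ℝ, ((medianProg M k).run A s).num k = v ∧ IsMedian (fun j : Fin r => f j) v := by
  classical
  obtain ⟨i₀, hi₀, hfirst⟩ := exists_first_isMiddle hr fun j : Fin r => f j
  refine ⟨f i₀, ?_, i₀, hi₀, hfirst, rfl⟩
  obtain ⟨body, hbody⟩ : ∃ body, body =
      (Prog.seq (.setNat (.const 12) (.sub (.reg 12) (.const 1)))
      (.seq (countProg M)
        (.ite (.natLE (.reg 7) (.add (.reg 14) (.reg 14)))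
          (.ite (.natLE (.reg 7) (.add (.reg 15) (.reg 15)))
            (.setNum (.const k) (.cell (.add (.const M) (.reg 12)))) .skip) .skip))) := ⟨_, rfl⟩
  obtain ⟨s₁, hs₁⟩ : ∃ s₁, s₁ = (Prog.setNat (.const 12) (.reg 7)).run A s := ⟨_, rfl⟩
  have key := iterate_invariant (f := body.run A) (K := r) (s := s₁)
    (fun i u => u.nat 7 = r ∧ u.nat 12 = r - i ∧ (∀ j < r, u.num (M + j) = f j) ∧
      -- After `i` passes the indices from `r - i` on have been tried; nothing is claimed until `i₀`
      -- is among them.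
      (r ≤ i₀ + i → u.num k = f i₀))
    ⟨by simp [hs₁, Prog.run, h7], by simp [hs₁, Prog.run, h7],
      fun j hj => by simpa [hs₁, Prog.run] using hf j hj,
      fun h => absurd i₀.2 (by omega)⟩ (by
    rintro i u hi ⟨hu7, hu12, huf, huk⟩
    obtain ⟨v, hv⟩ : ∃ v, v = (Prog.setNat (.const 12) (.sub (.reg 12) (.const 1))).run A u :=
      ⟨_, rfl⟩
    have hv12 : v.nat 12 = r - (i + 1) := by
      simp [hv, Prog.run, hu12]; omega
    have hv7 : v.nat 7 = r := by simp [hv, Prog.run, hu7]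
    have hvn : v.num = u.num := by rw [hv]; rfl
    obtain ⟨c1, c2, c3⟩ := countProg_run (A := A) hv7 hv12 (by omega)
      (fun j hj => by rw [hvn, huf j hj])
    obtain ⟨v', hv'⟩ : ∃ v', v' = (countProg M).run A v := ⟨_, rfl⟩
    rw [← hv'] at c1 c2 c3
    have d7 : v'.nat 7 = r := by
      rw [hv', Prog.run_nat_of_natFrame A countProg_natFrame _ (by omega), hv7]
    have d12 : v'.nat 12 = r - (i + 1) := by
      rw [hv', Prog.run_nat_of_natFrame A countProg_natFrame _ (by omega), hv12]
    obtain ⟨P, hP⟩ : ∃ P : Prog, P = .ite (.natLE (.reg 7) (.add (.reg 14) (.reg 14)))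
      (.ite (.natLE (.reg 7) (.add (.reg 15) (.reg 15)))
        (.setNum (.const k) (.cell (.add (.const M) (.reg 12)))) .skip) .skip := ⟨_, rfl⟩
    have hPn : P.NatFrame fun _ => False := by rw [hP]; exact ⟨⟨trivial, trivial⟩, trivial⟩
    have hn : (body.run A u).nat = v'.nat := by
      have : (body.run A u).nat = (P.run A v').nat := by rw [hv', hv, hbody, hP]; rfl
      rw [this]
      exact funext fun c => Prog.run_nat_of_natFrame A hPn _ id
    have hi' : r - (i + 1) < r := by omega
    have hmid := isMiddle_iff f (⟨r - (i + 1), hi'⟩ : Fin r)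
    have hnum : (body.run A u).num =
        if IsMiddle (fun j : Fin r => f j) ⟨r - (i + 1), hi'⟩ then
          Function.update v'.num k (v'.num (M + (r - (i + 1)))) else v'.num := by
      have : (body.run A u).num = (if r ≤ v'.nat 14 + v'.nat 14 then
          if r ≤ v'.nat 15 + v'.nat 15 then Function.update v'.num k (v'.num (M + (r - (i + 1))))
          else v'.num else v'.num) := by
        have : (body.run A u).num = (P.run A v').num := by rw [hv', hv, hbody, hP]; rfl
        rw [this, hP]
        simp only [Prog.run, Test.holds, NExp.eval, MState.spend_num, d7]
        split_ifs <;> simp [d12]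
      rw [this, c1, c2, hmid, ← two_mul, ← two_mul]
      split_ifs <;> tauto
    have hMk : ∀ j, M + j ≠ k := fun j => by omega
    rw [hn, hnum]
    refine ⟨d7, d12, fun j hj => ?_, fun h => ?_⟩
    · rw [← huf j hj, ← hvn, ← c3]
      split_ifs
      · rw [Function.update_of_ne (hMk j)]
      · rfl
    · by_cases he : (i₀ : ℕ) = r - (i + 1)
      · have : (⟨r - (i + 1), hi'⟩ : Fin r) = i₀ := Fin.ext he.symm
        rw [this, if_pos hi₀, Function.update_self, c3, hvn, huf _ hi', ← he]
      · rw [if_neg (hfirst _ (by change r - (i + 1) < (i₀ : ℕ); omega)), c3, hvn,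
          huk (by omega)])
  have h17 : s₁.nat 7 = r := by simp [hs₁, Prog.run, h7]
  have hn : ((medianProg M k).run A s).num = ((body.run A)^[r] s₁).num := by
    rw [← h17, hs₁, hbody]; rfl
  rw [hn]
  exact key.2.2.2 (by omega)

/-- Stage `K` writes only the cell `K` and the scratch cells from `T` on, so earlier signal values
survive. It uses the `r * m` samples after those of the earlier stages. -/
lemma signalProg_run {L₀ R T M r m : ℕ} (hr : 0 < r) (hL₀ : 20 ≤ L₀) {s : MState}
    (h0 : s.nat 0 = n) (h2 : s.nat 2 = A.ham.length) (h6 : s.nat 6 = m) (h7 : s.nat 7 = r)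
    (hd : s.draws = 0) :
    ∀ K, L₀ + K * (3 * κ + 2) ≤ R → K ≤ T → T + 4 + K ≤ M →
      ((signalProg κ L₀ R T M K).run A s).draws = K * (r * m) ∧
      ∀ k < K, ∃ v : ℝ, ((signalProg κ L₀ R T M K).run A s).num k = v ∧
        IsMedianOfMeans (fun x => (pathSum A.ham A.ratio k x).re) A.samples (k * (r * m)) r m v
  | 0, _, _, _ => ⟨by simpa [signalProg, Prog.run] using hd, fun k hk => absurd hk (by omega)⟩
  | K + 1, hR, hT, hM => by
    have hK' : (K + 1) * (3 * κ + 2) = K * (3 * κ + 2) + (3 * κ + 2) := Nat.succ_mul _ _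
    obtain ⟨ih1, ih2⟩ := signalProg_run (R := R) (T := T) hr hL₀ h0 h2 h6 h7 hd K (by omega) (by omega)
      (show T + 4 + K ≤ M by omega)
    obtain ⟨u, hu⟩ : ∃ u, u = (signalProg κ L₀ R T M K).run A s := ⟨_, rfl⟩
    rw [← hu] at ih1 ih2
    have hlow : ∀ c, c < 10 → u.nat c = s.nat c := fun c hc => by
      rw [hu, Prog.run_nat_of_natFrame A (signalProg_natFrame hL₀ (by omega) K) _ (by omega)]
    obtain ⟨m1, m2⟩ := meansProg_run (A := A) (R := R) (T := T) (M := M) (k := K) hL₀ (by omega) (by omega)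
      (s := u) (by rw [hlow 0 (by omega), h0]) (by rw [hlow 2 (by omega), h2])
    rw [hlow 6 (by omega), hlow 7 (by omega), h6, h7, ih1] at m1 m2
    obtain ⟨v, hv⟩ : ∃ v, v = (meansProg κ L₀ R T M K).run A u := ⟨_, rfl⟩
    rw [← hv] at m1 m2
    have hv7 : v.nat 7 = r := by
      rw [hv, Prog.run_nat_of_natFrame A (meansProg_natFrame hL₀ (show L₀ ≤ R by omega)) _
        (by omega),
        hlow 7 (by omega), h7]
    obtain ⟨w, hw1, hw2⟩ := medianProg_run (A := A) (k := K) hr (by omega) hv7 m1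
    have hnum : ((signalProg κ L₀ R T M (K + 1)).run A s).num = ((medianProg M K).run A v).num := by
      rw [hv, hu]; rfl
    have hdr : ((signalProg κ L₀ R T M (K + 1)).run A s).draws = v.draws := by
      rw [← Prog.run_draws_of_noSample A (medianProg_noSample (M := M) (k := K)) v, hv, hu]; rfl
    rw [hnum, hdr]
    refine ⟨by rw [m2]; ring, fun k hk => ?_⟩
    by_cases hkK : k = K
    · subst hkK
      exact ⟨w, hw1, hw2⟩
    · obtain ⟨w', h1, h2⟩ := ih2 k (by omega)
      refine ⟨w', ?_, h2⟩
      rw [Prog.run_num_of_numFrame A medianProg_numFrame _ hkK, hv,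
        Prog.run_num_of_numFrame A (meansProg_numFrame (by omega)) _ (by omega), h1]

end

/-! ## Grid search for the poles -/

/-- Apply the operators `y ↦ (i ↦ y (i + 1) - w j * y i)`, `j < l`, to the sequence `y`. -/
def diffSeq (w y : ℕ → ℂ) : ℕ → ℕ → ℂ
  | 0, i => y i
  | l + 1, i => diffSeq w y l (i + 1) - w l * diffSeq w y l i

lemma diffSeq_congr {w w' y y' : ℕ → ℂ} : ∀ {l i : ℕ}, (∀ j < l, w j = w' j) →
    (∀ c ≤ i + l, y c = y' c) → diffSeq w y l i = diffSeq w' y' l i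
  | 0, i, _, hy => hy i le_rfl
  | l + 1, i, hw, hy => by
    rw [diffSeq, diffSeq, hw l l.lt_succ_self,
      diffSeq_congr (l := l) (i := i + 1) (fun j hj => hw j (by omega)) fun c hc => hy c (by omega),
      diffSeq_congr (l := l) (i := i) (fun j hj => hw j (by omega)) fun c hc => hy c (by omega)]

/-- The squared residual of the linear recurrence with roots `w 0, …, w (S - 1)`. -/
noncomputable def recurrenceResidual (S : ℕ) (w y : ℕ → ℂ) : ℝ :=
  ∑ i ∈ Finset.range S, ‖diffSeq w y S i‖ ^ 2

lemma recurrenceResidual_congr {S : ℕ} {w w' y y' : ℕ → ℂ} (hw : ∀ j < S, w j = w' j)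
    (hy : ∀ c ≤ 2 * S, y c = y' c) :
    recurrenceResidual S w y = recurrenceResidual S w' y' := by
  refine Finset.sum_congr rfl fun i hi => ?_
  rw [Finset.mem_range] at hi
  rw [diffSeq_congr hw fun c hc => hy c (by omega)]

/-- `diffSeq` of the numbers in the cells `0, 1, …`, with roots in the cells from `W` on. -/
def diffExp (W : ℕ) : ℕ → ℕ → CExp
  | 0, i => .reg i
  | l + 1, i => .sub (diffExp W l (i + 1)) (.mul (.reg (W + l)) (diffExp W l i))

lemma diffExp_eval (W : ℕ) (s : MState) :
    ∀ l i, (diffExp W l i).eval s = diffSeq (fun j => s.num (W + j)) s.num l i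
  | 0, i => rfl
  | l + 1, i => by simp [diffExp, diffSeq, diffExp_eval W s l]

/-- `recurrenceResidual` as an expression. -/
def residualExp (W S : ℕ) : ℕ → CExp
  | 0 => .ofNat (.const 0)
  | i + 1 => .add (residualExp W S i) (.mul (diffExp W S i) (.conj (diffExp W S i)))

lemma residualExp_eval (W S : ℕ) (s : MState) :
    ((residualExp W S S).eval s).re = recurrenceResidual S (fun j => s.num (W + j)) s.num := by
  have key : ∀ i, (residualExp W S i).eval s =
      ((∑ i ∈ Finset.range i, ‖diffSeq (fun j => s.num (W + j)) s.num S i‖ ^ 2 : ℝ) : ℂ) := by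
    intro i
    induction i with
    | zero => simp [residualExp]
    | succ i ih =>
      rw [residualExp, CExp.eval, ih, CExp.eval, CExp.eval, diffExp_eval, Finset.sum_range_succ,
        Complex.mul_conj']
      push_cast
      rfl
  rw [key, Complex.ofReal_re]
  rfl

/-- Write the energies for the poles in the cells from `W` on to the cells from `D` on. -/
def storeProg (W D : ℕ) : ℕ → Prog
  | 0 => .skip
  | j + 1 => .seq (storeProg W D j) (.setNum (.const (D + j))
      (.mul (.mul (.ofNat (.const 2)) .pi) (.sub (.ofNat (.const 1)) (.reg (W + j)))))

/-- Try all poles on the grid `{0, 1 / K, …, 1}`, where `K` is in register `5` and `K + 1` in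
register `8`, and store the energies if the squared residual is at most `b / K ^ 2`. -/
def searchProg (W S b : ℕ) : ℕ → ℕ → Prog
  | 0, _ => .ite (.reLE (residualExp W S S)
      (.div (.ofNat (.const b)) (.mul (.ofNat (.reg 5)) (.ofNat (.reg 5)))))
      (storeProg W (2 * S + 1) S) .skip
  | m + 1, l => .seq (.setNat (.const (20 + l)) (.const 0))
      (.loop (.reg 8)
        (.seq (.setNum (.const (W + l)) (.div (.ofNat (.reg (20 + l))) (.ofNat (.reg 5))))
        (.seq (searchProg W S b m (l + 1))
          (.setNat (.const (20 + l)) (.add (.reg (20 + l)) (.const 1))))))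

lemma storeProg_natFrame {W D : ℕ} {V : ℕ → Prop} : ∀ j, (storeProg W D j).NatFrame V
  | 0 => trivial
  | j + 1 => ⟨storeProg_natFrame j, trivial⟩

lemma storeProg_numFrame {W D : ℕ} : ∀ j, (storeProg W D j).NumFrame fun c => D ≤ c ∧ c < D + j
  | 0 => trivial
  | j + 1 => ⟨(storeProg_numFrame j).mono fun c hc => by omega, by
      simp only [Prog.NumFrame, NExp.Lands]; omega⟩

lemma storeProg_noSample {W D : ℕ} : ∀ j, (storeProg W D j).NoSample
  | 0 => trivial
  | j + 1 => ⟨storeProg_noSample j, trivial⟩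

lemma storeProg_loopsOn {W D L : ℕ} : ∀ j, (storeProg W D j).LoopsOn L
  | 0 => trivial
  | j + 1 => ⟨storeProg_loopsOn j, trivial⟩

lemma searchProg_natFrame {W S b : ℕ} : ∀ m l, (searchProg W S b m l).NatFrame (20 + l ≤ ·)
  | 0, _ => ⟨storeProg_natFrame S, trivial⟩
  | m + 1, l => by
    refine ⟨?_, trivial, (searchProg_natFrame m (l + 1)).mono fun c hc => ?_, ?_⟩
    · simp [Prog.NatFrame, NExp.Lands]
    · omega
    · simp [Prog.NatFrame, NExp.Lands]

lemma searchProg_numFrame {W S b : ℕ} : ∀ m l, (searchProg W S b m l).NumFrame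
    fun c => (2 * S + 1 ≤ c ∧ c < 3 * S + 1) ∨ W + l ≤ c
  | 0, _ => ⟨(storeProg_numFrame S).mono fun c hc => by omega, trivial⟩
  | m + 1, l => by
    refine ⟨trivial, ?_, (searchProg_numFrame m (l + 1)).mono fun c hc => ?_, trivial⟩
    · simp [Prog.NumFrame, NExp.Lands]
    · omega

lemma searchProg_noSample {W S b : ℕ} : ∀ m l, (searchProg W S b m l).NoSample
  | 0, _ => ⟨storeProg_noSample S, trivial⟩
  | m + 1, l => ⟨trivial, trivial, searchProg_noSample m (l + 1), trivial⟩

lemma searchProg_loopsOn {W S b : ℕ} : ∀ m l, (searchProg W S b m l).LoopsOn 10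
  | 0, _ => ⟨storeProg_loopsOn S, trivial⟩
  | m + 1, l => ⟨trivial, by decide, trivial, searchProg_loopsOn m (l + 1), trivial⟩

/-! ### Correctness of the grid search -/

section

variable {n κ : ℕ} {A : Access n κ}

lemma storeProg_run {W D : ℕ} {s : MState} : ∀ {j}, D + j ≤ W → ∀ i < j,
    ((storeProg W D j).run A s).num (D + i) = 2 * (Real.pi : ℂ) * (1 - s.num (W + i))
  | 0, _, i, hi => absurd hi (by omega)
  | j + 1, hW, i, hi => by
    have hf := Prog.run_num_of_numFrame A (storeProg_numFrame (W := W) (D := D) j) s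
      (c := W + j) (by omega)
    by_cases hij : i = j
    · subst hij
      simp [storeProg, Prog.run, hf]
    · have := storeProg_run (W := W) (D := D) (s := s) (j := j) (by omega) i (by omega)
      simp only [storeProg, Prog.run, MState.spend_num, MState.writeNum_num, NExp.eval]
      rw [Function.update_of_ne (by omega), this]

/-- The stored energies belong to poles with a squared residual of at most `θ`. -/
def StoresPoles (S : ℕ) (θ : ℝ) (y : ℕ → ℂ) (s : MState) : Prop :=
  ∃ w : ℕ → ℂ, recurrenceResidual S w y ≤ θ ∧ (∀ j < S, ‖w j‖ ≤ 1) ∧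
    ∀ j < S, s.num (2 * S + 1 + j) = 2 * (Real.pi : ℂ) * (1 - w j)

/-- Either admissible poles have been stored, or the coordinates fixed so far extend to an
admissible grid tuple. A later success overwrites an earlier one only with another admissible tuple,
so the search needs no early exit. -/
lemma searchProg_run {W S b K : ℕ} (hW : 3 * S + 1 ≤ W) {y : ℕ → ℂ} :
    ∀ m l (s : MState), m + l = S → s.nat 5 = K → s.nat 8 = K + 1 →
      (∀ c ≤ 2 * S, s.num c = y c) → (∀ j < l, ‖s.num (W + j)‖ ≤ 1) →
      (StoresPoles S (b / (K * K)) y s ∨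
        ∃ g : ℕ → ℕ, (∀ j, g j ≤ K) ∧
          recurrenceResidual S (fun j => if j < l then s.num (W + j) else (g j / K : ℂ)) y ≤
            b / (K * K)) →
      StoresPoles S (b / (K * K)) y ((searchProg W S b m l).run A s)
  | 0, l, s, hl, h5, _, hy, hw, h => by
    obtain rfl : l = S := by omega
    have hres : recurrenceResidual l (fun j => s.num (W + j)) s.num =
        recurrenceResidual l (fun j => s.num (W + j)) y :=
      recurrenceResidual_congr (fun _ _ => rfl) hy
    have hthr : ((CExp.div (.ofNat (.const b))
        (.mul (.ofNat (.reg 5)) (.ofNat (.reg 5)))).eval s).re = (b / (K * K) : ℝ) := by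
      have : ((b : ℂ) / (K * K)) = ((b / (K * K) : ℝ) : ℂ) := by push_cast; rfl
      simp only [CExp.eval, NExp.eval, h5, this, Complex.ofReal_re]
    by_cases hc : recurrenceResidual l (fun j => s.num (W + j)) y ≤ b / (K * K)
    · refine ⟨fun j => s.num (W + j), hc, hw, fun j hj => ?_⟩
      have : (Test.reLE (residualExp W l l) (.div (.ofNat (.const b))
        (.mul (.ofNat (.reg 5)) (.ofNat (.reg 5))))).holds s := by
        rw [Test.holds, residualExp_eval, hthr, hres]; exact hc
      rw [searchProg, Prog.run, if_pos this, MState.spend_num]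
      exact storeProg_run (by omega) j hj
    · have : ¬ (Test.reLE (residualExp W l l) (.div (.ofNat (.const b))
        (.mul (.ofNat (.reg 5)) (.ofNat (.reg 5))))).holds s := by
        rw [Test.holds, residualExp_eval, hthr, hres]; exact hc
      rw [searchProg, Prog.run, if_neg this]
      rcases h with h | ⟨g, -, hg⟩
      · exact h
      · refine absurd ?_ hc
        rwa [recurrenceResidual_congr (w := fun j => s.num (W + j)) (w' := fun j => if j < l then
          s.num (W + j) else (g j / K : ℂ)) (fun j hj => by simp [hj]) fun _ _ => rfl]
  | m + 1, l, s, hl, h5, h8, hy, hw, h => by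
    obtain ⟨body, hbody⟩ : ∃ body, body =
      (Prog.seq (.setNum (.const (W + l)) (.div (.ofNat (.reg (20 + l))) (.ofNat (.reg 5))))
        (.seq (searchProg W S b m (l + 1))
          (.setNat (.const (20 + l)) (.add (.reg (20 + l)) (.const 1))))) := ⟨_, rfl⟩
    obtain ⟨s₁, hs₁⟩ : ∃ s₁, s₁ = (Prog.setNat (.const (20 + l)) (.const 0)).run A s := ⟨_, rfl⟩
    have key := iterate_invariant (f := body.run A) (K := K + 1) (s := s₁)
      (fun i u => u.nat 5 = K ∧ u.nat 8 = K + 1 ∧ u.nat (20 + l) = i ∧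
        (∀ c ≤ 2 * S, u.num c = y c) ∧ (∀ j < l, u.num (W + j) = s.num (W + j)) ∧
        -- The admissible tuple has not been passed yet. At the end of the loop this would force `K
        -- + 1 ≤ g l ≤ K`, so only the first alternative remains.
        (StoresPoles S (b / (K * K)) y u ∨ ∃ g : ℕ → ℕ, (∀ j, g j ≤ K) ∧ i ≤ g l ∧
          recurrenceResidual S (fun j => if j < l then s.num (W + j) else (g j / K : ℂ)) y ≤
            b / (K * K)))
      ⟨by simp [hs₁, Prog.run, h5, show 5 ≠ 20 + l by omega],
        by simp [hs₁, Prog.run, h8, show 8 ≠ 20 + l by omega], by simp [hs₁, Prog.run],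
        fun c hc => by rw [hs₁]; exact hy c hc, fun j _ => by rw [hs₁]; rfl, by
        rcases h with ⟨w, h1, h1', h2⟩ | ⟨g, h1, h2⟩
        · exact Or.inl ⟨w, h1, h1', fun j hj => by rw [hs₁]; exact h2 j hj⟩
        · exact Or.inr ⟨g, h1, Nat.zero_le _, h2⟩⟩ (by
      rintro i u hi ⟨hu5, hu8, hul, huy, huw, hu⟩
      obtain ⟨v, hv⟩ : ∃ v, v = (Prog.setNum (.const (W + l))
        (.div (.ofNat (.reg (20 + l))) (.ofNat (.reg 5)))).run A u := ⟨_, rfl⟩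
      have hvn : v.nat = u.nat := by rw [hv]; rfl
      have hvnum : v.num = Function.update u.num (W + l) (i / K : ℂ) := by
        rw [hv]
        simp only [Prog.run, MState.spend_num, MState.writeNum_num, NExp.eval, CExp.eval, hul, hu5]
      have hvy : ∀ c ≤ 2 * S, v.num c = y c := fun c hc => by
        rw [hvnum, Function.update_of_ne (by omega), huy c hc]
      have hvw : ∀ j < l, v.num (W + j) = s.num (W + j) := fun j hj => by
        rw [hvnum, Function.update_of_ne (by omega), huw j hj]
      have hvle : ∀ j < l + 1, ‖v.num (W + j)‖ ≤ 1 := fun j hj => by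
        by_cases hjl : j = l
        · subst hjl
          rw [hvnum, Function.update_self, norm_div, Complex.norm_natCast, Complex.norm_natCast]
          exact div_le_one_of_le₀ (by exact_mod_cast (by omega : i ≤ K)) (Nat.cast_nonneg _)
        · rw [hvw j (by omega)]
          exact hw j (by omega)
      obtain ⟨v', hv'⟩ : ∃ v', v' = (searchProg W S b m (l + 1)).run A v := ⟨_, rfl⟩
      have ih := searchProg_run (b := b) (K := K) hW (y := y) m (l + 1) v (by omega)
        (by rw [hvn, hu5]) (by rw [hvn, hu8]) hvy hvle
      rw [← hv'] at ih
      have hlow : ∀ c < 20 + (l + 1), v'.nat c = u.nat c := fun c hc => by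
        rw [hv', Prog.run_nat_of_natFrame A (searchProg_natFrame m (l + 1)) _ (by omega), hvn]
      have hlow' : ∀ c, ¬ ((2 * S + 1 ≤ c ∧ c < 3 * S + 1) ∨ W + (l + 1) ≤ c) →
          v'.num c = v.num c := fun c hc => by
        rw [hv', Prog.run_num_of_numFrame A (searchProg_numFrame m (l + 1)) _ hc]
      have hn : (body.run A u).nat = Function.update v'.nat (20 + l) (v'.nat (20 + l) + 1) := by
        rw [hv', hv, hbody]; rfl
      have hnum : (body.run A u).num = v'.num := by rw [hv', hv, hbody]; rfl
      rw [hn, hnum]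
      refine ⟨?_, ?_, ?_, fun c hc => ?_, fun j hj => ?_, ?_⟩
      · rw [Function.update_of_ne (by omega), hlow 5 (by omega), hu5]
      · rw [Function.update_of_ne (by omega), hlow 8 (by omega), hu8]
      · rw [Function.update_self, hlow _ (by omega), hul]
      · rw [hlow' c (by omega), hvy c hc]
      · rw [hlow' _ (by omega), hvw j hj]
      · have hstore : StoresPoles S (b / (K * K)) y v' →
            StoresPoles S (b / (K * K)) y (body.run A u) := by
          rintro ⟨w, h1, h1', h2⟩
          exact ⟨w, h1, h1', fun j hj => by rw [hnum]; exact h2 j hj⟩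
        rcases hu with ⟨w, h1, h1', h2⟩ | ⟨g, h1, h2, h3⟩
        · refine Or.inl (hstore (ih (Or.inl ⟨w, h1, h1', fun j hj => ?_⟩)))
          rw [hvnum, Function.update_of_ne (by omega), h2 j hj]
        · by_cases hg : i = g l
          · refine Or.inl (hstore (ih (Or.inr ⟨g, h1, ?_⟩)))
            rw [recurrenceResidual_congr (w' := fun j => if j < l then s.num (W + j) else
              (g j / K : ℂ)) (fun j hj => ?_) fun _ _ => rfl]
            · exact h3
            · by_cases hjl : j < l
              · simp only [hjl, if_true, show j < l + 1 by omega, hvw j hjl]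
              · by_cases hjl' : j = l
                · subst hjl'
                  simp [hvnum, hg]
                · simp only [hjl, if_false, show ¬ j < l + 1 by omega]
          · exact Or.inr ⟨g, h1, by omega, h3⟩)
    have h18 : s₁.nat 8 = K + 1 := by simp [hs₁, Prog.run, h8, show 8 ≠ 20 + l by omega]
    have hn : ((searchProg W S b (m + 1) l).run A s).num = ((body.run A)^[K + 1] s₁).num := by
      rw [← h18, hs₁, hbody]; rfl
    rcases key.2.2.2.2.2 with ⟨w, h1, h1', h2⟩ | ⟨g, h1, h2, -⟩
    · exact ⟨w, h1, h1', fun j hj => by rw [hn]; exact h2 j hj⟩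
    · exact absurd (h1 l) (by omega)

end

/-! ## Powers -/

/-- Store the `d`-th power of the content of register `4` in the register `a`. -/
def powProg (a : ℕ) : ℕ → Prog
  | 0 => .setNat (.const a) (.const 1)
  | d + 1 => .seq (powProg a d) (.seq (.setNat (.const 10) (.const 0))
      (.seq (.loop (.reg 4) (.setNat (.const 10) (.add (.reg 10) (.reg a))))
        (.setNat (.const a) (.reg 10))))

lemma powProg_natFrame {a : ℕ} : ∀ d, (powProg a d).NatFrame fun c => c = a ∨ c = 10
  | 0 => Or.inl rfl
  | d + 1 => ⟨powProg_natFrame d, Or.inr rfl, Or.inr rfl, Or.inl rfl⟩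

lemma powProg_numFrame {a : ℕ} : ∀ d, (powProg a d).NumFrame fun _ => False
  | 0 => trivial
  | d + 1 => ⟨powProg_numFrame d, trivial, trivial, trivial⟩

lemma powProg_noSample {a : ℕ} : ∀ d, (powProg a d).NoSample
  | 0 => trivial
  | d + 1 => ⟨powProg_noSample d, trivial, trivial, trivial⟩

lemma powProg_loopsOn {a L : ℕ} (hL : 4 < L) : ∀ d, (powProg a d).LoopsOn L
  | 0 => trivial
  | d + 1 => ⟨powProg_loopsOn hL d, trivial, ⟨hL, trivial⟩, trivial⟩

/-- Integer cells have no multiplication: each factor is a loop of additions, controlled by the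
register `4`, which is never written here. -/
lemma powProg_run {n κ : ℕ} {A : Access n κ} {a : ℕ} (ha : a ≠ 4) (ha' : a ≠ 10) (s : MState) :
    ∀ d, ((powProg a d).run A s).nat a = s.nat 4 ^ d
  | 0 => by simp [powProg, Prog.run]
  | d + 1 => by
    obtain ⟨u, hu⟩ : ∃ u, u = (powProg a d).run A s := ⟨_, rfl⟩
    have hua : u.nat a = s.nat 4 ^ d := by rw [hu, powProg_run ha ha' s d]
    have hu4 : u.nat 4 = s.nat 4 := by
      rw [hu, Prog.run_nat_of_natFrame A (powProg_natFrame d) _ (by omega)]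
    obtain ⟨v, hv⟩ : ∃ v, v = (Prog.setNat (.const 10) (.const 0)).run A u := ⟨_, rfl⟩
    have hv4 : v.nat 4 = s.nat 4 := by simp [hv, Prog.run, hu4]
    have key := iterate_invariant
      (f := (Prog.setNat (.const 10) (.add (.reg 10) (.reg a))).run A) (K := s.nat 4) (s := v)
      (fun i t => t.nat a = s.nat 4 ^ d ∧ t.nat 10 = i * s.nat 4 ^ d)
      ⟨by simp [hv, Prog.run, ha', hua], by simp [hv, Prog.run]⟩ (by
      rintro i t - ⟨h1, h2⟩
      refine ⟨by simp [Prog.run, ha', h1], ?_⟩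
      simp [Prog.run, h1, h2, Nat.succ_mul])
    have hn : ((powProg a (d + 1)).run A s).nat a =
        (((Prog.setNat (.const 10) (.add (.reg 10) (.reg a))).run A)^[v.nat 4] v).nat 10 := by
      rw [hv, hu]
      simp [powProg, Prog.run]
    rw [hn, hv4, key.2, pow_succ, mul_comm]

/-! ## Quantitative linear algebra -/

/-- A quantitative form of Cramer's rule. -/
lemma norm_det_mul_norm_le {S : ℕ} {A : Matrix (Fin S) (Fin S) ℂ} {B r : ℝ} (hB : 1 ≤ B)
    (hA : ∀ i j, ‖A i j‖ ≤ B) {x : Fin S → ℂ} (hx : ∀ i, ‖(A *ᵥ x) i‖ ≤ r) (j : Fin S) :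
    ‖A.det‖ * ‖x j‖ ≤ S * (S.factorial * B ^ S) * r := by
  have hadj : ∀ i j, ‖A.adjugate i j‖ ≤ S.factorial * B ^ S := by
    intro i j
    rw [Matrix.adjugate_apply]
    have := Matrix.det_le (A := A.updateRow j (Pi.single i 1)) (abv := NormedField.toAbsoluteValue ℂ)
      (x := B) (by
        intro a b
        change ‖A.updateRow j (Pi.single i 1) a b‖ ≤ B
        by_cases ha : a = j
        · subst ha
          rw [Matrix.updateRow_self, Pi.single_apply]
          split_ifs <;> simp <;> linarith
        · rw [Matrix.updateRow_ne ha]; exact hA a b)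
    rwa [nsmul_eq_mul, Fintype.card_fin] at this
  have h : A.det • x = A.adjugate *ᵥ (A *ᵥ x) := by
    rw [Matrix.mulVec_mulVec, Matrix.adjugate_mul, Matrix.smul_mulVec, Matrix.one_mulVec]
  have hr : 0 ≤ r := (norm_nonneg _).trans (hx j)
  calc ‖A.det‖ * ‖x j‖ = ‖(A.adjugate *ᵥ (A *ᵥ x)) j‖ := by rw [← h]; simp
    _ ≤ ∑ i, ‖A.adjugate j i * (A *ᵥ x) i‖ := by
        simp only [Matrix.mulVec, dotProduct]; exact norm_sum_le _ _
    _ ≤ ∑ _i : Fin S, (S.factorial * B ^ S) * r := Finset.sum_le_sum fun i _ => by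
        rw [norm_mul]
        exact mul_le_mul (hadj _ _) (hx i) (norm_nonneg _) (by positivity)
    _ = S * (S.factorial * B ^ S) * r := by simp; ring

/-- The norm of the inverse of a Vandermonde matrix is at most this, if the nodes lie in the unit
disc and have distance at least `1 / P`. -/
noncomputable def vandermondeBound (S : ℕ) (P : ℝ) : ℝ := S * S.factorial * P ^ (S * S)

/-- Each node contributes at most `S` differences of modulus at least `1 / P`; padding the exponent
to `S * S` is harmless because `1 / P ≤ 1`. -/
lemma one_le_norm_det_vandermonde {S : ℕ} {P : ℝ} (hP : 1 ≤ P) {z : Fin S → ℂ}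
    (hgap : ∀ i j, i ≠ j → 1 ≤ P * ‖z i - z j‖) :
    1 ≤ P ^ (S * S) * ‖(Matrix.vandermonde z).det‖ := by
  have hpos : 0 < P := by linarith
  rw [Matrix.det_vandermonde, norm_prod]
  have h1 : ∀ i : Fin S, (1 / P) ^ S ≤ ‖∏ j ∈ Finset.Ioi i, (z j - z i)‖ := by
    intro i
    rw [norm_prod]
    calc (1 / P) ^ S ≤ (1 / P) ^ (Finset.Ioi i).card := by
          refine pow_le_pow_of_le_one (by positivity) (by rw [div_le_one hpos]; exact hP) ?_
          exact (Finset.card_le_univ _).trans (by simp)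
      _ = ∏ _j ∈ Finset.Ioi i, (1 / P) := by simp
      _ ≤ _ := by
        refine Finset.prod_le_prod (fun _ _ => by positivity) fun j hj => ?_
        rw [div_le_iff₀ hpos, mul_comm]
        exact hgap j i (Finset.mem_Ioi.1 hj).ne'
  have h2 : (1 / P) ^ (S * S) ≤ ∏ i : Fin S, ‖∏ j ∈ Finset.Ioi i, (z j - z i)‖ := by
    calc (1 / P) ^ (S * S) = ∏ _i : Fin S, (1 / P) ^ S := by simp [pow_mul]
      _ ≤ _ := Finset.prod_le_prod (fun _ _ => by positivity) fun i _ => h1 i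
  calc (1 : ℝ) = P ^ (S * S) * (1 / P) ^ (S * S) := by
        rw [← mul_pow, mul_one_div_cancel hpos.ne', one_pow]
    _ ≤ _ := by gcongr

/-- Interpolation: a polynomial of degree below `S` that is small at `S` separated nodes has small
coefficients. -/
lemma norm_le_of_norm_vandermonde_mulVec_le {S : ℕ} {P r : ℝ} (hP : 1 ≤ P) {z : Fin S → ℂ}
    (hz : ∀ l, ‖z l‖ ≤ 1) (hgap : ∀ i j, i ≠ j → 1 ≤ P * ‖z i - z j‖) {c : Fin S → ℂ}
    (hc : ∀ l, ‖∑ i : Fin S, z l ^ (i : ℕ) * c i‖ ≤ r) (i : Fin S) :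
    ‖c i‖ ≤ vandermondeBound S P * r := by
  have h := norm_det_mul_norm_le (A := Matrix.vandermonde z) le_rfl
    (fun l i => by rw [Matrix.vandermonde_apply, norm_pow]; exact pow_le_one₀ (norm_nonneg _) (hz l))
    (x := c) (r := r) hc i
  have hd := one_le_norm_det_vandermonde hP hgap
  have hp : (0 : ℝ) < P ^ (S * S) := by positivity
  calc ‖c i‖ ≤ (P ^ (S * S) * ‖(Matrix.vandermonde z).det‖) * ‖c i‖ :=
        le_mul_of_one_le_left (norm_nonneg _) hd
    _ = P ^ (S * S) * (‖(Matrix.vandermonde z).det‖ * ‖c i‖) := by ring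
    _ ≤ P ^ (S * S) * (S * (S.factorial * 1 ^ S) * r) := by gcongr
    _ = vandermondeBound S P * r := by rw [vandermondeBound]; ring

/-- The dual statement: an exponential sum that is small at `S` consecutive times has small
amplitudes. -/
lemma norm_le_of_norm_vandermonde_transpose_mulVec_le {S : ℕ} {P r : ℝ} (hP : 1 ≤ P)
    {z : Fin S → ℂ} (hz : ∀ l, ‖z l‖ ≤ 1) (hgap : ∀ i j, i ≠ j → 1 ≤ P * ‖z i - z j‖)
    {c : Fin S → ℂ} (hc : ∀ i < S, ‖∑ l : Fin S, c l * z l ^ i‖ ≤ r) (l : Fin S) :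
    ‖c l‖ ≤ vandermondeBound S P * r := by
  have h := norm_det_mul_norm_le (A := (Matrix.vandermonde z)ᵀ) le_rfl
    (fun i l => by
      rw [Matrix.transpose_apply, Matrix.vandermonde_apply, norm_pow]
      exact pow_le_one₀ (norm_nonneg _) (hz l))
    (x := c) (r := r) (fun i => by
      simpa [Matrix.mulVec, dotProduct, Matrix.vandermonde_apply, mul_comm] using hc i i.2) l
  rw [Matrix.det_transpose] at h
  have hd := one_le_norm_det_vandermonde hP hgap
  have hp : (0 : ℝ) < P ^ (S * S) := by positivity
  calc ‖c l‖ ≤ (P ^ (S * S) * ‖(Matrix.vandermonde z).det‖) * ‖c l‖ :=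
        le_mul_of_one_le_left (norm_nonneg _) hd
    _ = P ^ (S * S) * (‖(Matrix.vandermonde z).det‖ * ‖c l‖) := by ring
    _ ≤ P ^ (S * S) * (S * (S.factorial * 1 ^ S) * r) := by gcongr
    _ = vandermondeBound S P * r := by rw [vandermondeBound]; ring

lemma one_le_vandermondeBound {S : ℕ} {P : ℝ} (hS : 1 ≤ S) (hP : 1 ≤ P) :
    1 ≤ vandermondeBound S P := by
  have h1 : (1 : ℝ) ≤ S := by exact_mod_cast hS
  have h2 : (1 : ℝ) ≤ S.factorial := by exact_mod_cast S.factorial_pos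
  exact one_le_mul_of_one_le_of_one_le (one_le_mul_of_one_le_of_one_le h1 h2) (one_le_pow₀ hP)

/-! ## Matching of roots -/

/-- If `∏ j, (X - w j)` is small at well separated points, then these are close to the roots. -/
lemma exists_perm_norm_sub_le {S : ℕ} {z w : Fin S → ℂ} {δ : ℝ} (hδ : 0 < δ)
    (hgap : ∀ i j, i ≠ j → 2 * δ < ‖z i - z j‖) (h : ∀ l, ‖∏ j, (z l - w j)‖ ≤ δ ^ S) :
    ∃ σ : Equiv.Perm (Fin S), ∀ l, ‖z l - w (σ l)‖ ≤ δ := by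
  -- If all `S` factors exceeded `δ`, the product would exceed `δ ^ S`.
  have hex : ∀ l, ∃ j, ‖z l - w j‖ ≤ δ := by
    intro l
    by_contra! hc
    have := Finset.prod_lt_prod_of_nonempty (s := (Finset.univ : Finset (Fin S)))
      (f := fun _ => δ) (g := fun j => ‖z l - w j‖) (fun _ _ => hδ) (fun j _ => hc j) ⟨l, by simp⟩
    rw [← norm_prod] at this
    simp only [Finset.prod_const, Finset.card_univ, Fintype.card_fin] at this
    exact absurd (h l) (not_le.2 this)
  choose f hf using hex
  -- Two points that share a root would be within `2 * δ` of each other.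
  have hinj : Function.Injective f := by
    intro a b hab
    by_contra hne
    have h1 := hf a
    have h2 := hf b
    rw [hab] at h1
    have h3 : ‖z a - z b‖ ≤ ‖z a - w (f b)‖ + ‖z b - w (f b)‖ := by
      have := norm_sub_le (z a - w (f b)) (z b - w (f b))
      simpa using this
    linarith [hgap a b hne]
  exact ⟨Equiv.ofBijective f (Finite.injective_iff_bijective.1 hinj), hf⟩

lemma matchDist_le {S : ℕ} (hS : 1 ≤ S) {E E' : Fin S → ℂ} {d : ℝ} (σ : Equiv.Perm (Fin S))
    (h : ∀ j, ‖E' (σ j) - E j‖ ≤ 2 * Real.pi * d) : matchDist E E' ≤ d := by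
  have hne : Nonempty (Fin S) := ⟨⟨0, hS⟩⟩
  have h1 : (⨅ σ : Equiv.Perm (Fin S), ⨆ j, ‖E' (σ j) - E j‖) ≤ 2 * Real.pi * d :=
    (ciInf_le (Set.finite_range _).bddBelow σ).trans (ciSup_le h)
  have hpi : 0 < 2 * Real.pi := by positivity
  rw [matchDist, one_div, inv_mul_le_iff₀ hpi]
  exact h1

/-! ## The grid search finds the poles -/

/-- On the sequence `z ^ k` the operator with root `w` acts as multiplication by `z - w`. -/
lemma diffSeq_sum_pow {S : ℕ} (p z : Fin S → ℂ) (w : ℕ → ℂ) : ∀ l i,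
    diffSeq w (fun k => ∑ a, p a * z a ^ k) l i =
      ∑ a, (p a * ∏ j ∈ Finset.range l, (z a - w j)) * z a ^ i
  | 0, i => by simp [diffSeq]
  | l + 1, i => by
    rw [diffSeq, diffSeq_sum_pow p z w l, diffSeq_sum_pow p z w l, Finset.mul_sum,
      ← Finset.sum_sub_distrib]
    refine Finset.sum_congr rfl fun a _ => ?_
    rw [Finset.prod_range_succ]
    ring

/-- An operator with `‖w‖ ≤ 1` at most doubles the uniform error. -/
lemma norm_diffSeq_sub_le {w y g : ℕ → ℂ} {ε : ℝ} : ∀ {l i : ℕ}, (∀ j < l, ‖w j‖ ≤ 1) →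
    (∀ k ≤ i + l, ‖y k - g k‖ ≤ ε) → ‖diffSeq w y l i - diffSeq w g l i‖ ≤ 2 ^ l * ε
  | 0, i, _, h => by simpa [diffSeq] using h i le_rfl
  | l + 1, i, hw, h => by
    have h1 := norm_diffSeq_sub_le (w := w) (l := l) (i := i + 1) (fun j hj => hw j (by omega))
      fun k hk => h k (by omega)
    have h2 := norm_diffSeq_sub_le (w := w) (l := l) (i := i) (fun j hj => hw j (by omega))
      fun k hk => h k (by omega)
    have : diffSeq w y (l + 1) i - diffSeq w g (l + 1) i =
        (diffSeq w y l (i + 1) - diffSeq w g l (i + 1)) -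
          w l * (diffSeq w y l i - diffSeq w g l i) := by
      simp only [diffSeq]; ring
    rw [this]
    calc _ ≤ ‖diffSeq w y l (i + 1) - diffSeq w g l (i + 1)‖ +
          ‖w l‖ * ‖diffSeq w y l i - diffSeq w g l i‖ := by
          rw [← norm_mul]; exact norm_sub_le _ _
      _ ≤ 2 ^ l * ε + 1 * (2 ^ l * ε) := by
          gcongr
          exact hw l l.lt_succ_self
      _ = 2 ^ (l + 1) * ε := by ring

/-- Poles with a small residual are approximate zeros. -/
lemma norm_prod_sub_le_of_residual {S : ℕ} {P ε η : ℝ} (hP : 1 ≤ P) {z p : Fin S → ℂ}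
    (hz : ∀ l, ‖z l‖ ≤ 1) (hgap : ∀ i j, i ≠ j → 1 ≤ P * ‖z i - z j‖)
    (hp : ∀ l, 1 ≤ P * ‖p l‖) {y : ℕ → ℂ} (hy : ∀ k ≤ 2 * S, ‖y k - ∑ a, p a * z a ^ k‖ ≤ ε)
    {w : ℕ → ℂ} (hw : ∀ j < S, ‖w j‖ ≤ 1) (hη : 0 ≤ η) (hres : recurrenceResidual S w y ≤ η ^ 2)
    (l : Fin S) :
    ‖∏ j : Fin S, (z l - w j)‖ ≤ P * (vandermondeBound S P * (η + 2 ^ S * ε)) := by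
  have h1 : ∀ i < S, ‖diffSeq w y S i‖ ≤ η := by
    intro i hi
    refine abs_le_of_sq_le_sq' ?_ hη |>.2
    exact (Finset.single_le_sum (f := fun i => ‖diffSeq w y S i‖ ^ 2) (fun _ _ => sq_nonneg _)
      (Finset.mem_range.2 hi)).trans hres
  have h2 : ∀ i < S, ‖∑ a, (p a * ∏ j ∈ Finset.range S, (z a - w j)) * z a ^ i‖ ≤
      η + 2 ^ S * ε := by
    intro i hi
    rw [← diffSeq_sum_pow]
    have h3 := norm_diffSeq_sub_le (w := w) (y := y) (g := fun k => ∑ a, p a * z a ^ k)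
      (ε := ε) (l := S) (i := i) hw fun k hk => hy k (by omega)
    have h4 := norm_sub_le (diffSeq w y S i)
      (diffSeq w y S i - diffSeq w (fun k => ∑ a, p a * z a ^ k) S i)
    rw [sub_sub_cancel] at h4
    linarith [h1 i hi]
  -- The filtered exact signal is again an exponential sum, now with amplitudes `p a * ∏ j, (z a - w
  -- j)`; the lower bound on `p` then isolates the product.
  have h3 := norm_le_of_norm_vandermonde_transpose_mulVec_le hP hz hgap h2 l
  rw [← Fin.prod_univ_eq_prod_range (fun j => z l - w j) S, norm_mul] at h3
  calc _ ≤ (P * ‖p l‖) * ‖∏ j : Fin S, (z l - w j)‖ :=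
        le_mul_of_one_le_left (norm_nonneg _) (hp l)
    _ = P * (‖p l‖ * ‖∏ j : Fin S, (z l - w j)‖) := by ring
    _ ≤ _ := by gcongr

/-- There are grid points with a small residual. -/
lemma exists_grid_residual_le {S K : ℕ} (hS : 1 ≤ S) (hK : 0 < K) {ζ : Fin S → ℝ} {p : Fin S → ℂ}
    (hζ : ∀ l, 0 ≤ ζ l ∧ ζ l ≤ 1) (hp : ∑ l, ‖p l‖ ≤ 1) {y : ℕ → ℂ}
    (hy : ∀ k ≤ 2 * S, ‖y k - ∑ a, p a * (ζ a : ℂ) ^ k‖ ≤ 1 / K) :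
    ∃ g : ℕ → ℕ, (∀ j, g j ≤ K) ∧ recurrenceResidual S (fun j => (g j / K : ℂ)) y ≤
      (S * (2 ^ S + 1) ^ 2 : ℕ) / ((K : ℝ) * K) := by
  have hK' : (0 : ℝ) < K := by exact_mod_cast hK
  -- Round each pole down to the grid; the entries from `S` on play no role.
  set g : ℕ → ℕ := fun j => if h : j < S then ⌊ζ ⟨j, h⟩ * K⌋₊ else 0 with hg
  have hgK : ∀ j, g j ≤ K := by
    intro j
    by_cases h : j < S
    · simp only [hg, h, dif_pos]
      refine Nat.floor_le_of_le ?_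
      nlinarith [(hζ ⟨j, h⟩).2]
    · simp [hg, h]
  refine ⟨g, hgK, ?_⟩
  set w : ℕ → ℂ := fun j => (g j / K : ℂ) with hw
  have hw1 : ∀ j, ‖w j‖ ≤ 1 := fun j => by
    rw [hw]
    simp only [norm_div, Complex.norm_natCast]
    exact div_le_one_of_le₀ (by exact_mod_cast hgK j) hK'.le
  have hclose : ∀ a : Fin S, ‖(ζ a : ℂ) - w a‖ ≤ 1 / K := by
    intro a
    have h1 : w a = ((⌊ζ a * K⌋₊ / K : ℝ) : ℂ) := by simp [hw, hg]
    rw [h1, ← Complex.ofReal_sub, Complex.norm_real, Real.norm_eq_abs]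
    have h2 := Nat.floor_le (mul_nonneg (hζ a).1 hK'.le)
    have h3 := Nat.lt_floor_add_one (ζ a * K)
    have h4 : ζ a - ⌊ζ a * K⌋₊ / K = (ζ a * K - ⌊ζ a * K⌋₊) / K := by field_simp
    rw [h4, abs_div, abs_of_pos hK', abs_of_nonneg (by linarith)]
    gcongr
    linarith
  have hsmall : ∀ a b : Fin S, ‖(ζ a : ℂ) - w b‖ ≤ 1 := by
    intro a b
    have h1 : w b = ((g b / K : ℝ) : ℂ) := by simp [hw]
    rw [h1, ← Complex.ofReal_sub, Complex.norm_real, Real.norm_eq_abs, abs_le]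
    have h2 : (g b / K : ℝ) ≤ 1 := div_le_one_of_le₀ (by exact_mod_cast hgK b) hK'.le
    have h3 : (0 : ℝ) ≤ g b / K := by positivity
    constructor <;> linarith [(hζ a).1, (hζ a).2]
  -- The error of the signal contributes `2 ^ S / K` and the rounding of the poles `1 / K`; this is
  -- the origin of `residualConst`.
  have hterm : ∀ i < S, ‖diffSeq w y S i‖ ≤ (2 ^ S + 1) / K := by
    intro i hi
    have h3 := norm_diffSeq_sub_le (w := w) (y := y) (g := fun k => ∑ a, p a * (ζ a : ℂ) ^ k)
      (ε := 1 / K) (l := S) (i := i) (fun j _ => hw1 j) fun k hk => hy k (by omega)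
    have h4 : ‖diffSeq w (fun k => ∑ a, p a * (ζ a : ℂ) ^ k) S i‖ ≤ 1 / K := by
      rw [diffSeq_sum_pow]
      calc _ ≤ ∑ a, ‖(p a * ∏ j ∈ Finset.range S, ((ζ a : ℂ) - w j)) * (ζ a : ℂ) ^ i‖ :=
            norm_sum_le _ _
        _ ≤ ∑ a, ‖p a‖ * (1 / K) := by
            refine Finset.sum_le_sum fun a _ => ?_
            have h5 : ‖(ζ a : ℂ) ^ i‖ ≤ 1 := by
              rw [norm_pow, Complex.norm_real, Real.norm_eq_abs, abs_of_nonneg (hζ a).1]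
              exact pow_le_one₀ (hζ a).1 (hζ a).2
            -- The factor of the pole's own grid point is at most `1 / K`, and the other factors are
            -- at most 1.
            have h6 : ‖∏ j ∈ Finset.range S, ((ζ a : ℂ) - w j)‖ ≤ 1 / K := by
              rw [← Fin.prod_univ_eq_prod_range (fun j => (ζ a : ℂ) - w j) S, norm_prod,
                ← Finset.mul_prod_erase _ _ (Finset.mem_univ a)]
              calc _ ≤ (1 / K : ℝ) * 1 := by
                    refine mul_le_mul (hclose a) ?_ (by positivity) (by positivity)
                    exact Finset.prod_le_one (fun _ _ => norm_nonneg _) fun b _ => hsmall a b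
                _ = 1 / K := mul_one _
            rw [norm_mul, norm_mul]
            calc _ ≤ ‖p a‖ * (1 / K) * 1 := by gcongr
              _ = _ := mul_one _
        _ = (∑ a, ‖p a‖) * (1 / K) := by rw [Finset.sum_mul]
        _ ≤ 1 * (1 / K) := by gcongr
        _ = 1 / K := one_mul _
    have h5 := norm_add_le (diffSeq w y S i - diffSeq w (fun k => ∑ a, p a * (ζ a : ℂ) ^ k) S i)
      (diffSeq w (fun k => ∑ a, p a * (ζ a : ℂ) ^ k) S i)
    rw [sub_add_cancel] at h5
    have h6 : ((2 : ℝ) ^ S + 1) / K = 2 ^ S * (1 / K) + 1 / K := by ring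
    linarith
  calc recurrenceResidual S w y ≤ ∑ _i ∈ Finset.range S, ((2 ^ S + 1) / K : ℝ) ^ 2 := by
        refine Finset.sum_le_sum fun i hi => ?_
        exact pow_le_pow_left₀ (norm_nonneg _) (hterm i (Finset.mem_range.1 hi)) 2
    _ = _ := by
        rw [Finset.sum_const, Finset.card_range, nsmul_eq_mul]
        push_cast
        field_simp

/-! ## Perturbation theory of ESPRIT -/

lemma star_dotProduct_self {m : ℕ} (v : Fin m → ℂ) :
    star v ⬝ᵥ v = ((∑ i, ‖v i‖ ^ 2 : ℝ) : ℂ) := by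
  simp only [dotProduct, Pi.star_apply]
  push_cast
  refine Finset.sum_congr rfl fun i _ => ?_
  rw [← Complex.conj_mul']
  rfl

lemma sum_norm_sq_unitary_mulVec {m : ℕ} {U : Matrix (Fin m) (Fin m) ℂ}
    (hU : U ∈ Matrix.unitaryGroup (Fin m) ℂ) (v : Fin m → ℂ) :
    ∑ i, ‖(U *ᵥ v) i‖ ^ 2 = ∑ i, ‖v i‖ ^ 2 := by
  have h : star (U *ᵥ v) ⬝ᵥ (U *ᵥ v) = star v ⬝ᵥ v := by
    rw [Matrix.star_mulVec, Matrix.dotProduct_mulVec, Matrix.vecMul_vecMul,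
      ← Matrix.star_eq_conjTranspose, Matrix.mem_unitaryGroup_iff'.1 hU, Matrix.vecMul_one]
  rw [star_dotProduct_self, star_dotProduct_self] at h
  exact_mod_cast h

section Esprit

variable {S : ℕ} {y : ℕ → ℂ} {z p : Fin S → ℂ} {ε : ℝ}
  {U W : Matrix (Fin (S + 1)) (Fin (S + 1)) ℂ} {σ : Fin (S + 1) → ℝ}

/-- A signal with `S` components has a Hankel matrix of rank at most `S`; hence the last singular
value of a perturbation is small. -/
lemma last_singular_value_le (hy : ∀ k ≤ 2 * S, ‖y k - ∑ a, p a * z a ^ k‖ ≤ ε)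
    (h : IsSVD (hankel S y) U W σ) : σ (Fin.last S) ≤ (S + 1) * ε := by
  have hε : 0 ≤ ε := (norm_nonneg _).trans (hy 0 (Nat.zero_le _))
  -- `S` equations in `S + 1` unknowns have a nonzero solution `v`. The exact Hankel matrix
  -- annihilates `v`, so only the perturbation acts on it.
  obtain ⟨v, hv, hv0⟩ := Submodule.exists_mem_ne_zero_of_ne_bot
    (LinearMap.ker_ne_bot_of_finrank_lt (f := Matrix.mulVecLin
      (Matrix.of fun (l : Fin S) (j : Fin (S + 1)) => z l ^ (j : ℕ))) (by simp))
  have hker : ∀ l, ∑ j : Fin (S + 1), z l ^ (j : ℕ) * v j = 0 := fun l =>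
    congrFun (LinearMap.mem_ker.1 hv) l
  set q := ∑ j, ‖v j‖ ^ 2 with hq
  have hqpos : 0 < q := by
    obtain ⟨j, hj⟩ := Function.ne_iff.1 hv0
    exact Finset.sum_pos' (fun _ _ => sq_nonneg _) ⟨j, Finset.mem_univ _,
      by have := norm_pos_iff.2 hj; positivity⟩
  have hlow : σ (Fin.last S) ^ 2 * q ≤ ∑ i, ‖(hankel S y *ᵥ v) i‖ ^ 2 := by
    rw [h.eq, ← Matrix.mulVec_mulVec, ← Matrix.mulVec_mulVec,
      sum_norm_sq_unitary_mulVec h.left_unitary, hq,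
      ← sum_norm_sq_unitary_mulVec h.right_unitary v, Finset.mul_sum]
    refine Finset.sum_le_sum fun i _ => ?_
    rw [Matrix.mulVec_diagonal, norm_mul, mul_pow, Complex.norm_real, Real.norm_eq_abs, sq_abs]
    have h1 := h.antitone (Fin.le_last i)
    have h2 := h.nonneg (Fin.last S)
    gcongr
  have hsum : (∑ j, ‖v j‖) ^ 2 ≤ (S + 1) * q := by
    have := sq_sum_le_card_mul_sum_sq (s := (Finset.univ : Finset (Fin (S + 1))))
      (f := fun j => ‖v j‖)
    simpa using this
  have hup : ∀ i, ‖(hankel S y *ᵥ v) i‖ ≤ ε * ∑ j, ‖v j‖ := by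
    intro i
    have h1 : (hankel S y *ᵥ v) i =
        ∑ j : Fin (S + 1), (y (i + j) - ∑ a, p a * z a ^ ((i : ℕ) + j)) * v j := by
      have h2 : ∑ j : Fin (S + 1), (∑ a, p a * z a ^ ((i : ℕ) + j)) * v j = 0 := by
        simp only [Finset.sum_mul]
        rw [Finset.sum_comm]
        refine Finset.sum_eq_zero fun a _ => ?_
        have : ∀ j : Fin (S + 1), p a * z a ^ ((i : ℕ) + j) * v j =
            p a * z a ^ (i : ℕ) * (z a ^ (j : ℕ) * v j) := fun j => by rw [pow_add]; ring
        rw [Finset.sum_congr rfl fun j _ => this j, ← Finset.mul_sum, hker, mul_zero]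
      simp only [sub_mul, Finset.sum_sub_distrib, h2, sub_zero]
      rfl
    rw [h1, Finset.mul_sum]
    refine (norm_sum_le _ _).trans (Finset.sum_le_sum fun j _ => ?_)
    rw [norm_mul]
    gcongr
    exact hy _ (by omega)
  have hfin : σ (Fin.last S) ^ 2 * q ≤ ((S + 1) * ε) ^ 2 * q := by
    calc _ ≤ _ := hlow
      _ ≤ ∑ _i : Fin (S + 1), (ε * ∑ j, ‖v j‖) ^ 2 :=
        Finset.sum_le_sum fun i _ => pow_le_pow_left₀ (norm_nonneg _) (hup i) 2
      _ = (S + 1) * ε ^ 2 * (∑ j, ‖v j‖) ^ 2 := by simp; ring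
      _ ≤ (S + 1) * ε ^ 2 * ((S + 1) * q) := by gcongr
      _ = ((S + 1) * ε) ^ 2 * q := by ring
  exact (abs_le_of_sq_le_sq' (le_of_mul_le_mul_right hfin hqpos) (by positivity)).2

/-- The value at `z l` of the polynomial whose coefficients are the conjugates of the last left
singular vector. -/
noncomputable def noisePoly (U : Matrix (Fin (S + 1)) (Fin (S + 1)) ℂ) (x : ℂ) : ℂ :=
  ∑ i, star (U i (Fin.last S)) * x ^ (i : ℕ)

/-- The adjoint of the last left singular vector sends the Hankel matrix to the last row of `W`
times the last singular value, of size at most `(S + 1) * ε`. Passing to the exact signal costs as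
much again. There the result is the exponential sum with amplitudes `p a * noisePoly U (z a)`, and
Vandermonde inversion bounds these. -/
lemma norm_noisePoly_le {P : ℝ} (hP : 1 ≤ P) (hz : ∀ l, ‖z l‖ ≤ 1)
    (hgap : ∀ i j, i ≠ j → 1 ≤ P * ‖z i - z j‖) (hp : ∀ l, 1 ≤ P * ‖p l‖)
    (hy : ∀ k ≤ 2 * S, ‖y k - ∑ a, p a * z a ^ k‖ ≤ ε)
    (h : IsSVD (hankel S y) U W σ) (l : Fin S) :
    ‖noisePoly U (z l)‖ ≤ P * (vandermondeBound S P * (2 * (S + 1) * ε)) := by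
  have hε : 0 ≤ ε := (norm_nonneg _).trans (hy 0 (Nat.zero_le _))
  have hcol : ∀ j : Fin (S + 1), ∑ i : Fin (S + 1), star (U i (Fin.last S)) * y (i + j) =
      σ (Fin.last S) * W (Fin.last S) j := by
    intro j
    have h1 : star U * hankel S y = Matrix.diagonal (fun i => (σ i : ℂ)) * W := by
      rw [h.eq, Matrix.mul_assoc, ← Matrix.mul_assoc (star U),
        Matrix.mem_unitaryGroup_iff'.1 h.left_unitary, Matrix.one_mul]
    have h2 := congrFun (congrFun h1 (Fin.last S)) j
    rw [Matrix.diagonal_mul, Matrix.mul_apply] at h2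
    exact h2
  have hbound : ∀ j < S, ‖∑ a, (p a * noisePoly U (z a)) * z a ^ j‖ ≤ 2 * (S + 1) * ε := by
    intro j hj
    have h1 : ∑ a, (p a * noisePoly U (z a)) * z a ^ j =
        (∑ i : Fin (S + 1), star (U i (Fin.last S)) * y (i + j)) -
        ∑ i : Fin (S + 1), star (U i (Fin.last S)) *
          (y (i + j) - ∑ a, p a * z a ^ ((i : ℕ) + j)) := by
      rw [← Finset.sum_sub_distrib]
      simp only [noisePoly, Finset.mul_sum, Finset.sum_mul]
      rw [Finset.sum_comm]
      refine Finset.sum_congr rfl fun i _ => ?_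
      rw [mul_sub, sub_sub_cancel, Finset.mul_sum]
      refine Finset.sum_congr rfl fun a _ => ?_
      rw [pow_add]; ring
    have h2 : ‖∑ i : Fin (S + 1), star (U i (Fin.last S)) * y (i + j)‖ ≤ (S + 1) * ε := by
      rw [hcol ⟨j, by omega⟩, norm_mul, Complex.norm_real, Real.norm_eq_abs,
        abs_of_nonneg (h.nonneg _)]
      calc _ ≤ σ (Fin.last S) * 1 := by
            gcongr
            · exact h.nonneg _
            · exact entry_norm_bound_of_unitary h.right_unitary _ _
        _ ≤ _ := by rw [mul_one]; exact last_singular_value_le hy h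
    have h3 : ‖∑ i : Fin (S + 1), star (U i (Fin.last S)) *
        (y (i + j) - ∑ a, p a * z a ^ ((i : ℕ) + j))‖ ≤ (S + 1) * ε := by
      calc _ ≤ ∑ _i : Fin (S + 1), 1 * ε := by
            refine (norm_sum_le _ _).trans (Finset.sum_le_sum fun i _ => ?_)
            rw [norm_mul, norm_star]
            gcongr
            · exact entry_norm_bound_of_unitary h.left_unitary _ _
            · exact hy _ (by omega)
        _ = _ := by simp
    rw [h1]
    refine (norm_sub_le _ _).trans ?_
    linarith
  have h3 := norm_le_of_norm_vandermonde_transpose_mulVec_le hP hz hgap hbound l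
  rw [norm_mul] at h3
  calc _ ≤ (P * ‖p l‖) * ‖noisePoly U (z l)‖ :=
        le_mul_of_one_le_left (norm_nonneg _) (hp l)
    _ = P * (‖p l‖ * ‖noisePoly U (z l)‖) := by ring
    _ ≤ _ := by gcongr

/-- The corner entry of the unitary matrix is not small. -/
lemma one_le_norm_last_last {P η : ℝ} (hS : 1 ≤ S) (hP : 1 ≤ P) (hz : ∀ l, ‖z l‖ ≤ 1)
    (hgap : ∀ i j, i ≠ j → 1 ≤ P * ‖z i - z j‖) (hU : U ∈ Matrix.unitaryGroup (Fin (S + 1)) ℂ)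
    (hη : ∀ l, ‖noisePoly U (z l)‖ ≤ η) :
    1 ≤ (S + 1) * (vandermondeBound S P * (η + ‖U (Fin.last S) (Fin.last S)‖)) := by
  set V := vandermondeBound S P with hV
  have hV1 : 1 ≤ V := one_le_vandermondeBound hS hP
  set a := ‖U (Fin.last S) (Fin.last S)‖ with ha
  have hη0 : 0 ≤ η := (norm_nonneg _).trans (hη ⟨0, hS⟩)
  -- Without its top term the noise polynomial has degree below `S` and values at most `η + a` at
  -- the poles, so interpolation bounds all its coefficients.
  have hentry : ∀ i, ‖U i (Fin.last S)‖ ≤ V * (η + a) := by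
    intro i
    refine Fin.lastCases ?_ (fun i => ?_) i
    · nlinarith [norm_nonneg (U (Fin.last S) (Fin.last S))]
    · have := norm_le_of_norm_vandermonde_mulVec_le (r := η + a) hP hz hgap
        (c := fun i : Fin S => star (U i.castSucc (Fin.last S))) (fun l => by
          have h1 : ∑ i : Fin S, z l ^ (i : ℕ) * star (U i.castSucc (Fin.last S)) =
              noisePoly U (z l) - star (U (Fin.last S) (Fin.last S)) * z l ^ S := by
            rw [noisePoly, Fin.sum_univ_castSucc]
            simp [mul_comm]
          rw [h1]
          refine (norm_sub_le _ _).trans (add_le_add (hη l) ?_)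
          rw [norm_mul, norm_star, norm_pow]
          exact mul_le_of_le_one_right (norm_nonneg _) (pow_le_one₀ (norm_nonneg _) (hz l))) i
      rwa [norm_star] at this
  have hunit : ∑ i, ‖U i (Fin.last S)‖ ^ 2 = 1 := by
    have h1 := sum_norm_sq_unitary_mulVec hU (Pi.single (Fin.last S) 1)
    simp only [Matrix.mulVec_single_one, Matrix.col_apply] at h1
    rw [h1, Finset.sum_eq_single (Fin.last S)] <;> simp +contextual
  -- Otherwise the last column of `U` would have norm less than one.
  by_contra! hlt
  have hpos : 0 ≤ V * (η + a) := by positivity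
  have hsum : ∑ i, ‖U i (Fin.last S)‖ ^ 2 ≤ (S + 1) * (V * (η + a)) ^ 2 := by
    calc _ ≤ ∑ _i : Fin (S + 1), (V * (η + a)) ^ 2 :=
          Finset.sum_le_sum fun i _ => pow_le_pow_left₀ (norm_nonneg _) (hentry i) 2
      _ = _ := by simp
  have hS1 : (1 : ℝ) ≤ S + 1 := by linarith [(Nat.cast_nonneg S : (0 : ℝ) ≤ S)]
  have : V * (η + a) ≤ (S + 1) * (V * (η + a)) := le_mul_of_one_le_left hpos hS1
  nlinarith

/-- The adjugate of a unitary matrix is its determinant times its adjoint, so a corner minor has the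
modulus of the opposite corner entry. -/
lemma norm_det_signal_rows (hU : U ∈ Matrix.unitaryGroup (Fin (S + 1)) ℂ) :
    ‖(U.submatrix Fin.castSucc Fin.castSucc).det‖ = ‖U (Fin.last S) (Fin.last S)‖ := by
  have h1 : U.adjugate = U.det • star U := by
    calc U.adjugate = U.adjugate * (U * star U) := by
          rw [Matrix.mem_unitaryGroup_iff.1 hU, Matrix.mul_one]
      _ = _ := by rw [← Matrix.mul_assoc, Matrix.adjugate_mul, Matrix.smul_mul, Matrix.one_mul]
  have h2 := congrFun (congrFun h1 (Fin.last S)) (Fin.last S)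
  rw [Matrix.adjugate_fin_succ_eq_det_submatrix] at h2
  have h3 : ‖U.det‖ = 1 := by
    have : U.det ∈ unitary ℂ := Matrix.det_of_mem_unitary hU
    exact CStarRing.norm_of_mem_unitary this
  have h4 := congrArg norm h2
  simp only [Fin.succAbove_last, Matrix.smul_apply, Matrix.star_apply, smul_eq_mul, norm_mul,
    norm_pow, norm_neg, norm_one, one_pow, one_mul, norm_star, h3] at h4
  exact h4

/-- The pencil of the two shifted blocks of signal vectors is almost singular at the poles. -/
lemma norm_det_pencil_le {η : ℝ} (hz : ∀ l, ‖z l‖ ≤ 1)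
    (hU : U ∈ Matrix.unitaryGroup (Fin (S + 1)) ℂ) {l : Fin S}
    (hη : ‖noisePoly U (z l)‖ ≤ η) (hη' : η ≤ 1 / 2) :
    ‖(z l • U.submatrix Fin.castSucc Fin.castSucc - U.submatrix Fin.succ Fin.castSucc).det‖ ≤
      4 * S ^ 2 * (S.factorial * 2 ^ S) * η := by
  set B := z l • U.submatrix Fin.castSucc Fin.castSucc - U.submatrix Fin.succ Fin.castSucc with hB
  have hent : ∀ i j, ‖U i j‖ ≤ 1 := fun i j => entry_norm_bound_of_unitary hU i j
  -- The coordinates of `(1, z l, …, z l ^ S)` in the signal columns of `U`. They reproduce this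
  -- vector up to its component along the last column, which is `noisePoly U (z l)`.
  set a : Fin S → ℂ := fun j => ∑ i : Fin (S + 1), star (U i j.castSucc) * z l ^ (i : ℕ) with ha
  have hexp : ∀ k : Fin (S + 1), ∑ j : Fin S, U k j.castSucc * a j =
      z l ^ (k : ℕ) - U k (Fin.last S) * noisePoly U (z l) := by
    intro k
    have h1 : U *ᵥ (star U *ᵥ fun i : Fin (S + 1) => z l ^ (i : ℕ)) =
        fun i : Fin (S + 1) => z l ^ (i : ℕ) := by
      rw [Matrix.mulVec_mulVec, Matrix.mem_unitaryGroup_iff.1 hU, Matrix.one_mulVec]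
    have h2 := congrFun h1 k
    rw [Matrix.mulVec, dotProduct, Fin.sum_univ_castSucc] at h2
    rw [← h2, add_sub_assoc]
    have : U k (Fin.last S) * (star U *ᵥ fun i : Fin (S + 1) => z l ^ (i : ℕ)) (Fin.last S) -
        U k (Fin.last S) * noisePoly U (z l) = 0 := by
      rw [sub_eq_zero]; rfl
    rw [this, add_zero]
    rfl
  -- Shifting the vector of powers by one row multiplies it by `z l`, so the pencil annihilates `a`
  -- except for the noise component.
  have hBa : ∀ k, ‖(B *ᵥ a) k‖ ≤ 2 * η := by
    intro k
    have h1 : (B *ᵥ a) k = z l * (∑ j : Fin S, U k.castSucc j.castSucc * a j) -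
        ∑ j : Fin S, U k.succ j.castSucc * a j := by
      simp only [hB, Matrix.mulVec, dotProduct, Matrix.sub_apply, Matrix.smul_apply,
        Matrix.submatrix_apply, smul_eq_mul, sub_mul, Finset.sum_sub_distrib, Finset.mul_sum,
        mul_assoc]
    have h2 : (B *ᵥ a) k =
        (U k.succ (Fin.last S) - z l * U k.castSucc (Fin.last S)) * noisePoly U (z l) := by
      rw [h1, hexp, hexp]
      simp only [Fin.val_castSucc, Fin.val_succ, pow_succ]
      ring
    rw [h2, norm_mul]
    have h3 : ‖U k.succ (Fin.last S) - z l * U k.castSucc (Fin.last S)‖ ≤ 2 := by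
      refine (norm_sub_le _ _).trans ?_
      rw [norm_mul]
      have := mul_le_one₀ (hz l) (norm_nonneg _) (hent k.castSucc (Fin.last S))
      linarith [hent k.succ (Fin.last S)]
    exact mul_le_mul h3 hη (norm_nonneg _) zero_le_two
  have hBent : ∀ i j, ‖B i j‖ ≤ 2 := by
    intro i j
    simp only [hB, Matrix.sub_apply, Matrix.smul_apply, Matrix.submatrix_apply, smul_eq_mul]
    refine (norm_sub_le _ _).trans ?_
    rw [norm_mul]
    have := mul_le_one₀ (hz l) (norm_nonneg _) (hent i.castSucc j.castSucc)
    linarith [hent i.succ j.castSucc]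
  -- The first entry of the vector of powers is 1, so its signal coordinates cannot all be small;
  -- Cramer's rule then forces a small determinant.
  have hlarge : 1 / 2 ≤ ∑ j, ‖a j‖ := by
    have h1 := hexp 0
    simp only [Fin.val_zero, pow_zero] at h1
    have h2 : ‖U 0 (Fin.last S) * noisePoly U (z l)‖ ≤ 1 / 2 := by
      rw [norm_mul]
      calc _ ≤ 1 * η := mul_le_mul (hent _ _) hη (norm_nonneg _) zero_le_one
        _ ≤ _ := by linarith
    have h3 : ‖∑ j : Fin S, U 0 j.castSucc * a j‖ ≤ ∑ j, ‖a j‖ := by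
      refine (norm_sum_le _ _).trans (Finset.sum_le_sum fun j _ => ?_)
      rw [norm_mul]
      exact mul_le_of_le_one_left (norm_nonneg _) (hent _ _)
    have h4 := norm_sub_norm_le (1 : ℂ) (U 0 (Fin.last S) * noisePoly U (z l))
    rw [norm_one, ← h1] at h4
    linarith
  have hdet := norm_det_mul_norm_le one_le_two hBent hBa
  have hsum : ‖B.det‖ * ∑ j, ‖a j‖ ≤ S * (S * (S.factorial * 2 ^ S) * (2 * η)) := by
    rw [Finset.mul_sum]
    calc _ ≤ ∑ _j : Fin S, (S * (S.factorial * 2 ^ S) * (2 * η) : ℝ) :=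
          Finset.sum_le_sum fun j _ => hdet j
      _ = _ := by simp
  have : ‖B.det‖ * (1 / 2) ≤ ‖B.det‖ * ∑ j, ‖a j‖ := by gcongr
  nlinarith

lemma IsMoorePenrose.mul_eq_one {m : ℕ} {A B : Matrix (Fin m) (Fin m) ℂ} (h : IsMoorePenrose A B)
    (hA : A.det ≠ 0) : A * B = 1 := by
  have hu : IsUnit A.det := isUnit_iff_ne_zero.2 hA
  calc A * B = A * B * (A * A⁻¹) := by rw [Matrix.mul_nonsing_inv _ hu, Matrix.mul_one]
    _ = 1 := by rw [← Matrix.mul_assoc, h.mul_mul_self, Matrix.mul_nonsing_inv _ hu]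

lemma isMoorePenrose_inv {m : ℕ} {A : Matrix (Fin m) (Fin m) ℂ} (hA : A.det ≠ 0) :
    IsMoorePenrose A A⁻¹ := by
  have hu : IsUnit A.det := isUnit_iff_ne_zero.2 hA
  have h1 := Matrix.mul_nonsing_inv _ hu
  have h2 := Matrix.nonsing_inv_mul _ hu
  exact ⟨by rw [h1, Matrix.one_mul], by rw [h2, Matrix.one_mul],
    by rw [h1]; exact Matrix.isHermitian_one, by rw [h2]; exact Matrix.isHermitian_one⟩

lemma prod_sub_eq_charpoly_eval {m : ℕ} {A : Matrix (Fin m) (Fin m) ℂ} {w : Fin m → ℂ}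
    (h : A.charpoly.roots = Finset.univ.val.map w) (x : ℂ) :
    ∏ j, (x - w j) = A.charpoly.eval x := by
  rw [(IsAlgClosed.splits A.charpoly).eval_eq_prod_roots_of_monic A.charpoly_monic, h,
    Multiset.map_map]
  rfl

lemma castLE_eq_castSucc (h : S ≤ S + 1) : (Fin.castLE h : Fin S → Fin (S + 1)) = Fin.castSucc :=
  rfl

/-- The poles found by ESPRIT are approximate zeros of the signal poles. -/
lemma norm_prod_sub_esprit_le {P η : ℝ} (hS : 1 ≤ S) (hP : 1 ≤ P) (hz : ∀ l, ‖z l‖ ≤ 1)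
    (hgap : ∀ i j, i ≠ j → 1 ≤ P * ‖z i - z j‖) (hp : ∀ l, 1 ≤ P * ‖p l‖)
    (hy : ∀ k ≤ 2 * S, ‖y k - ∑ a, p a * z a ^ k‖ ≤ ε)
    (hη : P * (vandermondeBound S P * (2 * (S + 1) * ε)) ≤ η)
    (hη' : 2 * (S + 1) * vandermondeBound S P * η ≤ 1)
    {w : Fin S → ℂ} (hw : IsEspritOutput S S le_rfl y w) (l : Fin S) :
    ‖∏ j, (z l - w j)‖ ≤
      2 * (S + 1) * vandermondeBound S P * (4 * S ^ 2 * (S.factorial * 2 ^ S) * η) := by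
  obtain ⟨U, W, σ, hsvd, B, hB, hroots⟩ := hw
  rw [castLE_eq_castSucc] at hB hroots
  set V := vandermondeBound S P with hV
  have hV1 : 1 ≤ V := one_le_vandermondeBound hS hP
  have hn : ∀ l, ‖noisePoly U (z l)‖ ≤ η := fun l =>
    (norm_noisePoly_le hP hz hgap hp hy hsvd l).trans hη
  have hη0 : 0 ≤ η := (norm_nonneg _).trans (hn l)
  have hlast := one_le_norm_last_last hS hP hz hgap hsvd.left_unitary hn
  rw [← norm_det_signal_rows hsvd.left_unitary] at hlast
  set U₀ := U.submatrix Fin.castSucc Fin.castSucc with hU₀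
  set U₁ := U.submatrix Fin.succ Fin.castSucc with hU₁
  have hS1 : (1 : ℝ) ≤ S + 1 := by linarith [(Nat.cast_nonneg S : (0 : ℝ) ≤ S)]
  -- By `hη'` the share of `η` in `hlast` is at most one half; the determinant accounts for the
  -- rest.
  have hdet : 1 ≤ 2 * (S + 1) * V * ‖U₀.det‖ := by nlinarith
  have hne : U₀.det ≠ 0 := by
    intro h0
    rw [h0, norm_zero, mul_zero] at hdet
    linarith
  have hSV : (1 : ℝ) ≤ (S + 1) * V := one_le_mul_of_one_le_of_one_le hS1 hV1
  have hpen := norm_det_pencil_le hz hsvd.left_unitary (hn l) (by nlinarith)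
  -- As `U₀` is square and invertible, the pseudoinverse is an inverse, and the factor `U₀.det`
  -- clears it from the characteristic polynomial.
  have hfac : U₀.det * (B * U₁).charpoly.eval (z l) = (z l • U₀ - U₁).det := by
    rw [Matrix.eval_charpoly, ← Matrix.det_mul, Matrix.mul_sub, ← Matrix.mul_assoc,
      hB.mul_eq_one hne, Matrix.one_mul]
    congr 2
    simp [Matrix.scalar_apply, ← Matrix.smul_one_eq_diagonal]
  rw [prod_sub_eq_charpoly_eval hroots]
  calc ‖(B * U₁).charpoly.eval (z l)‖ ≤
        (2 * (S + 1) * V * ‖U₀.det‖) * ‖(B * U₁).charpoly.eval (z l)‖ :=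
        le_mul_of_one_le_left (norm_nonneg _) hdet
    _ = 2 * (S + 1) * V * ‖U₀.det * (B * U₁).charpoly.eval (z l)‖ := by rw [norm_mul]; ring
    _ ≤ _ := by rw [hfac]; gcongr

/-- A real Hankel matrix has a singular value decomposition. -/
lemma exists_isSVD (hy : ∀ k ≤ 2 * S, (y k).im = 0) :
    ∃ (U W : Matrix (Fin (S + 1)) (Fin (S + 1)) ℂ) (σ : Fin (S + 1) → ℝ),
      IsSVD (hankel S y) U W σ := by
  have hH : (hankel S y).IsHermitian := by
    ext i j
    simp only [Matrix.conjTranspose_apply, hankel, Matrix.of_apply]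
    rw [Nat.add_comm (j : ℕ) i]
    exact Complex.conj_eq_iff_im.2 (hy _ (by omega))
  set Q : Matrix (Fin (S + 1)) (Fin (S + 1)) ℂ :=
    (hH.eigenvectorUnitary : Matrix (Fin (S + 1)) (Fin (S + 1)) ℂ) with hQ
  have hQu : Q ∈ Matrix.unitaryGroup (Fin (S + 1)) ℂ := hH.eigenvectorUnitary.2
  set lam := hH.eigenvalues with hlam
  have hspec : hankel S y = Q * Matrix.diagonal (fun i => (lam i : ℂ)) * star Q := by
    conv_lhs => rw [hH.spectral_theorem]
    rw [Unitary.conjStarAlgAut_apply]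
    rfl
  -- Singular values of a Hermitian matrix are the moduli of its eigenvalues; the minus sign makes
  -- the ascending sort a descending order of the moduli.
  set e := Tuple.sort (fun i => -|lam i|) with he
  have hmono : Monotone ((fun i => -|lam i|) ∘ e) := Tuple.monotone_sort _
  -- The signs of the eigenvalues go into the right factor; the eigenvalue 0 gets the sign 1 to keep
  -- that factor unitary.
  set sgn : Fin (S + 1) → ℂ := fun i => if 0 ≤ lam i then 1 else -1 with hsgn
  have hsgn1 : ∀ i, ((|lam i| : ℝ) : ℂ) * sgn i = lam i := by
    intro i
    by_cases h : 0 ≤ lam i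
    · simp [hsgn, h, abs_of_nonneg h]
    · simp [hsgn, h, abs_of_neg (not_le.1 h)]
  have hQe : star (Q.submatrix id e) * Q.submatrix id e = 1 := by
    have := Matrix.submatrix_mul_equiv (star Q) Q e (Equiv.refl (Fin (S + 1))) e
    rw [Matrix.mem_unitaryGroup_iff'.1 hQu, Matrix.submatrix_one_equiv] at this
    exact this
  have hQe' : Q.submatrix id e * star (Q.submatrix id e) = 1 := by
    have := Matrix.submatrix_mul_equiv Q (star Q) id e id
    rw [Matrix.mem_unitaryGroup_iff.1 hQu, Matrix.submatrix_id_id] at this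
    exact this
  have hs : star (Matrix.diagonal fun i => sgn (e i)) * (Matrix.diagonal fun i => sgn (e i)) =
      (1 : Matrix (Fin (S + 1)) (Fin (S + 1)) ℂ) := by
    rw [Matrix.star_eq_conjTranspose, Matrix.diagonal_conjTranspose, Matrix.diagonal_mul_diagonal,
      ← Matrix.diagonal_one]
    congr 1
    ext i
    simp only [hsgn, Pi.star_apply]
    split_ifs <;> simp
  refine ⟨Q.submatrix id e, (Matrix.diagonal fun i => sgn (e i)) * star (Q.submatrix id e),
    fun i => |lam (e i)|, Matrix.mem_unitaryGroup_iff.2 hQe', ?_, fun i => abs_nonneg _,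
    fun i j hij => neg_le_neg_iff.1 (hmono hij), ?_⟩
  · rw [Matrix.mem_unitaryGroup_iff', star_mul, star_star, Matrix.mul_assoc, ← Matrix.mul_assoc
      (star (Matrix.diagonal fun i => sgn (e i))), hs, Matrix.one_mul, hQe']
  · rw [Matrix.mul_assoc, ← Matrix.mul_assoc (Matrix.diagonal _), Matrix.diagonal_mul_diagonal]
    simp only [hsgn1]
    have h1 : (Matrix.diagonal fun i => (lam (e i) : ℂ)) =
        (Matrix.diagonal fun i => (lam i : ℂ)).submatrix e e := by
      rw [Matrix.submatrix_diagonal_equiv]; rfl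
    have h2 : star (Q.submatrix id e) = (star Q).submatrix e id := rfl
    rw [h1, h2, Matrix.submatrix_mul_equiv, Matrix.submatrix_mul_equiv, Matrix.submatrix_id_id,
      ← Matrix.mul_assoc, ← hspec]

/-- ESPRIT has an output when the signal blocks are invertible. -/
lemma exists_isEspritOutput {P η : ℝ} (hS : 1 ≤ S) (hP : 1 ≤ P) (hz : ∀ l, ‖z l‖ ≤ 1)
    (hgap : ∀ i j, i ≠ j → 1 ≤ P * ‖z i - z j‖) (hp : ∀ l, 1 ≤ P * ‖p l‖)
    (hy : ∀ k ≤ 2 * S, ‖y k - ∑ a, p a * z a ^ k‖ ≤ ε)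
    (hη : P * (vandermondeBound S P * (2 * (S + 1) * ε)) ≤ η)
    (hη' : 2 * (S + 1) * vandermondeBound S P * η ≤ 1) (hre : ∀ k ≤ 2 * S, (y k).im = 0) :
    ∃ w, IsEspritOutput S S le_rfl y w := by
  obtain ⟨U, W, σ, hsvd⟩ := exists_isSVD hre
  have hn : ∀ l, ‖noisePoly U (z l)‖ ≤ η := fun l =>
    (norm_noisePoly_le hP hz hgap hp hy hsvd l).trans hη
  have hlast := one_le_norm_last_last hS hP hz hgap hsvd.left_unitary hn
  rw [← norm_det_signal_rows hsvd.left_unitary] at hlast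
  have hne : (U.submatrix Fin.castSucc Fin.castSucc).det ≠ 0 := by
    intro h0
    rw [h0, norm_zero, add_zero] at hlast
    nlinarith
  set B := (U.submatrix Fin.castSucc Fin.castSucc)⁻¹ * U.submatrix Fin.succ Fin.castSucc with hB
  have hcard : Multiset.card B.charpoly.roots = S := by
    rw [← (IsAlgClosed.splits B.charpoly).natDegree_eq_card_roots, Matrix.charpoly_natDegree_eq_dim,
      Fintype.card_fin]
  obtain ⟨L, hL⟩ : ∃ L : List ℂ, (L : Multiset ℂ) = B.charpoly.roots :=
    ⟨_, Multiset.coe_toList _⟩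
  have hlen : L.length = S := by rw [← hcard, ← hL, Multiset.coe_card]
  refine ⟨fun j => L.get (j.cast hlen.symm), U, W, σ, hsvd, _, isMoorePenrose_inv hne, ?_⟩
  rw [castLE_eq_castSucc, ← hB, ← hL]
  subst hlen
  rw [Fin.univ_val_map]
  simp

end Esprit

/-! ## The signal of a state that satisfies the promise -/

section Promise

variable {n κ S P : ℕ} {H : LocalHamiltonian n κ} {Φ : QState n} {E : Fin S → ℝ}

/-- The poles of the signal. -/
noncomputable def pole (E : Fin S → ℝ) (l : Fin S) : ℝ := 1 - E l / (2 * Real.pi)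

/-- This keeps the powers of the poles bounded and the poles within the range of the grid. -/
lemma SpectralPromise.pole_mem (h : SpectralPromise H Φ E P) (l : Fin S) :
    0 ≤ pole E l ∧ pole E l ≤ 1 := by
  obtain ⟨h1, h2⟩ := h.range l
  have hpi := Real.pi_pos
  have h3 : E l / (2 * Real.pi) ≤ 1 := by
    rw [div_le_one (by positivity)]; linarith
  have h4 : 0 ≤ E l / (2 * Real.pi) := by positivity
  constructor <;> unfold pole <;> linarith

lemma SpectralPromise.norm_pole_le (h : SpectralPromise H Φ E P) (l : Fin S) :
    ‖(pole E l : ℂ)‖ ≤ 1 := by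
  rw [Complex.norm_real, Real.norm_eq_abs, abs_of_nonneg (h.pole_mem l).1]
  exact (h.pole_mem l).2

lemma SpectralPromise.pole_gap (h : SpectralPromise H Φ E P) (i j : Fin S) (hij : i ≠ j) :
    1 ≤ (P : ℝ) * ‖(pole E i : ℂ) - pole E j‖ := by
  have hpi := Real.pi_pos
  have h1 : pole E i - pole E j = -((E i - E j) / (2 * Real.pi)) := by unfold pole; ring
  rw [← Complex.ofReal_sub, Complex.norm_real, Real.norm_eq_abs, h1, abs_neg, abs_div,
    abs_of_pos (by positivity : 0 < 2 * Real.pi)]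
  exact h.gap i j hij

lemma two_pi_mul_one_sub_pole (E : Fin S → ℝ) (l : Fin S) :
    2 * (Real.pi : ℂ) * (1 - pole E l) = E l := by
  have hpi : (Real.pi : ℂ) ≠ 0 := by exact_mod_cast Real.pi_ne_zero
  unfold pole
  push_cast
  field_simp
  ring

/-- The signal is a sum of exponentials, and the powers of `I - H / 2π` do not increase the norm of
the state. -/
lemma SpectralPromise.exists_signal (h : SpectralPromise H Φ E P) : ∃ p : Fin S → ℝ,
    (∀ l, 0 ≤ p l) ∧ (∀ l, 1 ≤ (P : ℝ) * p l) ∧ ∑ l, p l = 1 ∧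
    (∀ k, decaySignal H Φ k = ∑ l, (p l : ℂ) * (pole E l : ℂ) ^ k) ∧
    ∀ k, ∑ x, ‖(stepMatrix H ^ k *ᵥ Φ.ofLp) x‖ ^ 2 ≤ 1 := by
  obtain ⟨ψ, hψ, heig, hsum, hprob⟩ := h.supported
  set c : Fin S → ℂ := fun l => inner ℂ (ψ l) Φ with hc
  have hstep : ∀ l, stepMatrix H *ᵥ (ψ l).ofLp = (pole E l : ℂ) • (ψ l).ofLp := by
    intro l
    rw [stepMatrix, Matrix.sub_mulVec, Matrix.one_mulVec, Matrix.smul_mulVec, heig, smul_smul]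
    nth_rewrite 1 [← one_smul ℂ (ψ l).ofLp]
    rw [← sub_smul]
    congr 1
    unfold pole
    push_cast
    ring
  have hpow : ∀ k l, stepMatrix H ^ k *ᵥ (ψ l).ofLp = (pole E l : ℂ) ^ k • (ψ l).ofLp := by
    intro k l
    induction k with
    | zero => simp
    | succ k ih =>
      rw [pow_succ, ← Matrix.mulVec_mulVec, hstep, Matrix.mulVec_smul, ih, smul_smul, pow_succ']
  have hv : ∀ k, stepMatrix H ^ k *ᵥ Φ.ofLp =
      (∑ l, (c l * (pole E l : ℂ) ^ k) • ψ l : QState n).ofLp := by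
    intro k
    conv_lhs => rw [hsum]
    simp only [WithLp.ofLp_sum, WithLp.ofLp_smul, Matrix.mulVec_sum, Matrix.mulVec_smul, hpow,
      smul_smul]
    rfl
  -- By orthonormality only the eigenvalues that occur in `Φ` enter; the rest of the spectrum of `H`
  -- is unconstrained.
  have hnorm : ∀ k, ∑ x, ‖(stepMatrix H ^ k *ᵥ Φ.ofLp) x‖ ^ 2 =
      ∑ l, ‖c l‖ ^ 2 * (pole E l ^ k) ^ 2 := by
    intro k
    have h1 := EuclideanSpace.norm_sq_eq (∑ l, (c l * (pole E l : ℂ) ^ k) • ψ l : QState n)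
    rw [← hv] at h1
    rw [← h1, ← inner_self_eq_norm_sq (𝕜 := ℂ), hψ.inner_sum, map_sum]
    refine Finset.sum_congr rfl fun l _ => ?_
    rw [Complex.conj_mul', ← Complex.ofReal_pow, RCLike.re_to_complex, Complex.ofReal_re, norm_mul,
      norm_pow, Complex.norm_real, mul_pow, Real.norm_eq_abs, ← pow_mul, ← pow_mul, mul_comm k,
      pow_mul, sq_abs, ← pow_mul]
  have hp1 : ∑ l, ‖c l‖ ^ 2 = 1 := by
    have h1 := hnorm 0
    have h2 := EuclideanSpace.norm_sq_eq Φ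
    simp only [pow_zero, Matrix.one_mulVec, one_pow, mul_one] at h1
    rw [← h1, ← h2, h.normalized, one_pow]
  refine ⟨fun l => ‖c l‖ ^ 2, fun l => sq_nonneg _, hprob, hp1, fun k => ?_, fun k => ?_⟩
  · have h1 : decaySignal H Φ k = inner ℂ Φ (∑ l, (c l * (pole E l : ℂ) ^ k) • ψ l : QState n) := by
      rw [EuclideanSpace.inner_eq_star_dotProduct, decaySignal, hv, dotProduct_comm]
    rw [h1, inner_sum]
    refine Finset.sum_congr rfl fun l _ => ?_
    rw [inner_smul_right, ← inner_conj_symm Φ (ψ l)]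
    have := Complex.conj_mul' (c l)
    push_cast
    rw [← this]
    simp only [hc]
    ring
  · rw [hnorm, ← hp1]
    refine Finset.sum_le_sum fun l _ => ?_
    refine mul_le_of_le_one_right (sq_nonneg _) ?_
    obtain ⟨h1, h2⟩ := h.pole_mem l
    exact pow_le_one₀ (by positivity) (pow_le_one₀ h1 h2)

end Promise

/-- The bound for the squared residual in units of the grid constant. -/
def residualConst (S : ℕ) : ℕ := S * (2 ^ S + 1) ^ 2

/-- How fine the grid and how precise the signal have to be. -/
def resolutionConst (S : ℕ) : ℕ :=
  4 ^ S * (S ^ 2 * S.factorial ^ 2 * (16 * (S + 1) ^ 2 * S ^ 2 * S.factorial * 2 ^ S)) +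
    4 ^ S * (S * S.factorial * (residualConst S + 2 ^ S))

/-! ### From a precise signal to a correct output -/

section Deterministic

variable {n κ S P q K : ℕ} {H : LocalHamiltonian n κ} {Φ : QState n} {E : Fin S → ℝ}

/-- What the resolution is fine enough for. -/
lemma resolution_bounds (hS : 1 ≤ S) (hP : (1 : ℝ) ≤ P)
    (hK : resolutionConst S * (P + q + 1) ^ (2 * S ^ 2 + S + 1) ≤ K) {δ ε V η : ℝ}
    (hδ : δ = 1 / (4 * (P + q + 1))) (hε : ε = 1 / K) (hV : V = vandermondeBound S P)
    (hη : η = P * (V * (2 * (S + 1) * ε))) :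
    0 < (K : ℝ) ∧ (q : ℝ) ≤ K ∧ 2 * (S + 1) * V * η ≤ 1 ∧
      2 * (S + 1) * V * (4 * S ^ 2 * (S.factorial * 2 ^ S) * η) ≤ δ ^ S ∧
      P * (V * (residualConst S / K + 2 ^ S * ε)) ≤ δ ^ S := by
  set D : ℝ := P + q + 1 with hD
  have hq0 : (0 : ℝ) ≤ q := Nat.cast_nonneg q
  have hD1 : 1 ≤ D := by linarith
  have hPD : (P : ℝ) ≤ D := by linarith
  have hS1 : (1 : ℝ) ≤ S := by exact_mod_cast hS
  have hf1 : (1 : ℝ) ≤ S.factorial := by exact_mod_cast S.factorial_pos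
  have h2S : (1 : ℝ) ≤ 2 ^ S := one_le_pow₀ one_le_two
  have hV1 : 1 ≤ V := hV ▸ one_le_vandermondeBound hS hP
  have hVD : V ≤ S * S.factorial * D ^ (S * S) := by
    rw [hV, vandermondeBound]; gcongr
  have hKR : (resolutionConst S : ℝ) * D ^ (2 * S ^ 2 + S + 1) ≤ K := by
    have : ((resolutionConst S * (P + q + 1) ^ (2 * S ^ 2 + S + 1) : ℕ) : ℝ) ≤ K := by
      exact_mod_cast hK
    push_cast at this
    exact this
  set b : ℝ := ((residualConst S : ℕ) : ℝ) with hb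
  have hb1 : 1 ≤ b := by
    have : 1 ≤ residualConst S := by unfold residualConst; exact Nat.mul_pos hS (by positivity)
    rw [hb]
    exact_mod_cast this
  have hc : (resolutionConst S : ℝ) = 4 ^ S * (S ^ 2 * S.factorial ^ 2 *
      (16 * (S + 1) ^ 2 * S ^ 2 * S.factorial * 2 ^ S)) +
      4 ^ S * (S * S.factorial * (b + 2 ^ S)) := by
    rw [resolutionConst]; push_cast; rfl
  have hKpos : (0 : ℝ) < K := by
    refine lt_of_lt_of_le ?_ hKR
    rw [hc]; positivity
  have hδ0 : 0 < δ := by rw [hδ]; positivity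
  have hδS : δ ^ S = 1 / (4 ^ S * D ^ S) := by rw [hδ, div_pow, one_pow, mul_pow]
  -- The exponent `2 * S ^ 2 + S + 1` collects the powers of `D` from `V ^ 2`, from `δ ^ S` and from
  -- `P`.
  have hbound1 : 2 * (S + 1) * V * (4 * S ^ 2 * (S.factorial * 2 ^ S) * η) ≤ δ ^ S := by
    rw [hδS, hη, hε, le_div_iff₀ (by positivity)]
    have : (2 * (S + 1) * V * (4 * S ^ 2 * (S.factorial * 2 ^ S) *
        (P * (V * (2 * (S + 1) * (1 / K)))))) * (4 ^ S * D ^ S) =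
        (4 ^ S * (16 * (S + 1) ^ 2 * S ^ 2 * S.factorial * 2 ^ S) * (P * V ^ 2 * D ^ S)) / K := by
      field_simp; ring
    rw [this, div_le_one hKpos]
    refine le_trans ?_ hKR
    have h1 : (P : ℝ) * V ^ 2 * D ^ S ≤
        D * (S * S.factorial * D ^ (S * S)) ^ 2 * D ^ S := by gcongr
    have h2 : D * (S * S.factorial * D ^ (S * S)) ^ 2 * D ^ S =
        S ^ 2 * S.factorial ^ 2 * D ^ (2 * S ^ 2 + S + 1) := by ring
    rw [h2] at h1
    calc _ ≤ 4 ^ S * (16 * (S + 1) ^ 2 * S ^ 2 * S.factorial * 2 ^ S) *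
          (S ^ 2 * S.factorial ^ 2 * D ^ (2 * S ^ 2 + S + 1)) := by gcongr
      _ = (4 ^ S * (S ^ 2 * S.factorial ^ 2 *
      (16 * (S + 1) ^ 2 * S ^ 2 * S.factorial * 2 ^ S))) * D ^ (2 * S ^ 2 + S + 1) := by ring
      _ ≤ _ := by
        rw [hc]
        gcongr
        have : (0 : ℝ) ≤ 4 ^ S * (S * S.factorial * (b + 2 ^ S)) := by positivity
        linarith
  have hη0 : 0 ≤ η := by rw [hη, hε]; positivity
  have hbound2 : 2 * (S + 1) * V * η ≤ 1 := by
    have h1 : δ ^ S ≤ 1 := pow_le_one₀ hδ0.le (by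
      rw [hδ, div_le_one (by positivity)]; linarith)
    have h2 : (1 : ℝ) ≤ 4 * S ^ 2 * (S.factorial * 2 ^ S) := by
      have h3 : (1 : ℝ) ≤ S.factorial * 2 ^ S := one_le_mul_of_one_le_of_one_le hf1 h2S
      have h4 : (1 : ℝ) ≤ 4 * S ^ 2 := by nlinarith
      exact one_le_mul_of_one_le_of_one_le h4 h3
    refine le_trans ?_ (hbound1.trans h1)
    have h3 : η ≤ 4 * S ^ 2 * (S.factorial * 2 ^ S) * η := le_mul_of_one_le_left hη0 h2
    gcongr
  have hbound3 : P * (V * (b / K + 2 ^ S * ε)) ≤ δ ^ S := by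
    rw [hδS, hε, le_div_iff₀ (by positivity)]
    have : P * (V * (b / K + 2 ^ S * (1 / K))) * (4 ^ S * D ^ S) =
        (4 ^ S * (b + 2 ^ S) * (P * V * D ^ S)) / K := by
      field_simp
    rw [this, div_le_one hKpos]
    refine le_trans ?_ hKR
    have h1 : (P : ℝ) * V * D ^ S ≤ D * (S * S.factorial * D ^ (S * S)) * D ^ S := by gcongr
    have h2 : D * (S * S.factorial * D ^ (S * S)) * D ^ S =
        S * S.factorial * D ^ (S ^ 2 + S + 1) := by ring
    have h3 : D ^ (S ^ 2 + S + 1) ≤ D ^ (2 * S ^ 2 + S + 1) :=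
      pow_le_pow_right₀ hD1 (by nlinarith)
    rw [h2] at h1
    calc _ ≤ 4 ^ S * (b + 2 ^ S) * (S * S.factorial * D ^ (2 * S ^ 2 + S + 1)) := by
          exact mul_le_mul_of_nonneg_left
            (h1.trans (mul_le_mul_of_nonneg_left h3 (by positivity))) (by positivity)
      _ = (4 ^ S * (S * S.factorial * (b + 2 ^ S))) * D ^ (2 * S ^ 2 + S + 1) := by ring
      _ ≤ _ := by
        rw [hc]
        gcongr
        have : (0 : ℝ) ≤ 4 ^ S * (S ^ 2 * S.factorial ^ 2 *
          (16 * (S + 1) ^ 2 * S ^ 2 * S.factorial * 2 ^ S)) := by positivity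
        linarith
  have hqK : (q : ℝ) ≤ K := by
    have h3 : (1 : ℝ) ≤ resolutionConst S := by
      have : 1 ≤ resolutionConst S := by
        unfold resolutionConst
        have : 1 ≤ 4 ^ S * (S * S.factorial * (residualConst S + 2 ^ S)) :=
          Nat.mul_pos (by positivity) (Nat.mul_pos (Nat.mul_pos hS S.factorial_pos)
            (by positivity))
        omega
      exact_mod_cast this
    have h4 : D ≤ D ^ (2 * S ^ 2 + S + 1) := le_self_pow₀ hD1 (by omega)
    nlinarith
  exact ⟨hKpos, hqK, hbound2, hbound1, hbound3⟩

/-- If the signal is precise and poles with a small residual have been stored, then the output is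
correct. -/
lemma SpectralPromise.goodOutput (h : SpectralPromise H Φ E P) (hS : 1 ≤ S)
    (hK : resolutionConst S * (P + q + 1) ^ (2 * S ^ 2 + S + 1) ≤ K) {out : MState}
    (hsig : ∀ k ≤ 2 * S, ‖out.num k - decaySignal H Φ k‖ ≤ 1 / K)
    (hre : ∀ k ≤ 2 * S, (out.num k).im = 0)
    (hstore : StoresPoles S (residualConst S / (K * K)) out.num out) :
    GoodOutput H Φ E q out := by
  obtain ⟨p, hp0, hp, hp1, hg, -⟩ := h.exists_signal
  have hP : (1 : ℝ) ≤ P := by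
    have h1 := hp ⟨0, hS⟩
    have h2 : p ⟨0, hS⟩ ≤ 1 := hp1 ▸ Finset.single_le_sum (fun l _ => hp0 l) (Finset.mem_univ _)
    nlinarith [(Nat.cast_nonneg P : (0 : ℝ) ≤ P)]
  have hq0 : (0 : ℝ) ≤ q := Nat.cast_nonneg q
  obtain ⟨D, hD⟩ : ∃ D : ℝ, D = P + q + 1 := ⟨_, rfl⟩
  have hD1 : 1 ≤ D := by linarith
  have hPD : (P : ℝ) ≤ D := by linarith
  obtain ⟨δ, hδ⟩ : ∃ δ : ℝ, δ = 1 / (4 * (P + q + 1)) := ⟨_, rfl⟩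
  obtain ⟨ε, hε⟩ : ∃ ε : ℝ, ε = 1 / K := ⟨_, rfl⟩
  obtain ⟨hKpos, hqK, hbound2, hbound1, hbound3⟩ := resolution_bounds hS hP hK hδ hε rfl rfl
  rw [← hD] at hδ
  rw [← hε] at hsig
  have hδ0 : 0 < δ := by rw [hδ]; positivity
  have hb1 : (1 : ℝ) ≤ residualConst S := by
    have : 1 ≤ residualConst S := by unfold residualConst; exact Nat.mul_pos hS (by positivity)
    exact_mod_cast this
  have hz := h.norm_pole_le
  have hgap := h.pole_gap
  have hp' : ∀ l, 1 ≤ (P : ℝ) * ‖(p l : ℂ)‖ := fun l => by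
    rw [Complex.norm_real, Real.norm_eq_abs, abs_of_nonneg (hp0 l)]; exact hp l
  have hy : ∀ k ≤ 2 * S, ‖out.num k - ∑ a, (p a : ℂ) * (pole E a : ℂ) ^ k‖ ≤ ε := fun k hk => by
    rw [← hg]; exact hsig k hk
  -- The factor 4 in `δ` makes `2 * δ = 1 / (2 * D)`, which is below the gap `1 / P`.
  have hgap' : ∀ i j, i ≠ j → 2 * δ < ‖(pole E i : ℂ) - pole E j‖ := by
    intro i j hij
    have h1 := hgap i j hij
    have h2 : D * (2 * δ) = 1 / 2 := by rw [hδ]; field_simp; norm_num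
    by_contra! hle
    have h3 : (P : ℝ) * ‖(pole E i : ℂ) - pole E j‖ ≤ D * (2 * δ) := by gcongr
    linarith
  -- The computed energies and those of ESPRIT are compared through the true poles, which doubles
  -- `δ`.
  have hqδ : q * (2 * δ) ≤ 1 := by
    rw [hδ, mul_one_div, mul_div_assoc', div_le_one (by positivity)]
    linarith
  have hpi : 0 < 2 * Real.pi := by positivity
  have hdist : ∀ a b : ℂ, ‖2 * (Real.pi : ℂ) * (1 - a) - 2 * (Real.pi : ℂ) * (1 - b)‖ =
      2 * Real.pi * ‖b - a‖ := by
    intro a b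
    have : 2 * (Real.pi : ℂ) * (1 - a) - 2 * (Real.pi : ℂ) * (1 - b) =
        ((2 * Real.pi : ℝ) : ℂ) * (b - a) := by push_cast; ring
    rw [this, norm_mul, Complex.norm_real, Real.norm_eq_abs, abs_of_pos hpi]
  have hesp : ∀ w, IsEspritOutput S S le_rfl out.num w →
      ∃ τ : Equiv.Perm (Fin S), ∀ l, ‖(pole E l : ℂ) - w (τ l)‖ ≤ δ := fun w hw =>
    exists_perm_norm_sub_le hδ0 hgap' fun l =>
      (norm_prod_sub_esprit_le hS hP hz hgap hp' hy le_rfl hbound2 hw l).trans hbound1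
  obtain ⟨w, hwres, hw1, hwout⟩ := hstore
  have hen : out.energies S = fun j : Fin S => 2 * (Real.pi : ℂ) * (1 - w j) :=
    funext fun j => hwout j j.2
  obtain ⟨τ, hτ⟩ : ∃ τ : Equiv.Perm (Fin S), ∀ l, ‖(pole E l : ℂ) - w (τ l)‖ ≤ δ :=
    exists_perm_norm_sub_le (w := fun j : Fin S => w j) hδ0 hgap' fun l =>
      -- The threshold `b / K ^ 2` is at most `(b / K) ^ 2` since `b ≥ 1`, which avoids a square
      -- root.
      (norm_prod_sub_le_of_residual hP hz hgap hp' hy hw1 (η := residualConst S / K) (by positivity)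
        (hwres.trans (by
          rw [div_pow, ← pow_two]
          gcongr
          exact le_self_pow₀ hb1 two_ne_zero)) l).trans hbound3
  refine ⟨fun k hk => ?_, ?_, fun v hv => ?_, fun v hv => ?_, ?_⟩
  · calc (q : ℝ) * ‖out.signal k - decaySignal H Φ k‖ ≤ K * ε := by
          gcongr
          exact hsig k hk
      _ = 1 := by rw [hε, mul_one_div_cancel hKpos.ne']
  · exact exists_isEspritOutput hS hP hz hgap hp' hy le_rfl hbound2 hre
  · obtain ⟨τ', hτ'⟩ := hesp v hv
    have : matchDist (fun j => (E j : ℂ)) (energyOf v) ≤ δ := matchDist_le hS τ' fun j => by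
      rw [← two_pi_mul_one_sub_pole, energyOf, hdist]
      gcongr
      exact hτ' j
    nlinarith
  · obtain ⟨τ', hτ'⟩ := hesp v hv
    have : matchDist (energyOf v) (out.energies S) ≤ 2 * δ :=
      matchDist_le hS (τ'⁻¹.trans τ) fun j => by
        obtain ⟨l, rfl⟩ := τ'.surjective j
        rw [hen, energyOf, hdist]
        gcongr
        have h1 := norm_sub_le ((pole E l : ℂ) - w (τ l)) (pole E l - v (τ' l))
        rw [sub_sub_sub_cancel_left] at h1
        have h2 : (τ'⁻¹.trans τ) (τ' l) = τ l := by simp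
        rw [h2]
        linarith [hτ l, hτ' l]
    nlinarith
  · have : matchDist (fun j => (E j : ℂ)) (out.energies S) ≤ δ := matchDist_le hS τ fun j => by
      rw [← two_pi_mul_one_sub_pole, hen, hdist]
      gcongr
      exact hτ j
    nlinarith

/-- The grid contains poles with a small residual if the signal is precise. -/
lemma SpectralPromise.exists_grid (h : SpectralPromise H Φ E P) (hS : 1 ≤ S) (hK : 0 < K)
    {y : ℕ → ℂ} (hsig : ∀ k ≤ 2 * S, ‖y k - decaySignal H Φ k‖ ≤ 1 / K) :
    ∃ g : ℕ → ℕ, (∀ j, g j ≤ K) ∧ recurrenceResidual S (fun j => (g j / K : ℂ)) y ≤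
      residualConst S / ((K : ℝ) * K) := by
  obtain ⟨p, hp0, -, hp1, hg, -⟩ := h.exists_signal
  refine exists_grid_residual_le hS hK h.pole_mem (p := fun l => (p l : ℂ)) ?_ fun k hk => ?_
  · rw [← hp1]
    refine (Finset.sum_congr rfl fun l _ => ?_).le
    rw [Complex.norm_real, Real.norm_eq_abs, abs_of_nonneg (hp0 l)]
  · rw [← hg]; exact hsig k hk

end Deterministic

/-! ## The median of means -/

/-- If the median exceeds `g + δ`, so does every number not smaller than the median, which is at
least half of them; the other side is symmetric. -/
lemma IsMedian.card_ge {r : ℕ} {f : Fin r → ℝ} {v g δ : ℝ} (h : IsMedian f v) (hv : δ < |v - g|) :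
    r ≤ 2 * (Finset.univ.filter fun j => δ < |f j - g|).card := by
  obtain ⟨i, ⟨h1, h2⟩, -, rfl⟩ := h
  rw [Nat.card_eq_fintype_card, Fintype.card_subtype] at h1 h2
  rcases lt_abs.1 hv with hv | hv
  · refine h2.trans (Nat.mul_le_mul_left 2 (Finset.card_le_card fun j hj => ?_))
    rw [Finset.mem_filter] at hj ⊢
    exact ⟨hj.1, lt_abs.2 (Or.inl (by linarith [hj.2]))⟩
  · refine h1.trans (Nat.mul_le_mul_left 2 (Finset.card_le_card fun j hj => ?_))
    rw [Finset.mem_filter] at hj ⊢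
    exact ⟨hj.1, lt_abs.2 (Or.inr (by linarith [hj.2]))⟩

/-! ### Concentration of medians of means -/

section Independence

variable {Ω α : Type} [MeasurableSpace Ω] {μ : Measure Ω} [IsProbabilityMeasure μ]
  [MeasurableSpace α] [Finite α] [MeasurableSingletonClass α] {X : ℕ → Ω → α}

/-- Events that depend on disjoint blocks of independent variables occur jointly with at most the
product of the bounds for their probabilities. -/
lemma measure_forall_le_pow [Inhabited α] (hX : ∀ i, Measurable (X i)) (hind : iIndepFun X μ) {ι : Type}
    [DecidableEq ι] {B : ι → Finset ℕ} (hB : ∀ i j, i ≠ j → Disjoint (B i) (B j))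
    {G : ι → (ℕ → α) → Prop} (hG : ∀ j x y, (∀ i ∈ B j, x i = y i) → (G j x ↔ G j y))
    {ε : ENNReal} (hε : ∀ j, μ {ω | G j fun i => X i ω} ≤ ε) (A : Finset ι) :
    μ {ω | ∀ j ∈ A, G j fun i => X i ω} ≤ ε ^ A.card := by
  classical
  induction A using Finset.induction_on with
  | empty => simp
  | insert a A ha ih =>
    set U := A.biUnion B with hU
    have hdis : Disjoint (B a) U := by
      rw [hU, Finset.disjoint_biUnion_right]
      intro j hj
      exact hB a j fun h => ha (h ▸ hj)
    -- Fill up a partial assignment with a default value; by `hG` the events do not see the values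
    -- outside their blocks.
    let ext : (S : Finset ℕ) → ((i : S) → α) → ℕ → α := fun S u i =>
      if h : i ∈ S then u ⟨i, h⟩ else default
    have key := (hind.indepFun_finset (B a) U hdis hX).measure_inter_preimage_eq_mul
      {u | G a (ext _ u)} {u | ∀ j ∈ A, G j (ext _ u)} (Set.toFinite _).measurableSet
      (Set.toFinite _).measurableSet
    have e1 : (fun ω (i : B a) => X i ω) ⁻¹' {u | G a (ext _ u)} = {ω | G a fun i => X i ω} := by
      ext ω
      refine hG a _ _ fun i hi => ?_
      simp only [ext, dif_pos hi]
    have e2 : (fun ω (i : U) => X i ω) ⁻¹' {u | ∀ j ∈ A, G j (ext _ u)} =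
        {ω | ∀ j ∈ A, G j fun i => X i ω} := by
      ext ω
      refine forall₂_congr fun j hj => hG j _ _ fun i hi => ?_
      have : i ∈ U := Finset.mem_biUnion.2 ⟨j, hj, hi⟩
      simp only [ext, dif_pos this]
    rw [e1, e2] at key
    have e3 : {ω | ∀ j ∈ insert a A, G j fun i => X i ω} =
        {ω | G a fun i => X i ω} ∩ {ω | ∀ j ∈ A, G j fun i => X i ω} := by
      ext ω
      simp only [Finset.forall_mem_insert, Set.mem_ofPred_eq, Set.mem_inter_iff]
    rw [e3, key, Finset.card_insert_of_notMem ha, pow_succ']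
    exact mul_le_mul' (hε a) ih

/-- If each of `r` independent events has probability at most `1 / 64`, then at least half of them
occur with probability at most `4⁻ʳ`. -/
lemma measure_half_le [Inhabited α] (hX : ∀ i, Measurable (X i)) (hind : iIndepFun X μ) {r : ℕ}
    {B : Fin r → Finset ℕ} (hB : ∀ i j, i ≠ j → Disjoint (B i) (B j))
    {G : Fin r → (ℕ → α) → Prop} (hG : ∀ j x y, (∀ i ∈ B j, x i = y i) → (G j x ↔ G j y))
    (hε : ∀ j, μ {ω | G j fun i => X i ω} ≤ 64⁻¹) :
    μ {ω | ∃ A : Finset (Fin r), r ≤ 2 * A.card ∧ ∀ j ∈ A, G j fun i => X i ω} ≤ 4⁻¹ ^ r := by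
  have hsub : {ω | ∃ A : Finset (Fin r), r ≤ 2 * A.card ∧ ∀ j ∈ A, G j fun i => X i ω} ⊆
      ⋃ A ∈ (Finset.univ.filter fun A : Finset (Fin r) => r ≤ 2 * A.card),
        {ω | ∀ j ∈ A, G j fun i => X i ω} := by
    rintro ω ⟨A, hA, hω⟩
    simp only [Set.mem_iUnion]
    exact ⟨A, by simpa using hA, hω⟩
  refine (measure_mono hsub).trans ((measure_biUnion_finset_le _ _).trans ?_)
  -- At least `r / 2` of the events occur, with probability at most `8⁻¹ ^ r` for a given choice of
  -- them; the `2 ^ r` choices leave `4⁻¹ ^ r`.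
  have h64 : (64 : ENNReal)⁻¹ = 8⁻¹ ^ 2 := by
    rw [← ENNReal.inv_pow]; norm_num
  have h8 : (8 : ENNReal)⁻¹ ≤ 1 := ENNReal.inv_le_one.2 (by norm_num)
  have h4 : (2 : ENNReal) * 8⁻¹ = 4⁻¹ := by
    have h28 : (8 : ENNReal) = 2 * 4 := by norm_num
    rw [h28, ENNReal.mul_inv (by norm_num) (by norm_num), ← mul_assoc,
      ENNReal.mul_inv_cancel (by norm_num) (by norm_num), one_mul]
  calc ∑ A ∈ Finset.univ.filter fun A : Finset (Fin r) => r ≤ 2 * A.card,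
        μ {ω | ∀ j ∈ A, G j fun i => X i ω}
      ≤ ∑ A ∈ Finset.univ.filter fun A : Finset (Fin r) => r ≤ 2 * A.card, (8 : ENNReal)⁻¹ ^ r := by
        refine Finset.sum_le_sum fun A hA => (measure_forall_le_pow hX hind hB hG hε A).trans ?_
        rw [h64, ← pow_mul]
        exact pow_le_pow_right_of_le_one' h8 (by simpa using hA)
    _ ≤ ∑ _A : Finset (Fin r), (8 : ENNReal)⁻¹ ^ r :=
        Finset.sum_le_sum_of_subset (Finset.filter_subset _ _)
    _ = 4⁻¹ ^ r := by
        rw [Finset.sum_const, Finset.card_univ, Fintype.card_finset, Fintype.card_fin, nsmul_eq_mul,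
          ← h4, mul_pow]
        push_cast
        rfl

/-- The mean of `m` independent samples is within `1 / K` of the expectation, except with probability
at most `K² / m`. -/
lemma measure_mean_le (hX : ∀ i, Measurable (X i)) (hind : iIndepFun X μ) {F : α → ℝ} {g : ℝ}
    (hmean : ∀ i, ∫ ω, F (X i ω) ∂μ = g) (hsq : ∀ i, ∫ ω, F (X i ω) ^ 2 ∂μ ≤ 1) {K m : ℕ} (hK : 0 < K)
    (hm : 64 * K ^ 2 ≤ m) (s : ℕ) :
    μ {ω | 1 / (K : ℝ) < |(∑ i ∈ Finset.range m, F (X (s + i) ω)) / m - g|} ≤ 64⁻¹ := by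
  have hF : Measurable F := measurable_of_finite F
  have hm0 : (0 : ℝ) < m := by
    have : 0 < m := lt_of_lt_of_le (by positivity) hm
    exact_mod_cast this
  have hK0 : (0 : ℝ) < K := by exact_mod_cast hK
  have hLp : ∀ i, MemLp (fun ω => F (X i ω)) 2 μ := by
    intro i
    obtain ⟨C, hC⟩ : ∃ C, ∀ x, ‖F x‖ ≤ C := by
      obtain ⟨C, hC⟩ := (Set.finite_range fun x => ‖F x‖).bddAbove
      exact ⟨C, fun x => hC ⟨x, rfl⟩⟩
    exact MemLp.of_bound (hF.comp (hX i)).aestronglyMeasurable C (ae_of_all _ fun ω => hC _)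
  have hvar : ∀ i, variance (fun ω => F (X i ω)) μ ≤ 1 := fun i =>
    (variance_le_expectation_sq (hLp i).1).trans (hsq i)
  set Y : Ω → ℝ := ∑ i ∈ Finset.range m, fun ω => F (X (s + i) ω) with hY
  have hYapp : ∀ ω, Y ω = ∑ i ∈ Finset.range m, F (X (s + i) ω) := fun ω => by
    rw [hY, Finset.sum_apply]
  have hYLp : MemLp Y 2 μ := memLp_finsetSum' _ fun i _ => hLp _
  have hYvar : variance Y μ ≤ m := by
    rw [hY, IndepFun.variance_sum (fun i _ => hLp _)]
    · refine (Finset.sum_le_sum fun i _ => hvar _).trans ?_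
      simp
    · intro i _ j _ hij
      have : s + i ≠ s + j := by omega
      exact (hind.indepFun this).comp hF hF
  have hYmean : ∫ ω, Y ω ∂μ = m * g := by
    simp_rw [hYapp]
    rw [integral_finsetSum _ fun i _ => (hLp _).integrable one_le_two]
    simp [hmean]
  have hc : 0 < (m : ℝ) / K := by positivity
  -- Chebyshev's inequality for the sum: a deviation of `m / K` with variance at most `m` has
  -- probability at most `K ^ 2 / m ≤ 1 / 64`.
  have := meas_ge_le_variance_div_sq hYLp hc
  rw [hYmean] at this
  refine (measure_mono fun ω hω => ?_).trans (this.trans ?_)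
  · have h1 : (1 : ℝ) / K < |Y ω / m - g| := by rw [hYapp]; exact hω
    have h2 : Y ω - m * g = m * (Y ω / m - g) := by field_simp
    change (m : ℝ) / K ≤ |Y ω - m * g|
    rw [h2, abs_mul, abs_of_pos hm0, div_eq_mul_one_div]
    gcongr
  · have h64 : (64 : ENNReal)⁻¹ = ENNReal.ofReal (64⁻¹ : ℝ) := by
      rw [ENNReal.ofReal_inv_of_pos (by norm_num)]; norm_num
    rw [h64]
    refine ENNReal.ofReal_le_ofReal ?_
    have hm' : 64 * (K : ℝ) ^ 2 ≤ m := by exact_mod_cast hm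
    rw [div_pow, div_div_eq_mul_div, div_le_iff₀ (by positivity)]
    calc variance Y μ * (K : ℝ) ^ 2 ≤ m * (K : ℝ) ^ 2 := by gcongr
      _ = 64⁻¹ * ((m : ℝ) * (64 * (K : ℝ) ^ 2)) := by ring
      _ ≤ 64⁻¹ * ((m : ℝ) * m) := by gcongr
      _ = 64⁻¹ * (m : ℝ) ^ 2 := by ring

/-- The median of `r` means is within `1 / K` of the expectation, except with probability at
most `4⁻ʳ`. -/
lemma measure_medianOfMeans_le [Inhabited α] (hX : ∀ i, Measurable (X i)) (hind : iIndepFun X μ) {F : α → ℝ} {g : ℝ}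
    (hmean : ∀ i, ∫ ω, F (X i ω) ∂μ = g) (hsq : ∀ i, ∫ ω, F (X i ω) ^ 2 ∂μ ≤ 1) {K m : ℕ} (hK : 0 < K)
    (hm : 64 * K ^ 2 ≤ m) (s r : ℕ) :
    μ {ω | ∃ v, IsMedianOfMeans F (fun i => X i ω) s r m v ∧ 1 / (K : ℝ) < |v - g|} ≤ 4⁻¹ ^ r := by
  set G : Fin r → (ℕ → α) → Prop := fun j x =>
    1 / (K : ℝ) < |(∑ i ∈ Finset.range m, F (x (s + (j * m + i)))) / m - g| with hGdef
  set B : Fin r → Finset ℕ := fun j => Finset.Ico (s + j * m) (s + j * m + m) with hBdef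
  have hB : ∀ i j, i ≠ j → Disjoint (B i) (B j) := by
    intro i j hij
    rw [Finset.disjoint_left]
    intro a ha hb
    simp only [hBdef, Finset.mem_Ico] at ha hb
    have hij' : (i : ℕ) ≠ j := fun h => hij (Fin.ext h)
    rcases Nat.lt_or_gt_of_ne hij' with h | h
    · have := Nat.mul_le_mul_right m (Nat.succ_le_of_lt h)
      rw [Nat.succ_mul] at this
      omega
    · have := Nat.mul_le_mul_right m (Nat.succ_le_of_lt h)
      rw [Nat.succ_mul] at this
      omega
  have hG : ∀ j x y, (∀ i ∈ B j, x i = y i) → (G j x ↔ G j y) := by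
    intro j x y h
    have : ∑ i ∈ Finset.range m, F (x (s + (j * m + i))) =
        ∑ i ∈ Finset.range m, F (y (s + (j * m + i))) := Finset.sum_congr rfl fun i hi => by
      rw [h]
      rw [Finset.mem_range] at hi
      simp only [hBdef, Finset.mem_Ico]
      omega
    simp only [hGdef, this]
  refine (measure_mono ?_).trans (measure_half_le hX hind hB hG fun j => ?_)
  · rintro ω ⟨v, hv, hvg⟩
    refine ⟨_, hv.card_ge hvg, fun j hj => ?_⟩
    exact (Finset.mem_filter.1 hj).2
  · have := measure_mean_le hX hind hmean hsq hK hm (s + j * m)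
    simpa only [add_assoc] using this

end Independence

/-! ### Moments of the path-sum estimator -/

section Sampling

variable {n κ S P : ℕ} {H : LocalHamiltonian n κ} {Φ : QState n} {E : Fin S → ℝ}
  {ρ : Basis n → Basis n → ℂ} {Ω : Type} [MeasurableSpace Ω] {μ : Measure Ω} [IsProbabilityMeasure μ]

lemma integral_comp_sample {X : Ω → Basis n} (hX : Measurable X)
    (hlaw : ∀ x, μ {ω | X ω = x} = ENNReal.ofReal (‖Φ x‖ ^ 2)) (F : Basis n → ℝ) :
    ∫ ω, F (X ω) ∂μ = ∑ x, ‖Φ x‖ ^ 2 * F x := by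
  have := Measure.isProbabilityMeasure_map (μ := μ) hX.aemeasurable
  rw [← integral_map hX.aemeasurable (measurable_of_finite F).aestronglyMeasurable,
    integral_fintype (Integrable.of_finite)]
  refine Finset.sum_congr rfl fun x _ => ?_
  rw [Measure.real, Measure.map_apply hX (measurableSet_singleton x), smul_eq_mul]
  have : X ⁻¹' {x} = {ω | X ω = x} := rfl
  rw [this, hlaw, ENNReal.toReal_ofReal (sq_nonneg _)]

lemma pathSum_eq_div (hρ : ∀ x y, Φ x ≠ 0 → ρ x y = Φ y / Φ x) (k : ℕ) {x : Basis n} (hx : Φ x ≠ 0) :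
    pathSum H ρ k x = (stepMatrix H ^ k *ᵥ Φ.ofLp) x / Φ x := by
  rw [pathSum_eq]
  have : ρ x = (Φ x)⁻¹ • Φ.ofLp := by
    funext y
    rw [hρ x y hx, Pi.smul_apply, smul_eq_mul, div_eq_inv_mul]
  rw [this, Matrix.mulVec_smul, Pi.smul_apply, smul_eq_mul, div_eq_inv_mul]

/-- The estimator is unbiased: the weight `‖Φ x‖ ^ 2` turns the denominator `Φ x` into a factor
`conj (Φ x)`. Strings of amplitude zero have weight zero, so the unspecified ratios there do no
harm. -/
lemma sum_mul_pathSum_re (hρ : ∀ x y, Φ x ≠ 0 → ρ x y = Φ y / Φ x) (k : ℕ) :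
    ∑ x, ‖Φ x‖ ^ 2 * (pathSum H ρ k x).re = (decaySignal H Φ k).re := by
  rw [decaySignal, dotProduct, Complex.re_sum]
  refine Finset.sum_congr rfl fun x _ => ?_
  rw [← Complex.re_ofReal_mul]
  congr 1
  by_cases hx : Φ x = 0
  · simp [hx]
  · rw [pathSum_eq_div hρ k hx, Complex.ofReal_pow, ← Complex.conj_mul']
    simp only [Pi.star_apply, RCLike.star_def]
    field_simp

/-- The weights cancel the squared denominators, so the second moment is bounded by the squared norm
of `stepMatrix H ^ k *ᵥ Φ`, however small individual amplitudes are. -/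
lemma SpectralPromise.sum_mul_pathSum_re_sq_le (h : SpectralPromise H Φ E P)
    (hρ : ∀ x y, Φ x ≠ 0 → ρ x y = Φ y / Φ x) (k : ℕ) :
    ∑ x, ‖Φ x‖ ^ 2 * (pathSum H ρ k x).re ^ 2 ≤ 1 := by
  obtain ⟨-, -, -, -, -, h5⟩ := h.exists_signal
  refine (Finset.sum_le_sum fun x _ => ?_).trans (h5 k)
  by_cases hx : Φ x = 0
  · rw [hx]
    simp only [norm_zero, ne_eq, OfNat.ofNat_ne_zero, not_false_eq_true, zero_pow, zero_mul]
    positivity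
  · have h1 : ‖(stepMatrix H ^ k *ᵥ Φ.ofLp) x‖ = ‖Φ x‖ * ‖pathSum H ρ k x‖ := by
      rw [pathSum_eq_div hρ k hx, norm_div, mul_div_cancel₀]
      exact norm_ne_zero_iff.2 hx
    rw [h1, mul_pow]
    refine mul_le_mul_of_nonneg_left ?_ (sq_nonneg _)
    rw [← sq_abs]
    exact pow_le_pow_left₀ (abs_nonneg _) (Complex.abs_re_le_norm _) 2

lemma SpectralPromise.decaySignal_im (h : SpectralPromise H Φ E P) (k : ℕ) :
    (decaySignal H Φ k).im = 0 := by
  obtain ⟨p, -, -, -, h4, -⟩ := h.exists_signal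
  rw [h4, Complex.im_sum]
  refine Finset.sum_eq_zero fun l _ => ?_
  rw [← Complex.ofReal_pow, ← Complex.ofReal_mul, Complex.ofReal_im]

/-- With probability at least `1 - 2⁻ᵗ`, all medians of means are within `1 / K` of the signal. -/
lemma SpectralPromise.measure_signal_le (h : SpectralPromise H Φ E P)
    (hρ : ∀ x y, Φ x ≠ 0 → ρ x y = Φ y / Φ x) {X : ℕ → Ω → Basis n} (hX : ∀ i, Measurable (X i))
    (hind : iIndepFun X μ) (hlaw : ∀ i x, μ {ω | X i ω = x} = ENNReal.ofReal (‖Φ x‖ ^ 2))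
    {K m : ℕ} (hK : 0 < K) (hm : 64 * K ^ 2 ≤ m) (t : ℕ) :
    μ {ω | ∃ k < 2 * S + 1, ∃ v, IsMedianOfMeans (fun x => (pathSum H ρ k x).re) (fun i => X i ω)
      (k * ((t + (2 * S + 1)) * m)) (t + (2 * S + 1)) m v ∧
      1 / (K : ℝ) < |v - (decaySignal H Φ k).re|} ≤ 2⁻¹ ^ t := by
  set L := 2 * S + 1 with hL
  have hsub : {ω | ∃ k < L, ∃ v, IsMedianOfMeans (fun x => (pathSum H ρ k x).re)
      (fun i => X i ω) (k * ((t + L) * m)) (t + L) m v ∧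
      1 / (K : ℝ) < |v - (decaySignal H Φ k).re|} ⊆ ⋃ k ∈ Finset.range L,
      {ω | ∃ v, IsMedianOfMeans (fun x => (pathSum H ρ k x).re)
      (fun i => X i ω) (k * ((t + L) * m)) (t + L) m v ∧
      1 / (K : ℝ) < |v - (decaySignal H Φ k).re|} := by
    rintro ω ⟨k, hk, hω⟩
    simp only [Set.mem_iUnion]
    exact ⟨k, Finset.mem_range.2 hk, hω⟩
  refine (measure_mono hsub).trans ((measure_biUnion_finset_le _ _).trans ?_)
  have h4 : (4 : ENNReal)⁻¹ = 2⁻¹ * 2⁻¹ := by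
    rw [← ENNReal.mul_inv (by norm_num) (by norm_num)]; norm_num
  have h2 : (2 : ENNReal)⁻¹ ≤ 1 := ENNReal.inv_le_one.2 (by norm_num)
  -- The `L` additional groups absorb the factor `L ≤ 2 ^ L` of the union bound.
  calc _ ≤ ∑ _k ∈ Finset.range L, (4 : ENNReal)⁻¹ ^ (t + L) := by
        refine Finset.sum_le_sum fun k _ =>
          measure_medianOfMeans_le hX hind (fun i => ?_) (fun i => ?_) hK hm _ _
        · rw [integral_comp_sample (hX i) (hlaw i) fun x => (pathSum H ρ k x).re,
            sum_mul_pathSum_re hρ]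
        · rw [integral_comp_sample (hX i) (hlaw i) fun x => (pathSum H ρ k x).re ^ 2]
          exact h.sum_mul_pathSum_re_sq_le hρ k
    _ = L * (4 : ENNReal)⁻¹ ^ (t + L) := by simp
    _ ≤ 2 ^ L * (2⁻¹ ^ t * 2⁻¹ ^ L) := by
        refine mul_le_mul' (by exact_mod_cast L.lt_two_pow_self.le) ?_
        rw [h4, ← pow_add, mul_pow]
        exact mul_le_of_le_one_right' (pow_le_one' h2 _)
    _ = 2⁻¹ ^ t := by
        rw [mul_left_comm, ← mul_pow, ENNReal.mul_inv_cancel (by norm_num) (by norm_num), one_pow,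
          mul_one]

end Sampling

/-! ## Polynomials with natural coefficients -/

lemma Polynomial.eval_mono_nat (f : Polynomial ℕ) {a b : ℕ} (h : a ≤ b) : f.eval a ≤ f.eval b := by
  rw [eval_eq_sum_range, eval_eq_sum_range]
  gcongr

/-- The program computes its resolution as a power of `n + c`, so polynomial demands are rounded up
to that form. The bound `64 ≤ c` later supplies the constant in Chebyshev's inequality. -/
lemma Polynomial.exists_eval_le_pow (f : Polynomial ℕ) :
    ∃ c d : ℕ, 64 ≤ c ∧ ∀ n, f.eval n ≤ (n + c) ^ d := by
  refine ⟨64 + ∑ i ∈ Finset.range (f.natDegree + 1), f.coeff i, f.natDegree + 1, by omega,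
    fun n => ?_⟩
  set s := ∑ i ∈ Finset.range (f.natDegree + 1), f.coeff i with hs
  rw [eval_eq_sum_range, pow_succ']
  calc ∑ i ∈ Finset.range (f.natDegree + 1), f.coeff i * n ^ i
      ≤ ∑ i ∈ Finset.range (f.natDegree + 1), f.coeff i * (n + (64 + s)) ^ f.natDegree := by
        refine Finset.sum_le_sum fun i hi => Nat.mul_le_mul_left _ ?_
        rw [Finset.mem_range] at hi
        exact (Nat.pow_le_pow_left (Nat.le_add_right n _) i).trans
          (Nat.pow_le_pow_right (by omega) (by omega))
    _ = s * (n + (64 + s)) ^ f.natDegree := by rw [hs, Finset.sum_mul]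
    _ ≤ _ := Nat.mul_le_mul_right _ (by omega)

/-! ## The algorithm for a given number of eigenvalues -/

section Setup

variable {n κ : ℕ} {A : Access n κ}

/-- Store the resolution `(n + c) ^ d` in register `5` and the group size `(n + c) ^ (2 d + 1)` in
register `6`. -/
def resolutionProg (d : ℕ) : Prog := .seq (powProg 5 d) (powProg 6 (2 * d + 1))

/-- Store the number of groups in register `7` and the number of grid points in register `8`. -/
def groupsProg (S : ℕ) : Prog :=
  .seq (.setNat (.const 7) (.add (.reg 3) (.const (2 * S + 1))))
    (.setNat (.const 8) (.add (.reg 5) (.const 1)))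

/-- Compute the signal. -/
noncomputable def estimateProg (κ S : ℕ) : Prog :=
  signalProg κ 20 (20 + (2 * S + 1) * (3 * κ + 2)) (3 * S + 1) (5 * S + 6) (2 * S + 1)

/-- Compute the energies. -/
def polesProg (S : ℕ) : Prog := searchProg (3 * S + 1) S (residualConst S) S 0

/-- The algorithm for `S` eigenvalues. -/
noncomputable def resolveProg (κ S c d : ℕ) : Prog :=
  .seq (.setNat (.const 4) (.add (.reg 0) (.const c))) (.seq (resolutionProg d)
    (.seq (groupsProg S) (.seq (estimateProg κ S) (polesProg S))))

lemma resolutionProg_natFrame {d : ℕ} : (resolutionProg d).NatFrame fun c => c = 5 ∨ c = 6 ∨ c = 10 :=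
  ⟨(powProg_natFrame d).mono fun _ _ => by omega, (powProg_natFrame _).mono fun _ _ => by omega⟩

lemma groupsProg_natFrame {S : ℕ} : (groupsProg S).NatFrame fun c => c = 7 ∨ c = 8 :=
  ⟨Or.inl rfl, Or.inr rfl⟩

/-- The registers before the sampling starts. -/
lemma setup_run {S c d : ℕ} {s u v w : MState} (hd : s.draws = 0)
    (hu : u = (Prog.setNat (.const 4) (.add (.reg 0) (.const c))).run A s)
    (hv : v = (resolutionProg d).run A u) (hw : w = (groupsProg S).run A v) :
    w.draws = 0 ∧ (∀ a < 4, w.nat a = s.nat a) ∧ w.nat 4 = s.nat 0 + c ∧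
      w.nat 5 = (s.nat 0 + c) ^ d ∧ w.nat 6 = (s.nat 0 + c) ^ (2 * d + 1) ∧
      w.nat 7 = s.nat 3 + (2 * S + 1) ∧ w.nat 8 = (s.nat 0 + c) ^ d + 1 ∧ w.nat 9 = s.nat 9 := by
  have hu' : ∀ a, a ≠ 4 → u.nat a = s.nat a := fun a ha => by simp [hu, Prog.run, ha]
  have hu4 : u.nat 4 = s.nat 0 + c := by simp [hu, Prog.run]
  have hv' : ∀ a, ¬ (a = 5 ∨ a = 6 ∨ a = 10) → v.nat a = u.nat a := fun a ha => by
    rw [hv, Prog.run_nat_of_natFrame A resolutionProg_natFrame _ ha]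
  have hw' : ∀ a, ¬ (a = 7 ∨ a = 8) → w.nat a = v.nat a := fun a ha => by
    rw [hw, Prog.run_nat_of_natFrame A groupsProg_natFrame _ ha]
  have hv5 : v.nat 5 = (s.nat 0 + c) ^ d := by
    rw [← hu4, ← powProg_run (A := A) (show 5 ≠ 4 by decide) (show 5 ≠ 10 by decide) u d,
      ← Prog.run_nat_of_natFrame A (powProg_natFrame (a := 6) (2 * d + 1)) ((powProg 5 d).run A u)
        (show ¬ (5 = 6 ∨ 5 = 10) by decide), hv]
    rfl
  have hv6 : v.nat 6 = (s.nat 0 + c) ^ (2 * d + 1) := by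
    rw [← hu4, ← Prog.run_nat_of_natFrame A (powProg_natFrame (a := 5) d) u
      (show ¬ (4 = 5 ∨ 4 = 10) by decide),
      ← powProg_run (A := A) (show 6 ≠ 4 by decide) (show 6 ≠ 10 by decide) _ (2 * d + 1), hv]
    rfl
  refine ⟨?_, fun a ha => ?_, ?_, ?_, ?_, ?_, ?_, ?_⟩
  · rw [hw, Prog.run_draws_of_noSample A (P := groupsProg S) ⟨trivial, trivial⟩, hv,
      Prog.run_draws_of_noSample A (P := resolutionProg d)
        ⟨powProg_noSample _, powProg_noSample _⟩, hu, ← hd]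
    rfl
  · rw [hw' a (by omega), hv' a (by omega), hu' a (by omega)]
  · rw [hw' 4 (by omega), hv' 4 (by omega), hu4]
  · rw [hw' 5 (by omega), hv5]
  · rw [hw' 6 (by omega), hv6]
  · have : w.nat 7 = v.nat 3 + (2 * S + 1) := by simp [hw, groupsProg, Prog.run]
    rw [this, hv' 3 (by omega), hu' 3 (by omega)]
  · have : w.nat 8 = v.nat 5 + 1 := by simp [hw, groupsProg, Prog.run]
    rw [this, hv5]
  · rw [hw' 9 (by omega), hv' 9 (by omega), hu' 9 (by omega)]

/-- The sum of the effort bounds for the stages of the algorithm. -/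
noncomputable def resolveCost (κ S c d : ℕ) : Polynomial ℕ :=
  (Prog.setNat (.const 4) (.add (.reg 0) (.const c))).cost κ + (resolutionProg d).cost κ +
    (groupsProg S).cost κ + (estimateProg κ S).cost κ + (polesProg S).cost κ + Polynomial.C 4

lemma estimateProg_natFrame {S : ℕ} : (estimateProg κ S).NatFrame (10 ≤ ·) :=
  signalProg_natFrame le_rfl (Nat.le_add_right _ _) _

lemma polesProg_natFrame {S : ℕ} : (polesProg S).NatFrame (10 ≤ ·) :=
  (searchProg_natFrame S 0).mono fun _ _ => by omega

/-- The setup stages write registers that control later loops, so `Prog.effort_le` cannot be applied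
to the whole program. It is applied to each stage with its own threshold between written and
controlling registers. -/
lemma resolveProg_effort_le {S c d B : ℕ} {s : MState} (hd : s.draws = 0) (hn : n ≤ B)
    (hA : A.charge ≤ B) (hs : ∀ a < 10, s.nat a ≤ B) (hc : (s.nat 0 + c) ^ (2 * d + 1) + 1 ≤ B)
    (hc0 : 1 ≤ c) (ht : s.nat 3 + (2 * S + 1) ≤ B) :
    ((resolveProg κ S c d).run A s).effort ≤ s.effort + (resolveCost κ S c d).eval B := by
  obtain ⟨u, hu⟩ : ∃ u, u = (Prog.setNat (.const 4) (.add (.reg 0) (.const c))).run A s := ⟨_, rfl⟩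
  obtain ⟨v, hv⟩ : ∃ v, v = (resolutionProg d).run A u := ⟨_, rfl⟩
  obtain ⟨w, hw⟩ : ∃ w, w = (groupsProg S).run A v := ⟨_, rfl⟩
  obtain ⟨x, hx⟩ : ∃ x, x = (estimateProg κ S).run A w := ⟨_, rfl⟩
  obtain ⟨y, hy⟩ : ∃ y, y = (polesProg S).run A x := ⟨_, rfl⟩
  obtain ⟨-, w3, w4, w5, w6, w7, w8, w9⟩ := setup_run hd hu hv hw
  have hp1 : s.nat 0 + c ≤ (s.nat 0 + c) ^ (2 * d + 1) := Nat.le_self_pow (by omega) _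
  have hp2 : (s.nat 0 + c) ^ d ≤ (s.nat 0 + c) ^ (2 * d + 1) :=
    Nat.pow_le_pow_right (by omega) (by omega)
  have hu' : ∀ a < 10, u.nat a ≤ B := by
    intro a ha
    by_cases h4 : a = 4
    · subst h4
      have : u.nat 4 = s.nat 0 + c := by simp [hu, Prog.run]
      omega
    · have : u.nat a = s.nat a := by simp [hu, Prog.run, h4]
      rw [this]; exact hs a ha
  have hw' : ∀ a < 10, w.nat a ≤ B := by
    intro a ha
    rcases lt_or_ge a 4 with h | h
    · rw [w3 a h]; exact hs a ha
    · have := hs 9 (by omega)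
      interval_cases a <;> omega
  have hv' : ∀ a < 7, v.nat a ≤ B := by
    intro a ha
    rw [← Prog.run_nat_of_natFrame A (groupsProg_natFrame (S := S)) v (c := a) (by omega), ← hw]
    exact hw' a (by omega)
  have hx' : ∀ a < 10, x.nat a ≤ B := by
    intro a ha
    rw [hx, Prog.run_nat_of_natFrame A estimateProg_natFrame _ (by omega)]
    exact hw' a ha
  have e1 := Prog.effort_le (P := .setNat (.const 4) (.add (.reg 0) (.const c))) (L := 4) A
    (le_refl 4) trivial hn hA s fun a ha => hs a (by omega)
  have e2 := Prog.effort_le (P := resolutionProg d) (L := 5) A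
    (resolutionProg_natFrame.mono fun _ _ => by omega)
    ⟨powProg_loopsOn (by decide) _, powProg_loopsOn (by decide) _⟩ hn hA u
    fun a ha => hu' a (by omega)
  have e3 := Prog.effort_le (P := groupsProg S) (L := 7) A
    (groupsProg_natFrame.mono fun _ _ => by omega) ⟨trivial, trivial⟩ hn hA v hv'
  have e4 := Prog.effort_le (P := estimateProg κ S) A estimateProg_natFrame
    (signalProg_loopsOn _) hn hA w hw'
  have e5 := Prog.effort_le (P := polesProg S) A polesProg_natFrame (searchProg_loopsOn _ _) hn hA x hx'
  rw [← hu] at e1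
  rw [← hv] at e2
  rw [← hw] at e3
  rw [← hx] at e4
  rw [← hy] at e5
  have : ((resolveProg κ S c d).run A s).effort = y.effort + 4 := by
    rw [hy, hx, hw, hv, hu]; rfl
  rw [this, resolveCost]
  simp only [Polynomial.eval_add, Polynomial.eval_C]
  omega

/-- The state after the estimation of the signal, and the final state. -/
lemma resolveProg_run {S c d : ℕ} {s : MState} (h0 : s.nat 0 = n) (h2 : s.nat 2 = A.ham.length)
    (hd : s.draws = 0) :
    ((resolveProg κ S c d).run A s).draws =
        (2 * S + 1) * ((s.nat 3 + (2 * S + 1)) * (n + c) ^ (2 * d + 1)) ∧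
      (∀ k < 2 * S + 1, ∃ v : ℝ, ((resolveProg κ S c d).run A s).num k = v ∧
        IsMedianOfMeans (fun x => (pathSum A.ham A.ratio k x).re) A.samples
          (k * ((s.nat 3 + (2 * S + 1)) * (n + c) ^ (2 * d + 1))) (s.nat 3 + (2 * S + 1))
          ((n + c) ^ (2 * d + 1)) v) ∧
      ((∃ g : ℕ → ℕ, (∀ j, g j ≤ (n + c) ^ d) ∧
          recurrenceResidual S (fun j => (g j / ((n + c) ^ d : ℕ) : ℂ))
            ((resolveProg κ S c d).run A s).num ≤
            residualConst S / (((n + c) ^ d : ℕ) * ((n + c) ^ d : ℕ))) →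
        StoresPoles S (residualConst S / (((n + c) ^ d : ℕ) * ((n + c) ^ d : ℕ)))
          ((resolveProg κ S c d).run A s).num ((resolveProg κ S c d).run A s)) := by
  obtain ⟨u, hu⟩ : ∃ u, u = (Prog.setNat (.const 4) (.add (.reg 0) (.const c))).run A s := ⟨_, rfl⟩
  obtain ⟨v, hv⟩ : ∃ v, v = (resolutionProg d).run A u := ⟨_, rfl⟩
  obtain ⟨w, hw⟩ : ∃ w, w = (groupsProg S).run A v := ⟨_, rfl⟩
  obtain ⟨x, hx⟩ : ∃ x, x = (estimateProg κ S).run A w := ⟨_, rfl⟩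
  obtain ⟨y, hy⟩ : ∃ y, y = (polesProg S).run A x := ⟨_, rfl⟩
  obtain ⟨wd, w3, w4, w5, w6, w7, w8, w9⟩ := setup_run hd hu hv hw
  rw [h0] at w4 w5 w6 w8
  have hfin : (resolveProg κ S c d).run A s = y.spend 4 := by
    rw [hy, hx, hw, hv, hu]; rfl
  have hx' : ∀ a < 10, x.nat a = w.nat a := fun a ha => by
    rw [hx, Prog.run_nat_of_natFrame A estimateProg_natFrame _ (by omega)]
  have hy' : ∀ k < 2 * S + 1, y.num k = x.num k := fun k hk => by
    rw [hy, polesProg, Prog.run_num_of_numFrame A (searchProg_numFrame S 0) _ (by omega)]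
  -- The signal and the energies occupy the number cells up to `3 * S`. Scratch space starts at `3 *
  -- S + 1` and takes `4 + (2 * S + 1)` cells, hence the means are kept from `5 * S + 6` on.
  obtain ⟨s1, s2⟩ := signalProg_run (A := A) (L₀ := 20)
    (R := 20 + (2 * S + 1) * (3 * κ + 2)) (T := 3 * S + 1) (M := 5 * S + 6)
    (r := s.nat 3 + (2 * S + 1)) (m := (n + c) ^ (2 * d + 1)) (by omega) le_rfl
    (s := w) (by rw [w3 0 (by omega), h0]) (by rw [w3 2 (by omega), h2]) w6 w7 wd (2 * S + 1)
    le_rfl (by omega) (by omega)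
  change ((estimateProg κ S).run A w).draws = _ at s1
  change ∀ k < 2 * S + 1, ∃ v : ℝ, ((estimateProg κ S).run A w).num k = v ∧ _ at s2
  rw [← hx] at s1 s2
  rw [hfin]
  simp only [MState.spend_draws, MState.spend_num]
  refine ⟨?_, fun k hk => ?_, fun hg => ?_⟩
  · rw [hy, polesProg, Prog.run_draws_of_noSample A (searchProg_noSample _ _), s1]
  · rw [hy' k hk]; exact s2 k hk
  -- The search does not touch the signal cells, so the final memory may serve as the signal that is
  -- searched.
  · have := searchProg_run (A := A) (W := 3 * S + 1) (S := S) (b := residualConst S)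
      (K := (n + c) ^ d) le_rfl (y := y.num) S 0 x rfl (by rw [hx' 5 (by omega), w5])
      (by rw [hx' 8 (by omega), w8]) (fun k hk => (hy' k (by omega)).symm)
      (fun j hj => absurd hj (by omega)) (Or.inr (by simpa using hg))
    change StoresPoles _ _ _ ((polesProg S).run A x) at this
    rw [← hy] at this
    exact this

end Setup

/-! ### Assembly of the theorem -/

/-- What the theorem asserts for given numbers of qubits and eigenvalues and a given confidence. -/
def Resolves (κ : ℕ) (p q : Polynomial ℕ) (prog : Prog) (Q : Polynomial ℕ) (n S t : ℕ) : Prop :=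
  ∃ r m : ℕ, 0 < r ∧ 0 < m ∧ (2 * S + 1) * (r * m) ≤ Q.eval n * (t + 1) ∧
    ∀ (H : LocalHamiltonian n κ) (ρ : Basis n → Basis n → ℂ) (τ : ℕ),
      H.length ≤ p.eval n → τ ≤ p.eval n →
      (∀ X : ℕ → Basis n,
        (prog.final ⟨H, ρ, X, τ⟩ S t).effort ≤ Q.eval (n + t) ∧
        (prog.final ⟨H, ρ, X, τ⟩ S t).draws = (2 * S + 1) * (r * m) ∧
        ∀ k ≤ 2 * S, ∃ v : ℝ, (prog.final ⟨H, ρ, X, τ⟩ S t).signal k = (v : ℂ) ∧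
          IsMedianOfMeans (fun x => (pathSum H ρ k x).re) X (k * (r * m)) r m v) ∧
      ∀ (Φ : QState n) (E : Fin S → ℝ), SpectralPromise H Φ E (p.eval n) →
        (∀ x y, Φ x ≠ 0 → ρ x y = Φ y / Φ x) →
        ∀ (Ω : Type) [MeasurableSpace Ω] (μ : Measure Ω) [IsProbabilityMeasure μ]
          (X : ℕ → Ω → Basis n), (∀ i, Measurable (X i)) → iIndepFun X μ →
          (∀ i x, μ {ω | X i ω = x} = ENNReal.ofReal (‖Φ x‖ ^ 2)) →
          μ {ω | ¬ GoodOutput H Φ E (q.eval n)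
              (prog.final ⟨H, ρ, fun i => X i ω, τ⟩ S t)} ≤ (2 : ENNReal)⁻¹ ^ t

lemma GoodOutput.spend {n κ S a : ℕ} {H : LocalHamiltonian n κ} {Φ : QState n} {E : Fin S → ℝ}
    {out : MState} (h : GoodOutput H Φ E a out) (e : ℕ) : GoodOutput H Φ E a (out.spend e) :=
  ⟨h.signal, h.exists_esprit, h.esprit, h.numerical, h.resolved⟩

/-- Accounts for the branch on the number of eigenvalues, which changes nothing but the effort. -/
lemma Resolves.of_final_eq {κ : ℕ} {p q : Polynomial ℕ} {prog prog' : Prog} {Q Q' : Polynomial ℕ}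
    {n S t e : ℕ} (h : Resolves κ p q prog Q n S t)
    (hfin : ∀ A : Access n κ, prog'.final A S t = (prog.final A S t).spend e)
    (hQ : ∀ a, Q.eval a + e ≤ Q'.eval a) : Resolves κ p q prog' Q' n S t := by
  obtain ⟨r, m, hr, hm, hrm, h⟩ := h
  refine ⟨r, m, hr, hm, hrm.trans (Nat.mul_le_mul_right _ ((Nat.le_add_right _ e).trans (hQ n))),
    fun H ρ τ hH hτ => ⟨fun X => ?_, fun Φ E hE hρ Ω _ μ _ X hX hind hlaw => ?_⟩⟩
  · obtain ⟨h1, h2, h3⟩ := (h H ρ τ hH hτ).1 X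
    rw [hfin]
    exact ⟨(Nat.add_le_add_right h1 e).trans (hQ _), h2, h3⟩
  · refine (measure_mono fun ω hω => ?_).trans ((h H ρ τ hH hτ).2 Φ E hE hρ Ω μ X hX hind hlaw)
    intro hgood
    refine hω ?_
    rw [hfin]
    exact hgood.spend e

/-- With `K = (n + c) ^ d` above the required resolution, groups of `m = (n + c) * K ^ 2` samples
satisfy `64 * K ^ 2 ≤ m`. The confidence `t` enters only through the number `t + (2 * S + 1)` of
groups, so the sample count is linear in `t`. -/
lemma exists_resolves (κ : ℕ) {S : ℕ} (hS : 1 ≤ S) (p q : Polynomial ℕ) :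
    ∃ (prog : Prog) (Q : Polynomial ℕ), ∀ n t, Resolves κ p q prog Q n S t := by
  obtain ⟨c, d, hc, hcd⟩ := (Polynomial.C (resolutionConst S) *
    (p + q + 1) ^ (2 * S ^ 2 + S + 1)).exists_eval_le_pow
  -- A common bound for the number of qubits, the charge and all registers that control loops.
  obtain ⟨B, hB⟩ : ∃ B : Polynomial ℕ, B = (Polynomial.X + Polynomial.C c) ^ (2 * d + 1) +
    Polynomial.X + p + Polynomial.C (2 * S + 1) := ⟨_, rfl⟩
  refine ⟨resolveProg κ S c d, (resolveCost κ S c d).comp B + Polynomial.C ((2 * S + 1) ^ 2) *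
    (Polynomial.X + Polynomial.C c) ^ (2 * d + 1), fun n t => ?_⟩
  set K := (n + c) ^ d with hK
  set m := (n + c) ^ (2 * d + 1) with hm
  have hKpos : 0 < K := by positivity
  have hKm : 64 * K ^ 2 ≤ m := by
    have : m = (n + c) * K ^ 2 := by rw [hm, hK, ← pow_mul, ← pow_succ', mul_comm d 2]
    rw [this]
    exact Nat.mul_le_mul_right _ (by omega)
  refine ⟨t + (2 * S + 1), m, by omega, by positivity, ?_, fun H ρ τ hH hτ => ⟨fun X => ?_,
    fun Φ E hE hρ Ω _ μ _ X hX hind hlaw => ?_⟩⟩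
  · have h1 : t + (2 * S + 1) ≤ (2 * S + 1) * (t + 1) := by
      rw [Nat.mul_succ]
      exact Nat.add_le_add_right (Nat.le_mul_of_pos_left t (by omega)) _
    simp only [Polynomial.eval_add, Polynomial.eval_mul, Polynomial.eval_C, Polynomial.eval_pow,
      Polynomial.eval_X]
    rw [← hm]
    calc (2 * S + 1) * ((t + (2 * S + 1)) * m) ≤ (2 * S + 1) * ((2 * S + 1) * (t + 1) * m) := by gcongr
      _ = ((2 * S + 1) ^ 2 * m) * (t + 1) := by ring
      _ ≤ _ := Nat.mul_le_mul_right _ (Nat.le_add_left _ _)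
  · obtain ⟨h1, h2, -⟩ := resolveProg_run (A := (⟨H, ρ, X, τ⟩ : Access n κ)) (S := S) (c := c)
      (d := d) (s := MState.start n S H.length t) rfl rfl rfl
    refine ⟨?_, h1, fun k hk => h2 k (by omega)⟩
    have hBv : B.eval (n + t) = (n + t + c) ^ (2 * d + 1) + (n + t) + p.eval (n + t) + (2 * S + 1) := by
      rw [hB]; simp
    have hpm : p.eval n ≤ p.eval (n + t) := p.eval_mono_nat (Nat.le_add_right _ _)
    have hcm : (n + c) ^ (2 * d + 1) ≤ (n + t + c) ^ (2 * d + 1) :=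
      Nat.pow_le_pow_left (by omega) _
    refine (resolveProg_effort_le (A := (⟨H, ρ, X, τ⟩ : Access n κ)) (B := B.eval (n + t)) rfl
      (by omega) (show τ ≤ _ by omega) (fun a ha => ?_) ?_ (by omega) ?_).trans ?_
    · simp only [MState.start]
      split_ifs <;> omega
    · change (n + c) ^ (2 * d + 1) + 1 ≤ _
      omega
    · change t + (2 * S + 1) ≤ _
      omega
    · simp only [Polynomial.eval_add, Polynomial.eval_comp]
      exact (zero_add _).le.trans (Nat.le_add_right _ _)
  · refine (measure_mono fun ω hω => ?_).trans
      (hE.measure_signal_le hρ hX hind hlaw hKpos hKm t)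
    -- When all medians are precise, correctness of the output is deterministic, so a bad output
    -- forces an imprecise median.
    by_contra hbad
    refine hω ?_
    obtain ⟨-, h2, h3⟩ := resolveProg_run (A := (⟨H, ρ, fun i => X i ω, τ⟩ : Access n κ)) (S := S)
      (c := c) (d := d) (s := MState.start n S H.length t) rfl rfl rfl
    rw [← hK] at h3
    have hfin : (resolveProg κ S c d).final (⟨H, ρ, fun i => X i ω, τ⟩ : Access n κ) S t =
      (resolveProg κ S c d).run ⟨H, ρ, fun i => X i ω, τ⟩ (MState.start n S H.length t) := rfl
    rw [hfin]
    generalize (resolveProg κ S c d).run ⟨H, ρ, fun i => X i ω, τ⟩ (MState.start n S H.length t) =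
      out at h2 h3
    have hsig : ∀ k ≤ 2 * S, ‖out.num k - decaySignal H Φ k‖ ≤ 1 / K := by
      intro k hk
      obtain ⟨v, hv, hmed⟩ := h2 k (by omega)
      have hre : decaySignal H Φ k = ((decaySignal H Φ k).re : ℂ) :=
        Complex.ext rfl (by rw [hE.decaySignal_im, Complex.ofReal_im])
      rw [hv, hre, ← Complex.ofReal_sub, Complex.norm_real, Real.norm_eq_abs]
      by_contra! hlt
      exact hbad ⟨k, by omega, v, hmed, hlt⟩
    refine hE.goodOutput hS ?_ hsig (fun k hk => ?_) (h3 (hE.exists_grid hS hKpos hsig))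
    · simpa using hcd n
    · obtain ⟨v, hv, -⟩ := h2 k (by omega)
      rw [hv, Complex.ofReal_im]

theorem theorem5 (κ S₀ : ℕ) (p q : Polynomial ℕ) :
    ∃ (prog : Prog) (Q : Polynomial ℕ), ∀ n S t : ℕ, 1 ≤ S → S ≤ S₀ →
      ∃ r m : ℕ, 0 < r ∧ 0 < m ∧ (2 * S + 1) * (r * m) ≤ Q.eval n * (t + 1) ∧
        ∀ (H : LocalHamiltonian n κ) (ρ : Basis n → Basis n → ℂ) (τ : ℕ),
          H.length ≤ p.eval n → τ ≤ p.eval n →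
          -- on every run: polynomial effort, and the signal is the median of means of path sums
          (∀ X : ℕ → Basis n,
            (prog.final ⟨H, ρ, X, τ⟩ S t).effort ≤ Q.eval (n + t) ∧
            (prog.final ⟨H, ρ, X, τ⟩ S t).draws = (2 * S + 1) * (r * m) ∧
            ∀ k ≤ 2 * S, ∃ v : ℝ, (prog.final ⟨H, ρ, X, τ⟩ S t).signal k = (v : ℂ) ∧
              IsMedianOfMeans (fun x => (pathSum H ρ k x).re) X (k * (r * m)) r m v) ∧
          -- with probability at least `1 - 2⁻ᵗ`, the eigenvalues are resolved
          ∀ (Φ : QState n) (E : Fin S → ℝ), SpectralPromise H Φ E (p.eval n) →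
            (∀ x y, Φ x ≠ 0 → ρ x y = Φ y / Φ x) →
            ∀ (Ω : Type) [MeasurableSpace Ω] (μ : Measure Ω) [IsProbabilityMeasure μ]
              (X : ℕ → Ω → Basis n), (∀ i, Measurable (X i)) → iIndepFun X μ →
              (∀ i x, μ {ω | X i ω = x} = ENNReal.ofReal (‖Φ x‖ ^ 2)) →
              μ {ω | ¬ GoodOutput H Φ E (q.eval n)
                  (prog.final ⟨H, ρ, fun i => X i ω, τ⟩ S t)} ≤ (2 : ENNReal)⁻¹ ^ t := by
  suffices h : ∃ (prog : Prog) (Q : Polynomial ℕ), ∀ n S t : ℕ, 1 ≤ S → S ≤ S₀ →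
      Resolves κ p q prog Q n S t from h
  -- The program text depends on the number of eigenvalues, for instance through the nesting depth
  -- of the search. The programs for `1, …, S₀` are therefore joined by branches on the register
  -- `1`.
  induction S₀ with
  | zero => exact ⟨.skip, 0, fun n S t h1 h2 => absurd h1 (by omega)⟩
  | succ S₀ ih =>
    obtain ⟨prog₁, Q₁, h₁⟩ := ih
    obtain ⟨prog₂, Q₂, h₂⟩ := exists_resolves κ (Nat.le_add_left 1 S₀) p q
    refine ⟨.ite (.natLE (.reg 1) (.const S₀)) prog₁ prog₂, Q₁ + Q₂ + Polynomial.C 5,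
      fun n S t hS hS₀ => ?_⟩
    by_cases hle : S ≤ S₀
    · refine (h₁ n S t hS hle).of_final_eq (e := 5) (fun A => ?_) fun a => ?_
      · have : (Test.natLE (.reg 1) (.const S₀)).holds (MState.start n S A.ham.length t) := hle
        rw [Prog.final, Prog.run, if_pos this]
        rfl
      · simp only [Polynomial.eval_add, Polynomial.eval_C]
        omega
    · obtain rfl : S = S₀ + 1 := by omega
      refine (h₂ n t).of_final_eq (e := 5) (fun A => ?_) fun a => ?_
      · have : ¬ (Test.natLE (.reg 1) (.const S₀)).holds
          (MState.start n (S₀ + 1) A.ham.length t) := hle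
        rw [Prog.final, Prog.run, if_neg this]
        rfl
      · simp only [Polynomial.eval_add, Polynomial.eval_C]
        omega
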